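/- Let $\operatorname{Im}\tau>0$ and let $M=\mathbb C/(\mathbb Z+\tau\mathbb Z)$ carry the Euclidean metric, with area form $\mathrm{vol}=dx\wedge dy$ and total area $V$. The Hodge star acts on one-forms by $*dx=dy$, $*dy=-dx$. The monopole Green function $G(z,a)$ of $M$ is real-valued and is determined, for each $a\in M$, by $-d{*}dG(\cdot,a)=\delta_a-\frac1V\,\mathrm{vol}$ in the sense of currents and $\int_M G(\cdot,a)\,\mathrm{vol}=0$, with $G(\cdot,a)$ integrable on $M$ and continuous on $M\setminus\{a\}$. In the coordinate $z$ of $\mathbb C$ write $G(z,a)=\frac1{2\pi}\big(-\log|z-a|+H(z,a)\big)$ near $z=a$, with $H$ smooth across the diagonal; more generally use this decomposition whenever $z-a\notin(\mathbb Z+\tau\mathbb Z)\setminus\{0\}$. The Bergman kernel and the Schiffer kernel of $M$ are the double differentials $$K(z,a)\,dz\,d\bar a=-\frac2\pi\frac{\partial^2H(z,a)}{\partial z\,\partial\bar a}\,dz\,d\bar a\quad\text{on }M\times M,\qquad L(z,a)\,dz\,da=-4\,\frac{\partial^2G(z,a)}{\partial z\,\partial a}\,dz\,da\quad\text{for }z\ne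 a.$$ For a closed curve $\gamma$ in $M$ put $U_\gamma(a)=\oint_\gamma *dG(\cdot,a)$ for $a\notin\gamma$. The basic holomorphic one-form $\omega_\gamma$ is the regular part of $dU_\gamma+\mathrm i*dU_\gamma$, that is, the holomorphic one-form on all of $M$ that equals $dU_\gamma+\mathrm i*dU_\gamma$ on $M\setminus\gamma$. Let $\alpha,\beta$ be the closed curves given by the oriented segments $[0,1]$ and $[0,\tau]$. Let $$\wp(z)=\frac1{z^2}+\sum_{(m,n)\in\mathbb Z^2\setminus\{(0,0)\}}\Big(\frac1{(z-m-n\tau)^2}-\frac1{(m+n\tau)^2}\Big),$$ and let $\eta_1$ be the constant such that $\zeta(z+1)=\zeta(z)+\eta_1$ for a function $\zeta$ on $\mathbb C\setminus(\mathbb Z+\tau\mathbb Z)$ with $\zeta'=-\wp$. Then $G$ and $\eta_1$ exist, $G$ and $H$ are smooth where they are differentiated above, and $$K(z,a)\,dz\,d\bar a=\frac{dz\,d\bar a}{\operatorname{Im}\tau},\qquad L(z,a)\,dz\,da=\frac1\pi\big(\wp(z-a)+\eta_1\big)dz\,da-\frac{dz\,da}{\operatorname{Im}\tau},$$ $$\omega_\alpha(a)=-\frac{\mathrm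 i\,da}{\operatorname{Im}\tau},\qquad \omega_\beta(a)=-\frac{\mathrm i\,\bar\tau\,da}{\operatorname{Im}\tau}.$$ -/

import Mathlib

open MeasureTheory
open scoped ContDiff

noncomputable section

/-! ### The flat torus -/

/-- The period pair `(1, τ)`. -/
def torusPeriods (τ : UpperHalfPlane) : PeriodPair where
  ω₁ := 1
  ω₂ := (τ : ℂ)
  indep := by
    rw [LinearIndependent.pair_iff]
    intro s t h
    have him := congrArg Complex.im h
    have hre := congrArg Complex.re h
    simp at him hre
    have ht : t = 0 := by
      rcases him with h0 | h0
      · exact h0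
      · exact absurd h0 τ.im_pos.ne'
    subst ht
    simpa using hre

/-- The torus `M = ℂ / (ℤ + τℤ)`. -/
abbrev FlatTorus (τ : UpperHalfPlane) : Type := ℂ ⧸ (torusPeriods τ).lattice.toAddSubgroup

/-- The projection `ℂ → M`. Its local inverses are the local coordinates of `M`, the flat metric
of `M` is `|dz|²` in each of them, and all of them identify every tangent space of `M` with `ℂ`. -/
def torusProj (τ : UpperHalfPlane) (z : ℂ) : FlatTorus τ := QuotientAddGroup.mk z

/-- The fundamental period parallelogram `F` spanned by `1` and `τ`. -/
def periodParallelogram (τ : UpperHalfPlane) : Set ℂ :=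
  {z | ∃ s ∈ Set.Ico (0 : ℝ) 1, ∃ t ∈ Set.Ico (0 : ℝ) 1, z = s + t * (τ : ℂ)}

/-- The integral `∫_M f vol` with respect to the Euclidean area. -/
def flatTorusIntegral (τ : UpperHalfPlane) (f : FlatTorus τ → ℝ) : ℝ :=
  ∫ z in periodParallelogram τ, f (torusProj τ z)

/-- Integrability of a function on `M` with respect to the Euclidean area. -/
def FlatTorusIntegrable (τ : UpperHalfPlane) (f : FlatTorus τ → ℝ) : Prop :=
  IntegrableOn (fun z : ℂ => f (torusProj τ z)) (periodParallelogram τ) volume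

/-- The total area `V = vol(M)`. -/
def flatTorusArea (τ : UpperHalfPlane) : ℝ := volume.real (periodParallelogram τ)

/-! ### The monopole Green function -/

/-- `G` is the monopole Green function of the flat torus: for every `a`,
`-d*dG(·,a) = δ_a - vol / V` in the sense of currents (tested against all smooth `φ` on `M`,
with `d*dφ = Δφ vol`) and `∫_M G(·,a) vol = 0`. As usual `G(·,a)` is taken to be the
representative that is continuous on `M ∖ {a}`; the value at the pole is left free. -/
structure IsMonopoleGreen (τ : UpperHalfPlane) (G : FlatTorus τ → FlatTorus τ → ℝ) : Prop where
  integrable : ∀ a, FlatTorusIntegrable τ (fun z => G z a)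
  continuousOn : ∀ a, ContinuousOn (fun z => G z a) {a}ᶜ
  equation : ∀ (a : FlatTorus τ) (φ : FlatTorus τ → ℝ),
    ContDiff ℝ ∞ (fun z : ℂ => φ (torusProj τ z)) →
    -(∫ z in periodParallelogram τ,
        G (torusProj τ z) a * Laplacian.laplacian (fun w : ℂ => φ (torusProj τ w)) z) =
      φ a - 1 / flatTorusArea τ * flatTorusIntegral τ φ
  normalized : ∀ a, flatTorusIntegral τ (fun z => G z a) = 0

/-! ### Wirtinger derivatives and differentials -/

/-- `∂f/∂z = (∂f/∂x - i ∂f/∂y) / 2`. -/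
def wirtinger (f : ℂ → ℂ) (z : ℂ) : ℂ :=
  (fderiv ℝ f z 1 - Complex.I * fderiv ℝ f z Complex.I) / 2

/-- `∂f/∂z̄ = (∂f/∂x + i ∂f/∂y) / 2`. -/
def wirtingerBar (f : ℂ → ℂ) (z : ℂ) : ℂ :=
  (fderiv ℝ f z 1 + Complex.I * fderiv ℝ f z Complex.I) / 2

/-- `∂²F/∂z∂a`. -/
def mixedDeriv (F : ℂ → ℂ → ℝ) (z a : ℂ) : ℂ :=
  wirtinger (fun w => wirtinger (fun b => (F w b : ℂ)) a) z

/-- `∂²F/∂z∂ā`. -/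
def mixedDerivBar (F : ℂ → ℂ → ℝ) (z a : ℂ) : ℂ :=
  wirtinger (fun w => wirtingerBar (fun b => (F w b : ℂ)) a) z

/-- Values at a point of `M × M` of double differentials: real-bilinear maps of a tangent vector
in the first variable and a tangent vector in the second one. -/
abbrev DoubleForm : Type := ℂ →L[ℝ] ℂ →L[ℝ] ℂ

/-- `dz da : (v, w) ↦ v * w`. -/
def dzda : DoubleForm := ContinuousLinearMap.mul ℝ ℂ

/-- `dz dā : (v, w) ↦ v * conj w`. -/
def dzdaBar : DoubleForm :=
  (ContinuousLinearMap.mul ℝ ℂ).bilinearComp (ContinuousLinearMap.id ℝ ℂ) (Complex.conjCLE : ℂ →L[ℝ] ℂ)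

/-- `da : v ↦ v`. -/
def oneFormDa : ℂ →L[ℝ] ℂ := ContinuousLinearMap.id ℝ ℂ

/-- The Hodge star on one-forms, `*dx = dy`, `*dy = -dx`, that is `(*ψ)(v) = -ψ(i v)`. -/
def hodgeStar {E : Type*} [NormedAddCommGroup E] [NormedSpace ℝ E] (ψ : ℂ →L[ℝ] E) :
    ℂ →L[ℝ] E :=
  -(ψ.comp (ContinuousLinearMap.mul ℝ ℂ Complex.I))

/-! ### The Bergman and Schiffer kernels -/

/-- `K` is the Bergman kernel `K(z,a) dz dā = -(2/π) ∂²H/∂z∂ā dz dā`, where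
`G(z,a) = (1/2π) (-log|z - a| + H(z,a))` and `H` is the regular part of `G`, smooth also across
the diagonal. Here `z` and `a` are coordinates of two points of `M` for which `-log|z - a|` only
accounts for the pole at `z = a`, that is, `z` and `a` are equal if they lie over the same point
of `M`. Every point of `M × M` has such coordinates. -/
def IsBergmanKernel (τ : UpperHalfPlane) (G : FlatTorus τ → FlatTorus τ → ℝ)
    (K : FlatTorus τ → FlatTorus τ → DoubleForm) : Prop :=
  ∃ H : ℂ → ℂ → ℝ,
    (∀ z a : ℂ, torusProj τ z ≠ torusProj τ a →
      G (torusProj τ z) (torusProj τ a) =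
        1 / (2 * Real.pi) * (-Real.log ‖z - a‖ + H z a)) ∧
    (∀ z a : ℂ, (torusProj τ z = torusProj τ a → z = a) →
      ContDiffAt ℝ ∞ (fun p : ℂ × ℂ => H p.1 p.2) (z, a) ∧
      K (torusProj τ z) (torusProj τ a) = (-(2 / Real.pi : ℂ) * mixedDerivBar H z a) • dzdaBar)

/-- `L` is the Schiffer kernel `L(z,a) dz da = -4 ∂²G/∂z∂a dz da`, off the diagonal of `M × M`
(where it has its pole). -/
def IsSchifferKernel (τ : UpperHalfPlane) (G : FlatTorus τ → FlatTorus τ → ℝ)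
    (L : FlatTorus τ → FlatTorus τ → DoubleForm) : Prop :=
  ∀ z a : ℂ, torusProj τ z ≠ torusProj τ a →
    ContDiffAt ℝ ∞ (fun p : ℂ × ℂ => G (torusProj τ p.1) (torusProj τ p.2)) (z, a) ∧
    L (torusProj τ z) (torusProj τ a) =
      (-4 * mixedDeriv (fun w b => G (torusProj τ w) (torusProj τ b)) z a) • dzda

/-! ### The basic holomorphic one-forms -/

/-- The one-form `*dG(·,a)` in the coordinate `z`. -/
def starDGreen (τ : UpperHalfPlane) (G : FlatTorus τ → FlatTorus τ → ℝ) (a : FlatTorus τ)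
    (z : ℂ) : ℂ →L[ℝ] ℝ :=
  hodgeStar (fderiv ℝ (fun w : ℂ => G (torusProj τ w) a) z)

/-- `U_γ(a) = ∮_γ *dG(·,a)`, where the closed curve in `M` is given by a lift `γ` to `ℂ`. -/
def cyclePotential (τ : UpperHalfPlane) (G : FlatTorus τ → FlatTorus τ → ℝ) {p q : ℂ}
    (γ : Path p q) (a : FlatTorus τ) : ℝ :=
  curveIntegral (starDGreen τ G a) γ

/-- `θ = f(a) da` with a holomorphic function `f` on the torus. -/
def IsHolomorphicOneForm (τ : UpperHalfPlane) (θ : FlatTorus τ → (ℂ →L[ℝ] ℂ)) : Prop :=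
  ∃ f : FlatTorus τ → ℂ, Differentiable ℂ (fun z : ℂ => f (torusProj τ z)) ∧
    ∀ a, θ a = f a • oneFormDa

/-- `θ` is the basic holomorphic one-form `ω_γ`: the regular (holomorphic) part of
`dU_γ + i *dU_γ`, i.e. the one-form that is holomorphic on all of `M` and from which
`dU_γ + i *dU_γ` differs only by a singular part carried by `γ`, so that both agree on
`M ∖ γ`. -/
def IsBasicHolomorphicForm (τ : UpperHalfPlane) (G : FlatTorus τ → FlatTorus τ → ℝ) {p q : ℂ}
    (γ : Path p q) (θ : FlatTorus τ → (ℂ →L[ℝ] ℂ)) : Prop :=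
  IsHolomorphicOneForm τ θ ∧
  ∀ a : ℂ, torusProj τ a ∉ Set.range (fun t => torusProj τ (γ t)) →
    CurveIntegrable (starDGreen τ G (torusProj τ a)) γ ∧
    DifferentiableAt ℝ (fun b : ℂ => cyclePotential τ G γ (torusProj τ b)) a ∧
    θ (torusProj τ a) =
      Complex.ofRealCLM.comp (fderiv ℝ (fun b : ℂ => cyclePotential τ G γ (torusProj τ b)) a) +
      Complex.I • Complex.ofRealCLM.comp
        (hodgeStar (fderiv ℝ (fun b : ℂ => cyclePotential τ G γ (torusProj τ b)) a))

/-! ### The period `η₁` of the Weierstrass zeta function -/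

/-- `η₁` is the additive period of a primitive `ζ` of `-℘` on `ℂ ∖ (ℤ + τℤ)`:
`ζ(z + 1) = ζ(z) + η₁`. -/
def IsEtaOne (τ : UpperHalfPlane) (η₁ : ℂ) : Prop :=
  ∃ ζ : ℂ → ℂ,
    (∀ z : ℂ, z ∉ (torusPeriods τ).lattice →
      HasDerivAt ζ (-(torusPeriods τ).weierstrassP z) z) ∧
    ∀ z : ℂ, z ∉ (torusPeriods τ).lattice → ζ (z + 1) = ζ z + η₁

end

/-! The whole theorem rests on one explicit formula for `G`. The product `θ` has simple zeros
exactly at the lattice points, period 1, and `θ(z + τ) = -e^{-2πiz} θ(z)`. With `y = Im z` and `ψ =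
2πy²/Im τ - 2πy`, the function `N = |θ|² e^{-ψ}` is therefore doubly periodic. Off the lattice `log
|θ|²` is harmonic and `Δψ = 4π/Im τ`, so on the torus `Δ log N = 4πδ₀ - 4π/Im τ`. Hence `G(z,a) =
-(1/4π) log N(z - a) + const`, with the constant fixed by the normalization.

The distributional identity (`setIntegral_log_thetaNorm_mul_laplacian`) comes from the smooth
functions `log (N + δ²)` as `δ → 0`. Uniqueness of `G` off the diagonal
(`IsMonopoleGreen.eq_greenCore`) holds because the difference of two Green functions is orthogonal
to every character of the torus, and the characters span a dense subspace of the continuous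
functions.

The kernels are then second derivatives of `-log |F(z - a)|` plus a quadratic term in `Im (z - a)`.
In `∂²/∂z∂ā` the logarithm drops out and the quadratic term leaves a constant, which is `K`. In
`∂²/∂z∂a` the logarithm contributes `(log θ)''`, which equals `-(℘ + η)` by Liouville's theorem
(`exists_deriv_thetaLogDeriv_eq`). Since `θ'/θ` has period 1, `θ'/θ + ηz` is a primitive of `-℘`
that grows by `η` under `z ↦ z + 1`, so `η = η₁`.

For a closed segment from 0 to `c`, the `a`-dependence of `U_γ` is the imaginary part of `∫ (θ'/θ)(z
- a) dz` plus a linear term. The `a`-derivative of this integral is minus the increment of `θ'/θ`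
under `z ↦ z + c`, which is 0 for `c = 1` and `-2πi` for `c = τ`. So `dU_γ` has constant
coefficients off `γ`, and a holomorphic form is determined by its values on that dense set. -/

/-! ### A theta function given by its infinite product -/

/-- The infinite product `∏ (1 - qⁿ w)`, `n ≥ 0`. -/
noncomputable def qProduct (q w : ℂ) : ℂ := ∏' n : ℕ, (1 + -(q ^ n * w))

theorem summable_norm_qProduct_term {q : ℂ} (hq : ‖q‖ < 1) (w : ℂ) :
    Summable fun n : ℕ => ‖-(q ^ n * w)‖ := by
  simpa using (summable_geometric_of_lt_one (norm_nonneg q) hq).mul_right ‖w‖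

theorem qProduct_eq_mul {q : ℂ} (hq : ‖q‖ < 1) (w : ℂ) :
    qProduct q w = (1 - w) * qProduct q (q * w) := by
  have hm : Multipliable fun n : ℕ => (1 + -(q ^ (n + 1) * w)) :=
    multipliable_one_add_of_summable ((summable_nat_add_iff 1).2 (summable_norm_qProduct_term hq w))
  have h := tprod_eq_zero_mul' (f := fun n : ℕ => (1 + -(q ^ n * w))) hm
  have e : ∀ n : ℕ, 1 + -(q ^ (n + 1) * w) = 1 + -(q ^ n * (q * w)) := fun n => by ring
  simp only [e, pow_zero, one_mul] at h
  rw [sub_eq_add_neg]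
  exact h

theorem qProduct_ne_zero {q : ℂ} (hq : ‖q‖ < 1) {w : ℂ} (hw : ∀ n : ℕ, q ^ n * w ≠ 1) :
    qProduct q w ≠ 0 := by
  apply tprod_one_add_ne_zero_of_summable _ (summable_norm_qProduct_term hq w)
  intro n h
  exact hw n (by linear_combination -h)

theorem differentiable_qProduct {q : ℂ} (hq : ‖q‖ < 1) : Differentiable ℂ (qProduct q) := by
  have key : ∀ R : ℝ, DifferentiableOn ℂ (qProduct q) (Metric.ball 0 R) := by
    intro R
    -- On the ball of radius `R` the `n`-th factor differs from 1 by at most `‖q‖ⁿ R`, a convergent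
    -- majorant.
    have hs : Summable fun n : ℕ => ‖q‖ ^ n * R :=
      (summable_geometric_of_lt_one (norm_nonneg q) hq).mul_right R
    have := hs.hasProdLocallyUniformlyOn_nat_one_add (f := fun (n : ℕ) (w : ℂ) => -(q ^ n * w))
      (K := Metric.ball 0 R) Metric.isOpen_ball
      (.of_forall fun n w hw => by
        have hw' : ‖w‖ ≤ R := by simpa using (Metric.mem_ball.1 hw).le
        simpa using mul_le_mul_of_nonneg_left hw' (by positivity))
      (fun n => by fun_prop)
    refine this.differentiableOn (.of_forall fun s => ?_) Metric.isOpen_ball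
    simpa [Finset.prod_fn] using
      DifferentiableOn.finsetProd (fun _ _ => by fun_prop)
  intro w
  exact (key (‖w‖ + 1)).differentiableAt (Metric.isOpen_ball.mem_nhds (by simp))

/-- The periodic exponential `exp (2πiz)`. -/
noncomputable def expTwoPiI (z : ℂ) : ℂ := Complex.exp (2 * Real.pi * Complex.I * z)

theorem expTwoPiI_add (z w : ℂ) : expTwoPiI (z + w) = expTwoPiI z * expTwoPiI w := by
  rw [expTwoPiI, mul_add, Complex.exp_add]; rfl

theorem expTwoPiI_ne_zero (z : ℂ) : expTwoPiI z ≠ 0 := Complex.exp_ne_zero _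

theorem expTwoPiI_neg (z : ℂ) : expTwoPiI (-z) = (expTwoPiI z)⁻¹ := by
  rw [expTwoPiI, mul_neg, Complex.exp_neg]; rfl

theorem expTwoPiI_natCast_mul (n : ℕ) (z : ℂ) : expTwoPiI (n * z) = expTwoPiI z ^ n := by
  rw [expTwoPiI, expTwoPiI, ← Complex.exp_nat_mul]; ring_nf

theorem expTwoPiI_one : expTwoPiI 1 = 1 := by
  rw [expTwoPiI, mul_one, Complex.exp_two_pi_mul_I]

theorem expTwoPiI_eq_one_iff (z : ℂ) : expTwoPiI z = 1 ↔ ∃ n : ℤ, z = n := by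
  rw [expTwoPiI, Complex.exp_eq_one_iff]
  have h2 : (2 * Real.pi * Complex.I : ℂ) ≠ 0 := Complex.two_pi_I_ne_zero
  refine exists_congr fun n => ⟨fun h => ?_, fun h => by rw [h]; ring⟩
  exact mul_left_cancel₀ h2 (by rw [h]; ring)

theorem differentiable_expTwoPiI : Differentiable ℂ expTwoPiI := by
  unfold expTwoPiI; fun_prop

theorem norm_expTwoPiI (z : ℂ) : ‖expTwoPiI z‖ = Real.exp (-2 * Real.pi * z.im) := by
  rw [expTwoPiI, Complex.norm_exp]; congr 1; simp

theorem norm_expTwoPiI_lt_one (τ : UpperHalfPlane) : ‖expTwoPiI τ‖ < 1 := by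
  rw [norm_expTwoPiI, Real.exp_lt_one_iff]
  have := mul_pos Real.pi_pos τ.im_pos
  have h : (τ : ℂ).im = τ.im := rfl
  rw [h]; linarith

theorem mem_torusLattice {τ : UpperHalfPlane} {z : ℂ} :
    z ∈ (torusPeriods τ).lattice ↔ ∃ m n : ℤ, (m : ℂ) + n * τ = z := by
  rw [PeriodPair.mem_lattice]
  simp [torusPeriods]

theorem one_mem_torusLattice (τ : UpperHalfPlane) : (1 : ℂ) ∈ (torusPeriods τ).lattice :=
  mem_torusLattice.2 ⟨1, 0, by simp⟩

theorem tau_mem_torusLattice (τ : UpperHalfPlane) : (τ : ℂ) ∈ (torusPeriods τ).lattice :=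
  mem_torusLattice.2 ⟨0, 1, by simp⟩

/-- The theta function `∏_{n ≥ 0} (1 - qⁿ e^{2πiz}) ∏_{n ≥ 1} (1 - qⁿ e^{-2πiz})`,
`q = e^{2πiτ}`. -/
noncomputable def thetaProduct (τ : UpperHalfPlane) (z : ℂ) : ℂ :=
  qProduct (expTwoPiI τ) (expTwoPiI z) * qProduct (expTwoPiI τ) (expTwoPiI τ * expTwoPiI (-z))

theorem differentiable_thetaProduct (τ : UpperHalfPlane) : Differentiable ℂ (thetaProduct τ) := by
  have h := differentiable_qProduct (norm_expTwoPiI_lt_one τ)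
  have h' := differentiable_expTwoPiI
  unfold thetaProduct
  fun_prop

theorem thetaProduct_add_one (τ : UpperHalfPlane) (z : ℂ) :
    thetaProduct τ (z + 1) = thetaProduct τ z := by
  simp only [thetaProduct, expTwoPiI_neg, expTwoPiI_add, expTwoPiI_one, mul_one]

/-- With `w = e^{2πiz}`, the translation replaces `w` by `qw`: the first product loses the factor `1
- w`, the second gains `1 - w⁻¹ = -w⁻¹ (1 - w)`. -/
theorem thetaProduct_add_tau (τ : UpperHalfPlane) (z : ℂ) :
    thetaProduct τ (z + τ) = -expTwoPiI (-z) * thetaProduct τ z := by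
  have hq := norm_expTwoPiI_lt_one τ
  have h0 := expTwoPiI_ne_zero z
  have h1 := expTwoPiI_ne_zero (τ : ℂ)
  rw [thetaProduct, thetaProduct, qProduct_eq_mul hq (expTwoPiI z), expTwoPiI_neg, expTwoPiI_add,
    mul_inv, expTwoPiI_neg, mul_comm (expTwoPiI z) (expTwoPiI τ), mul_comm (expTwoPiI z)⁻¹,
    mul_inv_cancel_left₀ h1, qProduct_eq_mul hq (expTwoPiI z)⁻¹]
  field_simp
  ring

theorem thetaProduct_eq_mul (τ : UpperHalfPlane) (z : ℂ) :
    thetaProduct τ z = (1 - expTwoPiI z) * (qProduct (expTwoPiI τ) (expTwoPiI τ * expTwoPiI z) *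
      qProduct (expTwoPiI τ) (expTwoPiI τ * expTwoPiI (-z))) := by
  rw [thetaProduct, qProduct_eq_mul (norm_expTwoPiI_lt_one τ) (expTwoPiI z), mul_assoc]

/-- A factor vanishes only if `z + nτ` or `(n + 1)τ - z` is an integer for some `n ≥ 0`, and either
case puts `z` in the lattice. -/
theorem thetaProduct_ne_zero {τ : UpperHalfPlane} {z : ℂ} (hz : z ∉ (torusPeriods τ).lattice) :
    thetaProduct τ z ≠ 0 := by
  have hq := norm_expTwoPiI_lt_one τ
  apply mul_ne_zero
  · apply qProduct_ne_zero hq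
    intro n h
    rw [← expTwoPiI_natCast_mul, ← expTwoPiI_add, expTwoPiI_eq_one_iff] at h
    obtain ⟨m, hm⟩ := h
    exact hz (mem_torusLattice.2 ⟨m, -n, by push_cast; linear_combination -hm⟩)
  · apply qProduct_ne_zero hq
    intro n h
    rw [← expTwoPiI_natCast_mul, ← expTwoPiI_add, ← expTwoPiI_add, expTwoPiI_eq_one_iff] at h
    obtain ⟨m, hm⟩ := h
    exact hz (mem_torusLattice.2 ⟨-m, n + 1, by push_cast; linear_combination hm⟩)

theorem thetaProduct_zero (τ : UpperHalfPlane) : thetaProduct τ 0 = 0 := by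
  simp [thetaProduct_eq_mul, expTwoPiI]

/-- The factor `1 - e^{2πiz}` has a simple zero at 0, and the remaining factors do not vanish there
because `|q| < 1` excludes `q^(n+1) = 1`. -/
theorem deriv_thetaProduct_zero_ne_zero (τ : UpperHalfPlane) : deriv (thetaProduct τ) 0 ≠ 0 := by
  have hq := norm_expTwoPiI_lt_one τ
  have hE : HasDerivAt (fun z => 1 - expTwoPiI z) (-(2 * Real.pi * Complex.I)) 0 := by
    have h : HasDerivAt (fun z : ℂ => 2 * Real.pi * Complex.I * z) (2 * Real.pi * Complex.I) 0 := by
      simpa using (hasDerivAt_id (0 : ℂ)).const_mul (2 * Real.pi * Complex.I : ℂ)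
    simpa [expTwoPiI] using h.cexp.const_sub 1
  set R : ℂ → ℂ := fun z => qProduct (expTwoPiI τ) (expTwoPiI τ * expTwoPiI z) *
      qProduct (expTwoPiI τ) (expTwoPiI τ * expTwoPiI (-z)) with hR
  have hRd : Differentiable ℂ R := by
    have h := differentiable_qProduct hq
    have h' := differentiable_expTwoPiI
    fun_prop
  have hne : qProduct (expTwoPiI τ) (expTwoPiI τ) ≠ 0 := by
    apply qProduct_ne_zero hq
    intro n h
    rw [← pow_succ] at h
    have := pow_lt_one₀ (norm_nonneg _) hq n.succ_ne_zero
    rw [← norm_pow, h] at this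
    simp at this
  have hR0 : R 0 ≠ 0 := by
    simpa [hR, expTwoPiI] using hne
  have hth : thetaProduct τ = fun z => (1 - expTwoPiI z) * R z := funext (thetaProduct_eq_mul τ)
  have := hE.mul (hRd 0).hasDerivAt
  rw [hth, HasDerivAt.deriv (f := fun z => (1 - expTwoPiI z) * R z) this]
  have e0 : expTwoPiI 0 = 1 := by simp [expTwoPiI]
  rw [e0, sub_self, zero_mul, add_zero]
  exact mul_ne_zero (neg_ne_zero.2 Complex.two_pi_I_ne_zero) hR0

theorem periodic_of_mem_torusLattice {τ : UpperHalfPlane} {β : Type*} {f : ℂ → β}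
    (h1 : ∀ z, f (z + 1) = f z) (hτ : ∀ z, f (z + τ) = f z) {l : ℂ}
    (hl : l ∈ (torusPeriods τ).lattice) (z : ℂ) : f (z + l) = f z := by
  obtain ⟨m, n, rfl⟩ := mem_torusLattice.1 hl
  have p1 : Function.Periodic f 1 := h1
  have p2 : Function.Periodic f (τ : ℂ) := hτ
  rw [← add_assoc, p2.int_mul n, ← mul_one (m : ℂ), p1.int_mul m]

theorem thetaProduct_eq_zero_iff {τ : UpperHalfPlane} {z : ℂ} :
    thetaProduct τ z = 0 ↔ z ∈ (torusPeriods τ).lattice := by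
  refine ⟨fun h => by_contra fun hz => thetaProduct_ne_zero hz h, fun hz => ?_⟩
  -- The proposition `θ(z) = 0` is itself periodic in `z`, because the multiplier of `θ` has no
  -- zeros.
  have := periodic_of_mem_torusLattice (f := fun z => (thetaProduct τ z = 0))
    (fun z => by simp only [thetaProduct_add_one])
    (fun z => by simp [thetaProduct_add_tau, expTwoPiI_ne_zero]) hz 0
  simpa [thetaProduct_zero] using this

/-! ### The logarithmic derivative of the theta function -/

theorem isOpen_compl_torusLattice (τ : UpperHalfPlane) :
    IsOpen {z : ℂ | z ∉ (torusPeriods τ).lattice} :=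
  (torusPeriods τ).isClosed_lattice.isOpen_compl

theorem add_mem_torusLattice_iff {τ : UpperHalfPlane} {l : ℂ} (hl : l ∈ (torusPeriods τ).lattice)
    (z : ℂ) : z + l ∈ (torusPeriods τ).lattice ↔ z ∈ (torusPeriods τ).lattice :=
  Submodule.add_mem_iff_left _ hl

theorem eventually_notMem_torusLattice {τ : UpperHalfPlane} {z : ℂ}
    (hz : z ∉ (torusPeriods τ).lattice) : ∀ᶠ w in nhds z, w ∉ (torusPeriods τ).lattice :=
  (isOpen_compl_torusLattice τ).mem_nhds hz

/-- The logarithmic derivative of the theta function. -/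
noncomputable def thetaLogDeriv (τ : UpperHalfPlane) (z : ℂ) : ℂ :=
  deriv (thetaProduct τ) z / thetaProduct τ z

theorem differentiable_deriv_thetaProduct (τ : UpperHalfPlane) :
    Differentiable ℂ (deriv (thetaProduct τ)) :=
  fun z => ((differentiable_thetaProduct τ).analyticAt z).deriv.differentiableAt

theorem differentiableAt_thetaLogDeriv {τ : UpperHalfPlane} {z : ℂ}
    (hz : z ∉ (torusPeriods τ).lattice) : DifferentiableAt ℂ (thetaLogDeriv τ) z :=
  (differentiable_deriv_thetaProduct τ z).div (differentiable_thetaProduct τ z)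
    (thetaProduct_ne_zero hz)

theorem thetaLogDeriv_add_one (τ : UpperHalfPlane) (z : ℂ) :
    thetaLogDeriv τ (z + 1) = thetaLogDeriv τ z := by
  have h : (fun w => thetaProduct τ (w + 1)) = thetaProduct τ := funext (thetaProduct_add_one τ)
  rw [thetaLogDeriv, thetaLogDeriv, thetaProduct_add_one, ← deriv_comp_add_const, h]

/-- The increment is the logarithmic derivative of the multiplier `-e^{-2πiz}`. -/
theorem thetaLogDeriv_add_tau {τ : UpperHalfPlane} {z : ℂ} (hz : z ∉ (torusPeriods τ).lattice) :
    thetaLogDeriv τ (z + τ) = thetaLogDeriv τ z - 2 * Real.pi * Complex.I := by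
  have h : (fun w => thetaProduct τ (w + τ)) = fun w => -expTwoPiI (-w) * thetaProduct τ w :=
    funext (thetaProduct_add_tau τ)
  have h0 := thetaProduct_ne_zero hz
  have h1 := expTwoPiI_ne_zero (-z)
  have hl : HasDerivAt (fun z : ℂ => 2 * Real.pi * Complex.I * (-z))
      (-(2 * Real.pi * Complex.I)) z := by
    simpa using (hasDerivAt_neg z).const_mul (2 * Real.pi * Complex.I : ℂ)
  have hE : HasDerivAt (fun z => -expTwoPiI (-z)) (expTwoPiI (-z) * (2 * Real.pi * Complex.I)) z := by
    simpa [expTwoPiI] using hl.cexp.fun_neg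
  have hd := hE.mul (differentiable_thetaProduct τ z).hasDerivAt
  rw [thetaLogDeriv, thetaLogDeriv, thetaProduct_add_tau, ← deriv_comp_add_const, h,
    HasDerivAt.deriv (f := fun w => -expTwoPiI (-w) * thetaProduct τ w) hd]
  field_simp
  ring

/-- The quotient of the theta function by its zero at the origin. -/
noncomputable def thetaQuotient (τ : UpperHalfPlane) : ℂ → ℂ := dslope (thetaProduct τ) 0

theorem thetaProduct_eq_mul_thetaQuotient (τ : UpperHalfPlane) (z : ℂ) :
    thetaProduct τ z = z * thetaQuotient τ z := by
  have := sub_smul_dslope (thetaProduct τ) 0 z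
  simpa [thetaProduct_zero, thetaQuotient] using this.symm

theorem differentiable_thetaQuotient (τ : UpperHalfPlane) : Differentiable ℂ (thetaQuotient τ) := by
  rw [← differentiableOn_univ, thetaQuotient, Complex.differentiableOn_dslope Filter.univ_mem]
  exact (differentiable_thetaProduct τ).differentiableOn

theorem thetaQuotient_ne_zero {τ : UpperHalfPlane} {z : ℂ}
    (hz : z ∈ (torusPeriods τ).lattice → z = 0) : thetaQuotient τ z ≠ 0 := by
  by_cases h : z = 0
  · subst h
    rw [thetaQuotient, dslope_same]
    exact deriv_thetaProduct_zero_ne_zero τ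
  · have := thetaProduct_ne_zero (mt hz h)
    rw [thetaProduct_eq_mul_thetaQuotient] at this
    exact right_ne_zero_of_mul this

theorem differentiable_deriv_thetaQuotient (τ : UpperHalfPlane) :
    Differentiable ℂ (deriv (thetaQuotient τ)) :=
  fun z => ((differentiable_thetaQuotient τ).analyticAt z).deriv.differentiableAt

theorem thetaLogDeriv_eq {τ : UpperHalfPlane} {z : ℂ} (hz : z ∉ (torusPeriods τ).lattice) :
    thetaLogDeriv τ z = z⁻¹ + deriv (thetaQuotient τ) z / thetaQuotient τ z := by
  have h0 : z ≠ 0 := fun h => hz (h ▸ zero_mem _)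
  have h1 : thetaQuotient τ z ≠ 0 := thetaQuotient_ne_zero fun h => absurd h hz
  have hd := (hasDerivAt_id z).mul (differentiable_thetaQuotient τ z).hasDerivAt
  have hf : thetaProduct τ = fun z => z * thetaQuotient τ z :=
    funext (thetaProduct_eq_mul_thetaQuotient τ)
  rw [thetaLogDeriv, hf, HasDerivAt.deriv (f := fun z => z * thetaQuotient τ z) hd]
  simp only [id]
  field_simp

/-- The holomorphic continuation to a neighbourhood of `0` of `(log θ)'' + ℘`. -/
noncomputable def thetaRegularPart (τ : UpperHalfPlane) (z : ℂ) : ℂ :=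
  deriv (fun w => deriv (thetaQuotient τ) w / thetaQuotient τ w) z +
    (torusPeriods τ).weierstrassPExcept 0 z

/-- Since `θ = z · (θ/z)`, the only pole of `(θ'/θ)'` near 0 is `-1/z²`, and it cancels the term of
`℘` at the origin. -/
theorem deriv_thetaLogDeriv_add_weierstrassP {τ : UpperHalfPlane} {z : ℂ}
    (hz : z ∉ (torusPeriods τ).lattice) :
    deriv (thetaLogDeriv τ) z + (torusPeriods τ).weierstrassP z = thetaRegularPart τ z := by
  have h0 : z ≠ 0 := fun h => hz (h ▸ zero_mem _)
  have hq : DifferentiableAt ℂ (fun w => deriv (thetaQuotient τ) w / thetaQuotient τ w) z :=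
    (differentiable_deriv_thetaQuotient τ z).div (differentiable_thetaQuotient τ z)
      (thetaQuotient_ne_zero fun h => absurd h hz)
  have he : thetaLogDeriv τ =ᶠ[nhds z]
      fun w => w⁻¹ + deriv (thetaQuotient τ) w / thetaQuotient τ w := by
    filter_upwards [eventually_notMem_torusLattice hz] with w hw using thetaLogDeriv_eq hw
  have hP := (torusPeriods τ).weierstrassPExcept_add 0 z
  rw [he.deriv_eq, HasDerivAt.deriv (f := fun w => w⁻¹ + _) ((hasDerivAt_inv h0).add hq.hasDerivAt),
    thetaRegularPart, ← hP]
  simp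
  field_simp
  ring

theorem differentiableAt_thetaRegularPart_zero (τ : UpperHalfPlane) :
    DifferentiableAt ℂ (thetaRegularPart τ) 0 := by
  have h1 : AnalyticAt ℂ (fun w => deriv (thetaQuotient τ) w / thetaQuotient τ w) 0 :=
    ((differentiable_deriv_thetaQuotient τ).analyticAt 0).div
      ((differentiable_thetaQuotient τ).analyticAt 0) (thetaQuotient_ne_zero fun _ => rfl)
  exact h1.deriv.differentiableAt.add
    ((torusPeriods τ).analyticAt_weierstrassPExcept 0).differentiableAt

/-- Both generating periods change `θ'/θ` by a constant only, which differentiation removes. -/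
theorem deriv_thetaLogDeriv_add {τ : UpperHalfPlane} {l : ℂ} (hl : l ∈ (torusPeriods τ).lattice)
    {z : ℂ} (hz : z ∉ (torusPeriods τ).lattice) :
    deriv (thetaLogDeriv τ) (z + l) = deriv (thetaLogDeriv τ) z := by
  classical
  -- The value 0 on the lattice makes the function periodic on all of `ℂ`, so that the two
  -- generating periods suffice.
  set g : ℂ → ℂ := fun z => if z ∈ (torusPeriods τ).lattice then 0 else deriv (thetaLogDeriv τ) z
  have key := periodic_of_mem_torusLattice (f := g) ?_ ?_ hl z
  · simpa [g, add_mem_torusLattice_iff hl, hz] using key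
  · intro z
    have h : (fun w => thetaLogDeriv τ (w + 1)) = thetaLogDeriv τ :=
      funext (thetaLogDeriv_add_one τ)
    simp only [g, add_mem_torusLattice_iff (one_mem_torusLattice τ)]
    rw [← deriv_comp_add_const, h]
  · intro z
    simp only [g, add_mem_torusLattice_iff (tau_mem_torusLattice τ)]
    split_ifs with hz
    · rfl
    · have h : (fun w => thetaLogDeriv τ (w + τ)) =ᶠ[nhds z]
          fun w => thetaLogDeriv τ w - 2 * Real.pi * Complex.I := by
        filter_upwards [eventually_notMem_torusLattice hz] with w hw using thetaLogDeriv_add_tau hw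
      rw [← deriv_comp_add_const, h.deriv_eq, deriv_sub_const]

/-- Liouville's theorem: `(log θ)'' + ℘` is periodic and its singularities are removable, so it
extends to a bounded entire function. -/
theorem exists_deriv_thetaLogDeriv_eq (τ : UpperHalfPlane) :
    ∃ η : ℂ, ∀ z ∉ (torusPeriods τ).lattice,
      deriv (thetaLogDeriv τ) z = -((torusPeriods τ).weierstrassP z + η) := by
  classical
  set D : ℂ → ℂ := fun z => if z ∈ (torusPeriods τ).lattice then thetaRegularPart τ 0
    else deriv (thetaLogDeriv τ) z + (torusPeriods τ).weierstrassP z with hD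
  have hper : ∀ z, ∀ l ∈ (torusPeriods τ).lattice, D (z + l) = D z := by
    intro z l hl
    by_cases hz : z ∈ (torusPeriods τ).lattice
    · simp [hD, add_mem_torusLattice_iff hl, hz]
    · have := (torusPeriods τ).weierstrassP_add_coe z ⟨l, hl⟩
      simp only at this
      simp [hD, add_mem_torusLattice_iff hl, hz, deriv_thetaLogDeriv_add hl hz, this]
  have hd0 : DifferentiableAt ℂ D 0 := by
    refine (differentiableAt_thetaRegularPart_zero τ).congr_of_eventuallyEq ?_
    filter_upwards [(torusPeriods τ).compl_lattice_sdiff_singleton_mem_nhds 0] with z hz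
    by_cases hzl : z ∈ (torusPeriods τ).lattice
    · have : z = 0 := by
        by_contra h
        exact hz ⟨hzl, h⟩
      subst this
      simp [hD]
    · simp [hD, hzl, deriv_thetaLogDeriv_add_weierstrassP]
  have hdiff : Differentiable ℂ D := by
    intro z
    by_cases hz : z ∈ (torusPeriods τ).lattice
    -- Periodicity transports differentiability from 0 to every other lattice point.
    · have e : D = fun w => D (w - z) := by
        funext w
        rw [← hper (w - z) z hz, sub_add_cancel]
      rw [e]
      have : DifferentiableAt ℂ D (z - z) := by rwa [sub_self]
      exact this.comp (f := fun w => w - z) z (by fun_prop)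
    · have e : D =ᶠ[nhds z] fun w => deriv (thetaLogDeriv τ) w + (torusPeriods τ).weierstrassP w := by
        filter_upwards [eventually_notMem_torusLattice hz] with w hw
        simp [hD, hw]
      refine DifferentiableAt.congr_of_eventuallyEq (.add ?_ ?_) e
      · have hon : DifferentiableOn ℂ (thetaLogDeriv τ) {z | z ∉ (torusPeriods τ).lattice} :=
          fun w hw => (differentiableAt_thetaLogDeriv hw).differentiableWithinAt
        exact (hon.deriv (isOpen_compl_torusLattice τ)).differentiableAt
          ((isOpen_compl_torusLattice τ).mem_nhds hz)
      · exact (torusPeriods τ).differentiableOn_weierstrassP.differentiableAt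
          ((isOpen_compl_torusLattice τ).mem_nhds hz)
  have hb : Bornology.IsBounded (Set.range D) :=
    (IsZLattice.isCompact_range_of_periodic (torusPeriods τ).lattice D hdiff.continuous
      hper).isBounded
  refine ⟨-D 0, fun z hz => ?_⟩
  have h1 : D z = D 0 := hdiff.apply_eq_apply_of_bounded hb z 0
  rw [← h1]
  simp [hD, hz]

/-- The constant `η` with `(log θ)'' = -(℘ + η)`. -/
noncomputable def thetaEta (τ : UpperHalfPlane) : ℂ := (exists_deriv_thetaLogDeriv_eq τ).choose

theorem hasDerivAt_thetaLogDeriv {τ : UpperHalfPlane} {z : ℂ}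
    (hz : z ∉ (torusPeriods τ).lattice) :
    HasDerivAt (thetaLogDeriv τ) (-((torusPeriods τ).weierstrassP z + thetaEta τ)) z := by
  have := (differentiableAt_thetaLogDeriv hz).hasDerivAt
  rwa [(exists_deriv_thetaLogDeriv_eq τ).choose_spec z hz] at this

theorem isPreconnected_compl_torusLattice (τ : UpperHalfPlane) :
    IsPreconnected {z : ℂ | z ∉ (torusPeriods τ).lattice} := by
  have hc : ((torusPeriods τ).lattice : Set ℂ).Countable := by
    have : ((torusPeriods τ).lattice : Set ℂ) =
        Set.range fun p : ℤ × ℤ => (p.1 : ℂ) + p.2 * τ := by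
      ext z
      simp [mem_torusLattice]
    rw [this]
    exact Set.countable_range _
  have hr : 1 < Module.rank ℝ ℂ := by rw [Complex.rank_real_complex]; norm_num
  exact (hc.isPathConnected_compl_of_one_lt_rank hr).isConnected.isPreconnected

theorem isEtaOne_thetaEta (τ : UpperHalfPlane) : IsEtaOne τ (thetaEta τ) := by
  refine ⟨fun z => thetaLogDeriv τ z + thetaEta τ * z, fun z hz => ?_, fun z _ => ?_⟩
  · have := (hasDerivAt_thetaLogDeriv hz).add ((hasDerivAt_id z).const_mul (thetaEta τ))
    refine this.congr_deriv ?_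
    ring
  · simp only [thetaLogDeriv_add_one]
    ring

/-- Two primitives of `-℘` on the connected complement of the lattice differ by a constant, so they
have the same increment. It is compared at the point `1/2`. -/
theorem IsEtaOne.eq_thetaEta {τ : UpperHalfPlane} {η : ℂ} (h : IsEtaOne τ η) : η = thetaEta τ := by
  obtain ⟨ζ, hd, hζ⟩ := h
  set F : ℂ → ℂ := fun z => ζ z - (thetaLogDeriv τ z + thetaEta τ * z) with hF
  have hder : ∀ z ∉ (torusPeriods τ).lattice, HasDerivAt F 0 z := by
    intro z hz
    have := (hd z hz).sub
      ((hasDerivAt_thetaLogDeriv hz).add ((hasDerivAt_id z).const_mul (thetaEta τ)))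
    refine this.congr_deriv ?_
    ring
  have hconst : ∀ z ∉ (torusPeriods τ).lattice, ∀ w ∉ (torusPeriods τ).lattice, F z = F w := by
    intro z hz w hw
    exact (isOpen_compl_torusLattice τ).is_const_of_deriv_eq_zero
      (isPreconnected_compl_torusLattice τ)
      (fun w hw => (hder w hw).differentiableAt.differentiableWithinAt)
      (fun w hw => (hder w hw).deriv) hz hw
  have hz : (1 / 2 : ℂ) ∉ (torusPeriods τ).lattice := (torusPeriods τ).ω₁_div_two_notMem_lattice
  have h1 := hconst (1 / 2 + 1) (by rwa [add_mem_torusLattice_iff (one_mem_torusLattice τ)]) _ hz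
  simp only [hF, hζ _ hz, thetaLogDeriv_add_one] at h1
  linear_combination h1

/-! ### Periodic functions and integration over the period parallelogram -/

theorem torusProj_eq_iff {τ : UpperHalfPlane} {z w : ℂ} :
    torusProj τ z = torusProj τ w ↔ z - w ∈ (torusPeriods τ).lattice := by
  rw [torusProj, torusProj, QuotientAddGroup.eq, ← neg_mem_iff]
  have : -(-z + w) = z - w := by ring
  rw [this]; rfl

theorem torusProj_add {τ : UpperHalfPlane} {l : ℂ} (hl : l ∈ (torusPeriods τ).lattice) (z : ℂ) :
    torusProj τ (z + l) = torusProj τ z :=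
  torusProj_eq_iff.2 (by simpa using hl)

theorem torusProj_surjective (τ : UpperHalfPlane) : Function.Surjective (torusProj τ) :=
  QuotientAddGroup.mk_surjective

theorem continuous_torusProj (τ : UpperHalfPlane) : Continuous (torusProj τ) :=
  continuous_quot_mk

theorem isOpenMap_torusProj (τ : UpperHalfPlane) : IsOpenMap (torusProj τ) :=
  QuotientAddGroup.isOpenMap_coe

/-- Functions on `ℂ` with all the periods in `ℤ + τℤ`. -/
def IsTorusPeriodic (τ : UpperHalfPlane) {E : Type*} (k : ℂ → E) : Prop :=
  ∀ l ∈ (torusPeriods τ).lattice, ∀ z, k (z + l) = k z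

theorem isTorusPeriodic_comp_torusProj {τ : UpperHalfPlane} {E : Type*} (φ : FlatTorus τ → E) :
    IsTorusPeriodic τ fun z => φ (torusProj τ z) :=
  fun l hl z => by simp only [torusProj_add hl]

namespace IsTorusPeriodic

variable {τ : UpperHalfPlane} {E E' E'' : Type*} {k : ℂ → E} {k' : ℂ → E'}

theorem comp_const_add (hk : IsTorusPeriodic τ k) (c : ℂ) : IsTorusPeriodic τ fun z => k (z + c) :=
  fun l hl z => by simp only [add_right_comm z l c, hk l hl]

theorem comp (hk : IsTorusPeriodic τ k) (F : E → E') : IsTorusPeriodic τ fun z => F (k z) :=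
  fun l hl z => by simp only [hk l hl]

theorem comp₂ (hk : IsTorusPeriodic τ k) (hk' : IsTorusPeriodic τ k') (F : E → E' → E'') :
    IsTorusPeriodic τ fun z => F (k z) (k' z) :=
  fun l hl z => by simp only [hk l hl, hk' l hl]

theorem fderiv_add [NormedAddCommGroup E] [NormedSpace ℝ E] (hk : IsTorusPeriodic τ k) {l : ℂ}
    (hl : l ∈ (torusPeriods τ).lattice) (z : ℂ) : fderiv ℝ k (z + l) = fderiv ℝ k z := by
  have h : (fun w => k (w + l)) = k := funext (hk l hl)
  rw [← fderiv_comp_add_right, h]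

theorem fderiv_apply [NormedAddCommGroup E] [NormedSpace ℝ E] (hk : IsTorusPeriodic τ k) (v : ℂ) :
    IsTorusPeriodic τ fun z => fderiv ℝ k z v :=
  fun l hl z => by simp only [hk.fderiv_add hl]

theorem exists_norm_le [NormedAddCommGroup E] (hk : IsTorusPeriodic τ k) (hc : Continuous k) :
    ∃ C, ∀ z, ‖k z‖ ≤ C := by
  have := (IsZLattice.isCompact_range_of_periodic (torusPeriods τ).lattice k hc
    fun z w hw => hk w hw z).isBounded
  obtain ⟨C, hC⟩ := this.exists_norm_le
  exact ⟨C, fun z => hC _ ⟨z, rfl⟩⟩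

theorem vadd (hk : IsTorusPeriodic τ k)
    (l : (torusPeriods τ).lattice.toAddSubgroup) (z : ℂ) : k (l +ᵥ z) = k z := by
  have := hk l.1 l.2 z
  rwa [add_comm] at this

end IsTorusPeriodic

/-! ### The period parallelogram as a fundamental domain, and its area. -/

theorem periodParallelogram_eq (τ : UpperHalfPlane) :
    periodParallelogram τ = ZSpan.fundamentalDomain (torusPeriods τ).basis := by
  ext z
  constructor
  · rintro ⟨s, hs, t, ht, rfl⟩
    have e : (s : ℂ) + t * τ = s • (torusPeriods τ).basis 0 + t • (torusPeriods τ).basis 1 := by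
      simp [torusPeriods]
    rw [ZSpan.mem_fundamentalDomain, e]
    intro i
    simp only [map_add, map_smul, Module.Basis.repr_self]
    fin_cases i <;> simpa using (by assumption)
  · intro h
    rw [ZSpan.mem_fundamentalDomain] at h
    refine ⟨_, h 0, _, h 1, ?_⟩
    have := (torusPeriods τ).basis.sum_repr z
    rw [Fin.sum_univ_two] at this
    nth_rw 1 [← this]
    simp [torusPeriods]

instance countable_torusLattice (τ : UpperHalfPlane) :
    Countable (torusPeriods τ).lattice.toAddSubgroup :=
  ((torusPeriods τ).latticeEquivProd.toEquiv.countable_iff.2 inferInstance :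
    Countable (torusPeriods τ).lattice)

theorem isAddFundamentalDomain_periodParallelogram (τ : UpperHalfPlane) :
    IsAddFundamentalDomain (torusPeriods τ).lattice.toAddSubgroup (periodParallelogram τ)
      (volume : Measure ℂ) := by
  rw [periodParallelogram_eq, (torusPeriods τ).lattice_eq_span_range_basis]
  exact ZSpan.isAddFundamentalDomain' _ _

theorem isBounded_periodParallelogram (τ : UpperHalfPlane) :
    Bornology.IsBounded (periodParallelogram τ) := by
  rw [periodParallelogram_eq]
  exact ZSpan.fundamentalDomain_isBounded _

theorem measurableSet_periodParallelogram (τ : UpperHalfPlane) :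
    MeasurableSet (periodParallelogram τ) := by
  rw [periodParallelogram_eq]
  exact ZSpan.fundamentalDomain_measurableSet _

theorem volume_periodParallelogram_lt_top (τ : UpperHalfPlane) :
    volume (periodParallelogram τ) < ⊤ :=
  (isBounded_periodParallelogram τ).measure_lt_top

theorem flatTorusArea_eq (τ : UpperHalfPlane) : flatTorusArea τ = τ.im := by
  rw [flatTorusArea, periodParallelogram_eq,
    ZSpan.measureReal_fundamentalDomain _ _ Complex.orthonormalBasisOneI.toBasis]
  have h1 : volume.real (ZSpan.fundamentalDomain Complex.orthonormalBasisOneI.toBasis) = 1 := by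
    rw [measureReal_def, measure_congr (ZSpan.fundamentalDomain_ae_parallelepiped _ volume),
      OrthonormalBasis.coe_toBasis, OrthonormalBasis.volume_parallelepiped, ENNReal.toReal_one]
  rw [h1, mul_one, Module.Basis.det_apply, Matrix.det_fin_two]
  simp [Module.Basis.toMatrix_apply, torusPeriods, abs_of_pos τ.im_pos]

-- Translates of `F` are again fundamental domains, so a periodic function can be integrated over a
-- parallelogram placed around any chosen point.
open scoped Pointwise in
theorem isAddFundamentalDomain_preimage_periodParallelogram (τ : UpperHalfPlane) (c : ℂ) :
    IsAddFundamentalDomain (torusPeriods τ).lattice.toAddSubgroup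
      ((fun z => z + c) ⁻¹' periodParallelogram τ) (volume : Measure ℂ) := by
  have h := (isAddFundamentalDomain_periodParallelogram τ).vadd_of_comm (-c)
  have e : (-c +ᵥ periodParallelogram τ : Set ℂ) = (fun z => z + c) ⁻¹' periodParallelogram τ := by
    ext z
    rw [Set.mem_vadd_set_iff_neg_vadd_mem]
    simp [add_comm]
  rwa [e] at h

section Integral

variable {τ : UpperHalfPlane} {E : Type*} [NormedAddCommGroup E] {k : ℂ → E}

theorem measurePreserving_add_right_complex (c : ℂ) :
    MeasurePreserving (fun z : ℂ => z + c) volume volume :=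
  measurePreserving_add_right volume c

theorem measurableEmbedding_add_right_complex (c : ℂ) :
    MeasurableEmbedding (fun z : ℂ => z + c) := measurableEmbedding_addRight c

theorem IsTorusPeriodic.integrableOn_preimage (hk : IsTorusPeriodic τ k) (c : ℂ) :
    IntegrableOn k ((fun z => z + c) ⁻¹' periodParallelogram τ) ↔
      IntegrableOn k (periodParallelogram τ) :=
  (isAddFundamentalDomain_preimage_periodParallelogram τ c).integrableOn_iff
    (isAddFundamentalDomain_periodParallelogram τ) hk.vadd

theorem IsTorusPeriodic.integrableOn_comp_add (hk : IsTorusPeriodic τ k) (c : ℂ) :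
    IntegrableOn (fun z => k (z + c)) (periodParallelogram τ) ↔
      IntegrableOn k (periodParallelogram τ) := by
  rw [← (hk.comp_const_add c).integrableOn_preimage c]
  exact (measurePreserving_add_right_complex c).integrableOn_comp_preimage
    (measurableEmbedding_add_right_complex c)

variable [NormedSpace ℝ E]

theorem IsTorusPeriodic.setIntegral_preimage (hk : IsTorusPeriodic τ k) (c : ℂ) :
    ∫ z in (fun z => z + c) ⁻¹' periodParallelogram τ, k z = ∫ z in periodParallelogram τ, k z :=
  (isAddFundamentalDomain_preimage_periodParallelogram τ c).setIntegral_eq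
    (isAddFundamentalDomain_periodParallelogram τ) hk.vadd

theorem IsTorusPeriodic.setIntegral_comp_add (hk : IsTorusPeriodic τ k) (c : ℂ) :
    ∫ z in periodParallelogram τ, k (z + c) = ∫ z in periodParallelogram τ, k z := by
  rw [← (hk.comp_const_add c).setIntegral_preimage c]
  exact (measurePreserving_add_right_complex c).setIntegral_preimage_emb
    (measurableEmbedding_add_right_complex c) k _

end Integral

theorem IsTorusPeriodic.integrableOn_of_continuous {τ : UpperHalfPlane} {E : Type*}
    [NormedAddCommGroup E] [SecondCountableTopology E]
    {k : ℂ → E} (hk : IsTorusPeriodic τ k) (hc : Continuous k) :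
    IntegrableOn k (periodParallelogram τ) := by
  obtain ⟨C, hC⟩ := hk.exists_norm_le hc
  exact Measure.integrableOn_of_bounded (volume_periodParallelogram_lt_top τ).ne
    hc.aestronglyMeasurable (.of_forall hC)

/-- The integral of a derivative of a periodic function vanishes. -/
theorem IsTorusPeriodic.setIntegral_fderiv {τ : UpperHalfPlane} {k : ℂ → ℝ}
    (hk : IsTorusPeriodic τ k) (hd : ContDiff ℝ 1 k) (v : ℂ) :
    ∫ z in periodParallelogram τ, fderiv ℝ k z v = 0 := by
  have hcf : Continuous fun z => fderiv ℝ k z v :=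
    (hd.continuous_fderiv one_ne_zero).clm_apply continuous_const
  -- Integrated over `F`, the right side vanishes by translation invariance. By Fubini and the same
  -- invariance, the left side becomes the integral to be computed.
  have hline : ∀ z : ℂ, ∫ s in (0 : ℝ)..1, fderiv ℝ k (z + s * v) v = k (z + v) - k z := by
    intro z
    have h : ∀ s : ℝ, HasDerivAt (fun s : ℝ => k (z + s * v)) (fderiv ℝ k (z + s * v) v) s := by
      intro s
      have h1 : HasDerivAt (fun s : ℝ => z + s * v) v s := by
        simpa using ((Complex.ofRealCLM.hasDerivAt (x := s)).mul_const v).const_add z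
      exact ((hd.differentiable one_ne_zero (z + s * v)).hasFDerivAt).comp_hasDerivAt s h1
    have := intervalIntegral.integral_eq_sub_of_hasDerivAt (a := 0) (b := 1)
      (fun s _ => h s) (Continuous.intervalIntegrable (by fun_prop) _ _)
    simpa using this
  have hki := hk.integrableOn_of_continuous hd.continuous
  have h0 : ∫ z in periodParallelogram τ, (k (z + v) - k z) = 0 := by
    rw [integral_sub ((hk.integrableOn_comp_add v).2 hki) hki, hk.setIntegral_comp_add, sub_self]
  simp only [← hline] at h0
  obtain ⟨C, hC⟩ := (hk.fderiv_apply v).exists_norm_le hcf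
  have : IsFiniteMeasure (volume.restrict (periodParallelogram τ)) :=
    ⟨by simpa using volume_periodParallelogram_lt_top τ⟩
  have : IsFiniteMeasure (volume.restrict (Set.uIoc (0 : ℝ) 1)) := ⟨by simp [Set.uIoc]⟩
  rw [← intervalIntegral_integral_swap] at h0
  · have hc : ∀ s : ℝ, ∫ z in periodParallelogram τ, fderiv ℝ k (z + s * v) v =
        ∫ z in periodParallelogram τ, fderiv ℝ k z v :=
      fun s => (hk.fderiv_apply v).setIntegral_comp_add _
    simpa [hc] using h0
  · refine Integrable.of_bound (C := C) ?_ (.of_forall fun p => hC _)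
    exact Continuous.aestronglyMeasurable (by unfold Function.uncurry; fun_prop)

/-! ### The Laplacian of smooth periodic functions. -/

theorem laplacian_eq_fderiv_fderiv {f : ℂ → ℝ} (hf : ContDiff ℝ 2 f) (z : ℂ) :
    Laplacian.laplacian f z = fderiv ℝ (fun w => fderiv ℝ f w 1) z 1 +
      fderiv ℝ (fun w => fderiv ℝ f w Complex.I) z Complex.I := by
  have hd : Differentiable ℝ (fderiv ℝ f) :=
    (hf.fderiv_right (m := 1) (by norm_num)).differentiable one_ne_zero
  have h : ∀ v : ℂ, fderiv ℝ (fun w => fderiv ℝ f w v) z v = fderiv ℝ (fderiv ℝ f) z v v := by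
    intro v
    have := (hd z).hasFDerivAt.clm_apply (hasFDerivAt_const v z)
    rw [this.fderiv]
    simp
  rw [InnerProductSpace.laplacian_eq_iteratedFDeriv_complexPlane, h, h]
  simp [iteratedFDeriv_two_apply]

theorem two_le_infty : (2 : WithTop ℕ∞) ≤ ∞ := WithTop.coe_le_coe.2 le_top

theorem contDiff_fderiv_apply {f : ℂ → ℝ} (hf : ContDiff ℝ ∞ f) (v : ℂ) :
    ContDiff ℝ ∞ fun z => fderiv ℝ f z v :=
  (hf.fderiv_right (m := ∞) (by simp)).clm_apply contDiff_const

theorem continuous_laplacian {f : ℂ → ℝ} (hf : ContDiff ℝ ∞ f) :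
    Continuous (Laplacian.laplacian f) := by
  have h : Laplacian.laplacian f = fun z => fderiv ℝ (fun w => fderiv ℝ f w 1) z 1 +
      fderiv ℝ (fun w => fderiv ℝ f w Complex.I) z Complex.I :=
    funext (laplacian_eq_fderiv_fderiv (hf.of_le two_le_infty))
  rw [h]
  exact (contDiff_fderiv_apply (contDiff_fderiv_apply hf _) _).continuous.add
    (contDiff_fderiv_apply (contDiff_fderiv_apply hf _) _).continuous

theorem IsTorusPeriodic.laplacian {τ : UpperHalfPlane} {f : ℂ → ℝ} (h : IsTorusPeriodic τ f)
    (hf : ContDiff ℝ ∞ f) : IsTorusPeriodic τ (Laplacian.laplacian f) := by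
  intro l hl z
  rw [laplacian_eq_fderiv_fderiv (hf.of_le two_le_infty),
    laplacian_eq_fderiv_fderiv (hf.of_le two_le_infty),
    (h.fderiv_apply 1).fderiv_add hl, (h.fderiv_apply Complex.I).fderiv_add hl]

/-- Green's identity on the torus. -/
theorem IsTorusPeriodic.setIntegral_mul_laplacian {τ : UpperHalfPlane} {f g : ℂ → ℝ}
    (hf : IsTorusPeriodic τ f) (hg : IsTorusPeriodic τ g) (hfs : ContDiff ℝ ∞ f)
    (hgs : ContDiff ℝ ∞ g) :
    ∫ z in periodParallelogram τ, f z * Laplacian.laplacian g z =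
      ∫ z in periodParallelogram τ, Laplacian.laplacian f z * g z := by
  -- The integrand is the derivative along `v` of the periodic function `f ∂ᵥg - ∂ᵥf g`; the mixed
  -- terms cancel.
  have key : ∀ v : ℂ, ∫ z in periodParallelogram τ,
      (f z * fderiv ℝ (fun w => fderiv ℝ g w v) z v -
        fderiv ℝ (fun w => fderiv ℝ f w v) z v * g z) = 0 := by
    intro v
    have hfv := contDiff_fderiv_apply hfs v
    have hgv := contDiff_fderiv_apply hgs v
    have hper : IsTorusPeriodic τ fun z => f z * fderiv ℝ g z v - fderiv ℝ f z v * g z :=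
      fun l hl z => by beta_reduce; rw [hf l hl, hg l hl, hf.fderiv_add hl, hg.fderiv_add hl]
    have hsm : ContDiff ℝ ∞ fun z => f z * fderiv ℝ g z v - fderiv ℝ f z v * g z :=
      (hfs.mul hgv).sub (hfv.mul hgs)
    rw [← hper.setIntegral_fderiv (hsm.of_le (by simp)) v]
    congr 1
    ext z
    have d : ∀ {h : ℂ → ℝ}, ContDiff ℝ ∞ h → HasFDerivAt h (fderiv ℝ h z) z :=
      fun hh => (hh.differentiable (by simp) z).hasFDerivAt
    have e := ((d hfs).mul (d hgv)).sub ((d hfv).mul (d hgs))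
    rw [HasFDerivAt.fderiv (f := fun z => f z * fderiv ℝ g z v -
      fderiv ℝ f z v * g z) e]
    simp
    ring
  have hint : ∀ v : ℂ, IntegrableOn (fun z => f z * fderiv ℝ (fun w =>
      fderiv ℝ g w v) z v - fderiv ℝ (fun w => fderiv ℝ f w v) z v * g z)
      (periodParallelogram τ) := by
    intro v
    refine IsTorusPeriodic.integrableOn_of_continuous (fun l hl z => ?_) ?_
    · rw [hf l hl, hg l hl, (hf.fderiv_apply v).fderiv_add hl, (hg.fderiv_apply v).fderiv_add hl]
    · have := (contDiff_fderiv_apply (contDiff_fderiv_apply hfs v) v).continuous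
      have := (contDiff_fderiv_apply (contDiff_fderiv_apply hgs v) v).continuous
      have := hfs.continuous
      have := hgs.continuous
      fun_prop
  have hl1 : IntegrableOn (fun z => f z * Laplacian.laplacian g z) (periodParallelogram τ) :=
    IsTorusPeriodic.integrableOn_of_continuous (hf.comp₂ (hg.laplacian hgs) (· * ·))
      (hfs.continuous.mul (continuous_laplacian hgs))
  have hl2 : IntegrableOn (fun z => Laplacian.laplacian f z * g z) (periodParallelogram τ) :=
    IsTorusPeriodic.integrableOn_of_continuous ((hf.laplacian hfs).comp₂ hg (· * ·))
      ((continuous_laplacian hfs).mul hgs.continuous)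
  -- The right side `0 + 0` is replaced by the two vanishing integrals for the directions `1` and
  -- `i`, whose integrands add up to `f Δg - Δf g`.
  rw [← sub_eq_zero, ← integral_sub hl1 hl2, ← add_zero (0 : ℝ)]
  nth_rw 1 [← key 1]
  nth_rw 1 [← key Complex.I]
  rw [← integral_add (hint 1) (hint Complex.I)]
  congr 1
  ext z
  rw [laplacian_eq_fderiv_fderiv (hfs.of_le two_le_infty),
    laplacian_eq_fderiv_fderiv (hgs.of_le two_le_infty)]
  ring

/-! ### The periodic norm of the theta function -/

/-- The weight making `|θ|²` periodic. -/
noncomputable def thetaWeight (τ : UpperHalfPlane) (z : ℂ) : ℝ :=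
  2 * Real.pi * z.im ^ 2 / τ.im - 2 * Real.pi * z.im

/-- The smooth function `|θ|² e^{-ψ}` on the torus. -/
noncomputable def thetaNorm (τ : UpperHalfPlane) (z : ℂ) : ℝ :=
  Complex.normSq (thetaProduct τ z) * Real.exp (-thetaWeight τ z)

theorem contDiff_of_differentiable_complex {f : ℂ → ℂ} (hf : Differentiable ℂ f) :
    ContDiff ℝ ∞ f :=
  (hf.contDiff (n := ∞)).restrict_scalars ℝ

theorem contDiff_complex_re : ContDiff ℝ ∞ Complex.re := Complex.reCLM.contDiff

theorem contDiff_complex_im : ContDiff ℝ ∞ Complex.im := Complex.imCLM.contDiff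

theorem contDiff_complex_normSq : ContDiff ℝ ∞ Complex.normSq := by
  have h : (Complex.normSq : ℂ → ℝ) = fun z => z.re * z.re + z.im * z.im :=
    funext Complex.normSq_apply
  rw [h]
  exact (contDiff_complex_re.mul contDiff_complex_re).add
    (contDiff_complex_im.mul contDiff_complex_im)

theorem contDiff_thetaWeight (τ : UpperHalfPlane) : ContDiff ℝ ∞ (thetaWeight τ) := by
  have := contDiff_complex_im
  unfold thetaWeight
  fun_prop

theorem contDiff_thetaNorm (τ : UpperHalfPlane) : ContDiff ℝ ∞ (thetaNorm τ) :=
  (contDiff_complex_normSq.comp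
    (contDiff_of_differentiable_complex (differentiable_thetaProduct τ))).mul
    (Real.contDiff_exp.comp (contDiff_thetaWeight τ).neg)

theorem thetaNorm_nonneg (τ : UpperHalfPlane) (z : ℂ) : 0 ≤ thetaNorm τ z :=
  mul_nonneg (Complex.normSq_nonneg _) (Real.exp_nonneg _)

theorem thetaNorm_eq_zero_iff {τ : UpperHalfPlane} {z : ℂ} :
    thetaNorm τ z = 0 ↔ z ∈ (torusPeriods τ).lattice := by
  simp [thetaNorm, thetaProduct_eq_zero_iff, Real.exp_ne_zero]

theorem thetaNorm_pos {τ : UpperHalfPlane} {z : ℂ} (hz : z ∉ (torusPeriods τ).lattice) :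
    0 < thetaNorm τ z :=
  (thetaNorm_nonneg τ z).lt_of_ne' (mt thetaNorm_eq_zero_iff.1 hz)

/-- Under `z ↦ z + τ` the weight grows by `4π Im z`, which compensates `|e^{-2πiz}|² = e^{4π Im z}`.
-/
theorem isTorusPeriodic_thetaNorm (τ : UpperHalfPlane) : IsTorusPeriodic τ (thetaNorm τ) := by
  have hI : τ.im ≠ 0 := τ.im_pos.ne'
  have him : (τ : ℂ).im = τ.im := rfl
  intro l hl z
  refine periodic_of_mem_torusLattice (fun z => ?_) (fun z => ?_) hl z
  · simp [thetaNorm, thetaProduct_add_one, thetaWeight]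
  · have hw : thetaWeight τ (z + τ) = thetaWeight τ z + 4 * Real.pi * z.im := by
      simp only [thetaWeight, Complex.add_im, him]
      field_simp
      ring
    have he : Complex.normSq (expTwoPiI (-z)) = Real.exp (4 * Real.pi * z.im) := by
      rw [Complex.normSq_eq_norm_sq, norm_expTwoPiI, ← Real.exp_nat_mul]
      congr 1
      simp
      ring
    rw [thetaNorm, thetaNorm, thetaProduct_add_tau, map_mul, Complex.normSq_neg, he, hw, neg_add,
      Real.exp_add, Real.exp_neg (4 * Real.pi * z.im)]
    have := Real.exp_ne_zero (4 * Real.pi * z.im)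
    field_simp

/-- Reduces the derivatives below to one-variable calculus along real lines. -/
theorem fderiv_eq_of_hasDerivAt_line {f : ℂ → ℝ} {z v : ℂ} {d : ℝ} (hf : DifferentiableAt ℝ f z)
    (h : HasDerivAt (fun t : ℝ => f (z + t * v)) d 0) : fderiv ℝ f z v = d := by
  have h1 : HasDerivAt (fun t : ℝ => z + t * v) v 0 := by
    simpa using ((Complex.ofRealCLM.hasDerivAt (x := (0 : ℝ))).mul_const v).const_add z
  have hz : z + ((0 : ℝ) : ℂ) * v = z := by simp
  have hf' : HasFDerivAt f (fderiv ℝ f z) (z + ((0 : ℝ) : ℂ) * v) := by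
    rw [hz]; exact hf.hasFDerivAt
  exact (hf'.comp_hasDerivAt (0 : ℝ) h1).unique h

theorem hasDerivAt_line_re_im {f : ℂ → ℂ} (hf : Differentiable ℂ f) (z v : ℂ) (t : ℝ) :
    HasDerivAt (fun t : ℝ => (f (z + t * v)).re) (deriv f (z + t * v) * v).re t ∧
    HasDerivAt (fun t : ℝ => (f (z + t * v)).im) (deriv f (z + t * v) * v).im t := by
  have h1 : HasDerivAt (fun t : ℝ => z + t * v) v t := by
    simpa using ((Complex.ofRealCLM.hasDerivAt (x := t)).mul_const v).const_add z
  have h2 : HasDerivAt (fun t : ℝ => f (z + t * v)) (deriv f (z + t * v) * v) t :=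
    (hf (z + t * v)).hasDerivAt.comp_of_eq t h1 rfl
  exact ⟨Complex.reCLM.hasFDerivAt.comp_hasDerivAt t h2,
    Complex.imCLM.hasFDerivAt.comp_hasDerivAt t h2⟩

theorem hasDerivAt_line_thetaWeight (τ : UpperHalfPlane) (z v : ℂ) (t : ℝ) :
    HasDerivAt (fun t : ℝ => thetaWeight τ (z + t * v))
      ((4 * Real.pi * (z + t * v).im / τ.im - 2 * Real.pi) * v.im) t := by
  have h : HasDerivAt (fun t : ℝ => z.im + t * v.im) v.im t := by
    simpa using ((hasDerivAt_id t).mul_const v.im).const_add z.im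
  have := (((h.pow 2).const_mul (2 * Real.pi)).div_const τ.im).sub (h.const_mul (2 * Real.pi))
  simp only [thetaWeight, Complex.add_im, Complex.mul_im, Complex.ofReal_re, Complex.ofReal_im,
    zero_mul, add_zero]
  refine this.congr_deriv ?_
  push_cast
  ring

theorem fderiv_thetaNorm (τ : UpperHalfPlane) (z v : ℂ) :
    fderiv ℝ (thetaNorm τ) z v =
      (2 * ((thetaProduct τ z).re * (deriv (thetaProduct τ) z * v).re +
          (thetaProduct τ z).im * (deriv (thetaProduct τ) z * v).im) -
        Complex.normSq (thetaProduct τ z) *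
          ((4 * Real.pi * z.im / τ.im - 2 * Real.pi) * v.im)) * Real.exp (-thetaWeight τ z) := by
  refine fderiv_eq_of_hasDerivAt_line ((contDiff_thetaNorm τ).differentiable (by simp) z) ?_
  obtain ⟨hr, hi⟩ := hasDerivAt_line_re_im (differentiable_thetaProduct τ) z v 0
  have hw := (hasDerivAt_line_thetaWeight τ z v 0).fun_neg.exp
  have := ((hr.mul hr).add (hi.mul hi)).mul hw
  simp only [thetaNorm, Complex.normSq_apply]
  refine this.congr_deriv ?_
  simp
  ring

theorem fderiv_fderiv_thetaNorm (τ : UpperHalfPlane) (z v : ℂ) :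
    fderiv ℝ (fun w => fderiv ℝ (thetaNorm τ) w v) z v =
      (2 * ((deriv (thetaProduct τ) z * v).re ^ 2 + (deriv (thetaProduct τ) z * v).im ^ 2 +
          (thetaProduct τ z).re * (deriv (deriv (thetaProduct τ)) z * v * v).re +
          (thetaProduct τ z).im * (deriv (deriv (thetaProduct τ)) z * v * v).im) -
        4 * ((thetaProduct τ z).re * (deriv (thetaProduct τ) z * v).re +
          (thetaProduct τ z).im * (deriv (thetaProduct τ) z * v).im) *
          ((4 * Real.pi * z.im / τ.im - 2 * Real.pi) * v.im) -
        Complex.normSq (thetaProduct τ z) * (4 * Real.pi / τ.im * v.im ^ 2) +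
        Complex.normSq (thetaProduct τ z) *
          ((4 * Real.pi * z.im / τ.im - 2 * Real.pi) * v.im) ^ 2) *
        Real.exp (-thetaWeight τ z) := by
  refine fderiv_eq_of_hasDerivAt_line
    ((contDiff_fderiv_apply (contDiff_thetaNorm τ) v).differentiable (by simp) z) ?_
  obtain ⟨hr, hi⟩ := hasDerivAt_line_re_im (differentiable_thetaProduct τ) z v 0
  have hdv : Differentiable ℂ fun z => deriv (thetaProduct τ) z * v :=
    (differentiable_deriv_thetaProduct τ).mul_const v
  obtain ⟨hr', hi'⟩ := hasDerivAt_line_re_im hdv z v 0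
  have hdd : deriv (fun z => deriv (thetaProduct τ) z * v) (z + (0 : ℝ) * v) =
      deriv (deriv (thetaProduct τ)) (z + (0 : ℝ) * v) * v :=
    deriv_mul_const (differentiable_deriv_thetaProduct τ _) v
  rw [hdd] at hr' hi'
  have hw := (hasDerivAt_line_thetaWeight τ z v 0).fun_neg.exp
  have him : HasDerivAt (fun t : ℝ => (4 * Real.pi * (z + t * v).im / τ.im - 2 * Real.pi) * v.im)
      (4 * Real.pi / τ.im * v.im ^ 2) 0 := by
    have h : HasDerivAt (fun t : ℝ => z.im + t * v.im) v.im 0 := by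
      simpa using ((hasDerivAt_id (0 : ℝ)).mul_const v.im).const_add z.im
    have := ((((h.const_mul (4 * Real.pi)).div_const τ.im).sub_const (2 * Real.pi)).mul_const v.im)
    simp only [Complex.add_im, Complex.mul_im, Complex.ofReal_re, Complex.ofReal_im,
      zero_mul, add_zero]
    refine this.congr_deriv ?_
    ring
  have := ((((hr.mul hr').add (hi.mul hi')).const_mul 2).sub
    (((hr.mul hr).add (hi.mul hi)).mul him)).mul hw
  simp only [fderiv_thetaNorm, Complex.normSq_apply]
  refine this.congr_deriv ?_
  simp only [Complex.ofReal_zero, zero_mul, add_zero, Pi.mul_apply, Pi.add_apply, Pi.sub_apply]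
  ring

/-- Where `N ≠ 0` this is `N² Δ log N = -N² Δψ`, by harmonicity of `log |θ|²`. In the present form
it is a polynomial identity in the real and imaginary parts of `θ`, `θ'`, `θ''`, so it holds at the
zeros as well. -/
theorem thetaNorm_mul_laplacian (τ : UpperHalfPlane) (z : ℂ) :
    thetaNorm τ z * Laplacian.laplacian (thetaNorm τ) z -
      (fderiv ℝ (thetaNorm τ) z 1 ^ 2 + fderiv ℝ (thetaNorm τ) z Complex.I ^ 2) =
    -(4 * Real.pi / τ.im) * thetaNorm τ z ^ 2 := by
  rw [laplacian_eq_fderiv_fderiv ((contDiff_thetaNorm τ).of_le two_le_infty),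
    fderiv_fderiv_thetaNorm, fderiv_fderiv_thetaNorm, fderiv_thetaNorm, fderiv_thetaNorm, thetaNorm]
  simp [Complex.normSq_apply]
  ring

/-! ### The regularized logarithm -/

theorem contDiff_log_thetaNorm_add (τ : UpperHalfPlane) {ε : ℝ} (hε : 0 < ε) :
    ContDiff ℝ ∞ fun z => Real.log (thetaNorm τ z + ε) :=
  ((contDiff_thetaNorm τ).add contDiff_const).log
    fun z => (add_pos_of_nonneg_of_pos (thetaNorm_nonneg τ z) hε).ne'

/-- Since `Δ log (N + ε) = ((N + ε) ΔN - |∇N|²)/(N + ε)²`, the previous identity splits it into a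
bounded term, which tends to `-4π/Im τ` off the lattice, and a term that concentrates at the zeros
of `N`. -/
theorem laplacian_log_thetaNorm_add (τ : UpperHalfPlane) {ε : ℝ} (hε : 0 < ε) (z : ℂ) :
    Laplacian.laplacian (fun z => Real.log (thetaNorm τ z + ε)) z =
      -(4 * Real.pi / τ.im) * (thetaNorm τ z ^ 2 / (thetaNorm τ z + ε) ^ 2) +
      ε * Laplacian.laplacian (thetaNorm τ) z / (thetaNorm τ z + ε) ^ 2 := by
  have hpos : ∀ z, thetaNorm τ z + ε ≠ 0 :=
    fun z => (add_pos_of_nonneg_of_pos (thetaNorm_nonneg τ z) hε).ne'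
  have hN := contDiff_thetaNorm τ
  have h1 : ∀ v w, fderiv ℝ (fun z => Real.log (thetaNorm τ z + ε)) w v =
      fderiv ℝ (thetaNorm τ) w v / (thetaNorm τ w + ε) := by
    intro v w
    have := ((hN.differentiable (by simp) w).hasFDerivAt.add_const ε).log (hpos w)
    rw [this.fderiv]
    simp
    ring
  have h2 : ∀ v, fderiv ℝ (fun w => fderiv ℝ (thetaNorm τ) w v / (thetaNorm τ w + ε)) z v =
      (fderiv ℝ (fun w => fderiv ℝ (thetaNorm τ) w v) z v * (thetaNorm τ z + ε) -
        fderiv ℝ (thetaNorm τ) z v ^ 2) / (thetaNorm τ z + ε) ^ 2 := by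
    intro v
    have e1 := ((contDiff_fderiv_apply hN v).differentiable (by simp) z).hasFDerivAt
    have e2 := (hN.differentiable (by simp) z).hasFDerivAt.add_const ε
    have e3 := (hasDerivAt_inv (hpos z)).comp_hasFDerivAt z e2
    have := e1.fun_mul e3
    simp only [div_eq_mul_inv]
    rw [HasFDerivAt.fderiv (f := fun w => fderiv ℝ (thetaNorm τ) w v * (thetaNorm τ w + ε)⁻¹) this]
    have := hpos z
    simp
    field_simp
    ring
  rw [laplacian_eq_fderiv_fderiv ((contDiff_log_thetaNorm_add τ hε).of_le two_le_infty)]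
  simp only [h1, h2]
  have key := thetaNorm_mul_laplacian τ z
  rw [laplacian_eq_fderiv_fderiv (hN.of_le two_le_infty)] at key ⊢
  have := hpos z
  rw [← mul_div_assoc, ← add_div, ← add_div]
  congr 1
  linear_combination key

/-! ### The centered period parallelogram -/

/-- The period parallelogram centered at the origin. -/
def centeredParallelogram (τ : UpperHalfPlane) : Set ℂ :=
  (fun z => z + (1 + (τ : ℂ)) / 2) ⁻¹' periodParallelogram τ

/-- The closed period parallelogram centered at the origin. -/
def closedCenteredParallelogram (τ : UpperHalfPlane) : Set ℂ :=
  (fun p : ℝ × ℝ => (p.1 : ℂ) + p.2 * (τ : ℂ)) '' Set.Icc (-(1 / 2)) (1 / 2) ×ˢ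
    Set.Icc (-(1 / 2)) (1 / 2)

theorem isCompact_closedCenteredParallelogram (τ : UpperHalfPlane) :
    IsCompact (closedCenteredParallelogram τ) :=
  (isCompact_Icc.prod isCompact_Icc).image (by fun_prop)

theorem centeredParallelogram_subset (τ : UpperHalfPlane) :
    centeredParallelogram τ ⊆ closedCenteredParallelogram τ := by
  rintro z ⟨s, hs, t, ht, h⟩
  refine ⟨(s - 1 / 2, t - 1 / 2), ⟨⟨?_, ?_⟩, ⟨?_, ?_⟩⟩, ?_⟩
  · have := hs.1; simp only; linarith
  · have := hs.2; simp only; linarith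
  · have := ht.1; simp only; linarith
  · have := ht.2; simp only; linarith
  · simp only at h ⊢
    push_cast
    linear_combination -h

/-- The coordinates of a lattice point are integers, here of absolute value at most `1/2`. Thus the
origin is the only zero of `θ` in the closed centered parallelogram. -/
theorem eq_zero_of_mem_closedCenteredParallelogram {τ : UpperHalfPlane} {z : ℂ}
    (hz : z ∈ closedCenteredParallelogram τ) (hl : z ∈ (torusPeriods τ).lattice) : z = 0 := by
  obtain ⟨⟨s, t⟩, ⟨⟨hs1, hs2⟩, ⟨ht1, ht2⟩⟩, rfl⟩ := hz
  obtain ⟨m, n, h⟩ := mem_torusLattice.1 hl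
  have him := congrArg Complex.im h
  have hre := congrArg Complex.re h
  simp at him hre hs1 hs2 ht1 ht2 ⊢
  have hn : (n : ℝ) = t := by
    rcases him with h | h
    · exact h
    · exact absurd h τ.im_pos.ne'
  have hn0 : n = 0 := by
    rw [← hn] at ht1 ht2
    have h1 : (n : ℝ) < 1 := by linarith
    have h2 : (-1 : ℝ) < n := by linarith
    have h1' : n < 1 := by exact_mod_cast h1
    have h2' : -1 < n := by exact_mod_cast h2
    omega
  have ht0 : t = 0 := by rw [← hn, hn0]; simp
  rw [hn0, ht0] at hre
  have hm : (m : ℝ) = s := by simpa using hre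
  have hm0 : m = 0 := by
    rw [← hm] at hs1 hs2
    have h1 : (m : ℝ) < 1 := by linarith
    have h2 : (-1 : ℝ) < m := by linarith
    have h1' : m < 1 := by exact_mod_cast h1
    have h2' : -1 < m := by exact_mod_cast h2
    omega
  rw [← hm, ht0, hm0]
  simp

theorem centeredParallelogram_mem_nhds (τ : UpperHalfPlane) :
    centeredParallelogram τ ∈ nhds (0 : ℂ) := by
  have hI := τ.im_pos
  have hc1 : Continuous fun z : ℂ => z.im / τ.im := by fun_prop
  have hc2 : Continuous fun z : ℂ => z.re - z.im / τ.im * τ.re := by fun_prop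
  have h1 : ∀ᶠ z : ℂ in nhds 0, z.im / τ.im ∈ Set.Ioo (-(1 / 2) : ℝ) (1 / 2) :=
    hc1.continuousAt.eventually_mem (isOpen_Ioo.mem_nhds (by simp))
  have h2 : ∀ᶠ z : ℂ in nhds 0, z.re - z.im / τ.im * τ.re ∈ Set.Ioo (-(1 / 2) : ℝ) (1 / 2) :=
    hc2.continuousAt.eventually_mem (isOpen_Ioo.mem_nhds (by simp))
  filter_upwards [h1, h2] with z hz1 hz2
  refine ⟨z.re - z.im / τ.im * τ.re + 1 / 2, ⟨by linarith [hz2.1], by linarith [hz2.2]⟩,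
    z.im / τ.im + 1 / 2, ⟨by linarith [hz1.1], by linarith [hz1.2]⟩, ?_⟩
  · have him : (τ : ℂ).im = τ.im := rfl
    have hre : (τ : ℂ).re = τ.re := rfl
    apply Complex.ext
    · simp
      ring
    · simp
      field_simp

theorem measurableSet_centeredParallelogram (τ : UpperHalfPlane) :
    MeasurableSet (centeredParallelogram τ) :=
  measurableSet_preimage (by fun_prop) (measurableSet_periodParallelogram τ)

/-! ### Size of the norm of the theta function near its zero -/

/-- The quotient of `|θ|² e^{-ψ}` by `|z|²`. -/
noncomputable def thetaNormQuotient (τ : UpperHalfPlane) (z : ℂ) : ℝ :=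
  Complex.normSq (thetaQuotient τ z) * Real.exp (-thetaWeight τ z)

theorem thetaNorm_eq_mul (τ : UpperHalfPlane) (z : ℂ) :
    thetaNorm τ z = ‖z‖ ^ 2 * thetaNormQuotient τ z := by
  rw [thetaNorm, thetaProduct_eq_mul_thetaQuotient, map_mul, Complex.normSq_eq_norm_sq z,
    thetaNormQuotient, mul_assoc]

theorem continuous_thetaNormQuotient (τ : UpperHalfPlane) : Continuous (thetaNormQuotient τ) :=
  (Complex.continuous_normSq.comp (differentiable_thetaQuotient τ).continuous).mul
    (Real.continuous_exp.comp (contDiff_thetaWeight τ).continuous.neg)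

theorem thetaNormQuotient_pos {τ : UpperHalfPlane} {z : ℂ}
    (hz : z ∈ (torusPeriods τ).lattice → z = 0) : 0 < thetaNormQuotient τ z :=
  mul_pos (Complex.normSq_pos.2 (thetaQuotient_ne_zero hz)) (Real.exp_pos _)

/-- A positive continuous function on a compact set is bounded below. The extra condition `c ≤ 1`
later gives `c (1 + |w|²) ≤ |w|² Q + 1` for the quotient `Q = N/|z|²`. -/
theorem exists_le_thetaNormQuotient (τ : UpperHalfPlane) :
    ∃ c : ℝ, 0 < c ∧ c ≤ 1 ∧ ∀ z ∈ closedCenteredParallelogram τ, c ≤ thetaNormQuotient τ z := by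
  have hne : (closedCenteredParallelogram τ).Nonempty :=
    ⟨0, centeredParallelogram_subset τ (mem_of_mem_nhds (centeredParallelogram_mem_nhds τ))⟩
  obtain ⟨z₀, hz₀, h⟩ := (isCompact_closedCenteredParallelogram τ).exists_isMinOn hne
    (continuous_thetaNormQuotient τ).continuousOn
  refine ⟨min (thetaNormQuotient τ z₀) 1, lt_min (thetaNormQuotient_pos fun hl =>
    eq_zero_of_mem_closedCenteredParallelogram hz₀ hl) one_pos, min_le_right _ _,
    fun z hz => (min_le_left _ _).trans (h hz)⟩

theorem volume_torusLattice (τ : UpperHalfPlane) :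
    volume ((torusPeriods τ).lattice : Set ℂ) = 0 := by
  have : Countable ((torusPeriods τ).lattice : Set ℂ) := countable_torusLattice τ
  exact (Set.to_countable _).measure_zero _

/-- In polar coordinates the integrand becomes `y log y`, which is continuous up to 0. -/
theorem integrableOn_ball_log_norm (R : ℝ) :
    IntegrableOn (fun z : ℂ => Real.log ‖z‖) (Metric.ball 0 R) := by
  rw [integrableOn_fun_norm_addHaar]
  have : IntegrableOn (fun y : ℝ => y * Real.log y) (Set.Icc 0 R) :=
    Real.continuous_mul_log.continuousOn.integrableOn_Icc
  simpa using! this.mono_set Set.Ioo_subset_Icc_self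

/-- On the centered parallelogram `log N` is `2 log |z|` plus the logarithm of the positive
continuous function `N/|z|²`. -/
theorem integrableOn_log_thetaNorm (τ : UpperHalfPlane) :
    IntegrableOn (fun z => Real.log (thetaNorm τ z)) (periodParallelogram τ) := by
  have hper : IsTorusPeriodic τ fun z => Real.log (thetaNorm τ z) :=
    (isTorusPeriodic_thetaNorm τ).comp Real.log
  rw [← hper.integrableOn_preimage ((1 + (τ : ℂ)) / 2)]
  obtain ⟨R, hR⟩ := (isCompact_closedCenteredParallelogram τ).isBounded.subset_ball (0 : ℂ)
  have hK := isCompact_closedCenteredParallelogram τ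
  have h1 : IntegrableOn (fun z : ℂ => 2 * Real.log ‖z‖) (closedCenteredParallelogram τ) :=
    ((integrableOn_ball_log_norm R).mono_set hR).const_mul 2
  have h2 : IntegrableOn (fun z => Real.log (thetaNormQuotient τ z))
      (closedCenteredParallelogram τ) := by
    refine ContinuousOn.integrableOn_compact hK ?_
    exact (continuous_thetaNormQuotient τ).continuousOn.log fun z hz =>
      (thetaNormQuotient_pos fun hl => eq_zero_of_mem_closedCenteredParallelogram hz hl).ne'
  refine IntegrableOn.mono_set ((h1.add h2).congr ?_) (centeredParallelogram_subset τ)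
  have h0 : ∀ᵐ z : ℂ, z ≠ 0 := by simp [ae_iff, measure_singleton]
  filter_upwards [ae_restrict_mem hK.measurableSet, ae_restrict_of_ae h0] with z hz hz0
  have hq := thetaNormQuotient_pos (τ := τ) (z := z)
    fun hl => eq_zero_of_mem_closedCenteredParallelogram hz hl
  have hn : 0 < ‖z‖ := norm_pos_iff.2 hz0
  rw [thetaNorm_eq_mul, Real.log_mul (by positivity) hq.ne', Real.log_pow]
  simp

/-! ### The Laplacian of the logarithm in the sense of distributions -/

/-- Dominated convergence: for `0 < δ < 1` the integrand lies between `log N` and `log (N + 1)`, up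
to the bounded factor. The parameter is `δ²` to suit the rescaling `z = δw` used below. -/
theorem tendsto_setIntegral_log_thetaNorm_add (τ : UpperHalfPlane) {φ : ℂ → ℝ} {C : ℝ}
    (hφ : Continuous φ) (hC : ∀ z, ‖φ z‖ ≤ C) :
    Filter.Tendsto (fun δ : ℝ =>
        ∫ z in periodParallelogram τ, Real.log (thetaNorm τ z + δ ^ 2) * φ z)
      (nhdsWithin 0 (Set.Ioi 0))
      (nhds (∫ z in periodParallelogram τ, Real.log (thetaNorm τ z) * φ z)) := by
  have hN := (contDiff_thetaNorm τ).continuous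
  have hlat : ∀ᵐ z : ℂ, z ∉ (torusPeriods τ).lattice := by
    rw [ae_iff]
    simpa using! volume_torusLattice τ
  have hint : IntegrableOn (fun z => (‖Real.log (thetaNorm τ z)‖ +
      ‖Real.log (thetaNorm τ z + 1)‖) * C) (periodParallelogram τ) := by
    refine ((integrableOn_log_thetaNorm τ).norm.add ?_).mul_const C
    exact (IsTorusPeriodic.integrableOn_of_continuous
      ((isTorusPeriodic_thetaNorm τ).comp fun x => Real.log (x + 1))
      (contDiff_log_thetaNorm_add τ one_pos).continuous).norm
  refine tendsto_integral_filter_of_dominated_convergence _ ?_ ?_ hint ?_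
  · filter_upwards [self_mem_nhdsWithin] with δ hδ
    have hδ' : 0 < δ ^ 2 := pow_pos hδ 2
    exact ((contDiff_log_thetaNorm_add τ hδ').continuous.mul hφ).aestronglyMeasurable
  · filter_upwards [Ioo_mem_nhdsGT (zero_lt_one' ℝ)] with δ hδ
    filter_upwards [ae_restrict_of_ae hlat] with z hz
    have hp := thetaNorm_pos hz
    have hδ1 : δ ^ 2 ≤ 1 := pow_le_one₀ hδ.1.le hδ.2.le
    have l1 : Real.log (thetaNorm τ z) ≤ Real.log (thetaNorm τ z + δ ^ 2) :=
      Real.log_le_log hp (by linarith [sq_nonneg δ])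
    have l2 : Real.log (thetaNorm τ z + δ ^ 2) ≤ Real.log (thetaNorm τ z + 1) :=
      Real.log_le_log (by linarith [sq_nonneg δ]) (by linarith)
    rw [norm_mul]
    refine mul_le_mul ?_ (hC z) (norm_nonneg _) (by positivity)
    rw [Real.norm_eq_abs, Real.norm_eq_abs, Real.norm_eq_abs, abs_le]
    constructor
    · linarith [neg_abs_le (Real.log (thetaNorm τ z)),
        abs_nonneg (Real.log (thetaNorm τ z + 1))]
    · linarith [le_abs_self (Real.log (thetaNorm τ z + 1)),
        abs_nonneg (Real.log (thetaNorm τ z))]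
  · filter_upwards [ae_restrict_of_ae hlat] with z hz
    have hp := (thetaNorm_pos hz).ne'
    have h : ContinuousAt (fun δ : ℝ => Real.log (thetaNorm τ z + δ ^ 2) * φ z) 0 :=
      ((by fun_prop : ContinuousAt (fun δ : ℝ => thetaNorm τ z + δ ^ 2) 0).log
        (by simpa using hp)).mul continuousAt_const
    simpa using! h.tendsto.mono_left (nhdsWithin_le_nhds (s := Set.Ioi 0))

/-- The ratio lies in `[0, 1]` and tends to 1 off the lattice, a null set. -/
theorem tendsto_setIntegral_thetaNorm_ratio (τ : UpperHalfPlane) {φ : ℂ → ℝ} {C : ℝ}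
    (hφ : Continuous φ) (hC : ∀ z, ‖φ z‖ ≤ C) :
    Filter.Tendsto (fun δ : ℝ => ∫ z in periodParallelogram τ,
        thetaNorm τ z ^ 2 / (thetaNorm τ z + δ ^ 2) ^ 2 * φ z)
      (nhdsWithin 0 (Set.Ioi 0)) (nhds (∫ z in periodParallelogram τ, φ z)) := by
  have hN := (contDiff_thetaNorm τ).continuous
  have hlat : ∀ᵐ z : ℂ, z ∉ (torusPeriods τ).lattice := by
    rw [ae_iff]
    simpa using! volume_torusLattice τ
  have hint : IntegrableOn (fun _ : ℂ => C) (periodParallelogram τ) :=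
    integrableOn_const (volume_periodParallelogram_lt_top τ).ne
  refine tendsto_integral_filter_of_dominated_convergence _ ?_ ?_ hint ?_
  · filter_upwards [self_mem_nhdsWithin] with δ hδ
    have hδ' : 0 < δ ^ 2 := pow_pos hδ 2
    have hne : ∀ z, (thetaNorm τ z + δ ^ 2) ^ 2 ≠ 0 := fun z =>
      (pow_pos (add_pos_of_nonneg_of_pos (thetaNorm_nonneg τ z) hδ') 2).ne'
    exact (((hN.pow 2).div₀ ((hN.add continuous_const).pow 2) hne).mul hφ).aestronglyMeasurable
  · refine .of_forall fun δ => .of_forall fun z => ?_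
    rw [norm_mul, ← one_mul C]
    refine mul_le_mul ?_ (hC z) (norm_nonneg _) zero_le_one
    rw [← div_pow, norm_pow]
    refine pow_le_one₀ (norm_nonneg _) ?_
    have h0 := thetaNorm_nonneg τ z
    rw [Real.norm_of_nonneg (div_nonneg h0 (by positivity))]
    exact div_le_one_of_le₀ (by linarith [sq_nonneg δ]) (by positivity)
  · filter_upwards [ae_restrict_of_ae hlat] with z hz
    have hp := (thetaNorm_pos hz).ne'
    have h : ContinuousAt (fun δ : ℝ =>
        thetaNorm τ z ^ 2 / (thetaNorm τ z + δ ^ 2) ^ 2 * φ z) 0 :=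
      ContinuousAt.mul (ContinuousAt.div (by fun_prop) (by fun_prop) (by simpa using hp))
        continuousAt_const
    have h1 : thetaNorm τ z ^ 2 / (thetaNorm τ z + 0 ^ 2) ^ 2 * φ z = φ z := by
      rw [zero_pow two_ne_zero, add_zero, div_self (pow_ne_zero 2 hp), one_mul]
    have h2 := h.tendsto.mono_left (nhdsWithin_le_nhds (s := Set.Ioi 0))
    rwa [h1] at h2

/-- The mass of the rescaled limit of the regularized delta functions. -/
noncomputable def thetaMass (τ : UpperHalfPlane) : ℝ :=
  ∫ w : ℂ, Laplacian.laplacian (thetaNorm τ) 0 / (‖w‖ ^ 2 * thetaNormQuotient τ 0 + 1) ^ 2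

/-- Substitute `z = δw` on the centered parallelogram. As `N = |z|² Q(z)`, all powers of `δ` cancel
and the kernel becomes `1/(|w|² Q(δw) + 1)²`, so `ΔN` and `φ` are evaluated at the origin in the
limit. -/
theorem tendsto_setIntegral_laplacian_thetaNorm (τ : UpperHalfPlane) {φ : ℂ → ℝ}
    (hper : IsTorusPeriodic τ φ) (hφ : Continuous φ) :
    Filter.Tendsto (fun δ : ℝ => ∫ z in periodParallelogram τ,
        δ ^ 2 * Laplacian.laplacian (thetaNorm τ) z / (thetaNorm τ z + δ ^ 2) ^ 2 * φ z)
      (nhdsWithin 0 (Set.Ioi 0)) (nhds (thetaMass τ * φ 0)) := by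
  have hN := (contDiff_thetaNorm τ).continuous
  have hL := continuous_laplacian (contDiff_thetaNorm τ)
  have hNp := isTorusPeriodic_thetaNorm τ
  have hLp := hNp.laplacian (contDiff_thetaNorm τ)
  have hQ := continuous_thetaNormQuotient τ
  have hS := measurableSet_centeredParallelogram τ
  obtain ⟨C, hC⟩ := (hLp.comp₂ hper (· * ·)).exists_norm_le (hL.mul hφ)
  have hC0 : 0 ≤ C := (norm_nonneg _).trans (hC 0)
  obtain ⟨c, hc0, hc1, hc⟩ := exists_le_thetaNormQuotient τ
  set Q : ℝ → ℂ → ℝ := fun δ w => (centeredParallelogram τ).indicator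
    (fun z => Laplacian.laplacian (thetaNorm τ) z * φ z /
      (‖w‖ ^ 2 * thetaNormQuotient τ z + 1) ^ 2) (δ • w) with hQdef
  have hQeq : ∀ δ : ℝ, 0 < δ → ∫ z in periodParallelogram τ,
      δ ^ 2 * Laplacian.laplacian (thetaNorm τ) z / (thetaNorm τ z + δ ^ 2) ^ 2 * φ z =
      ∫ w, Q δ w := by
    intro δ hδ
    have hp : IsTorusPeriodic τ fun z =>
        δ ^ 2 * Laplacian.laplacian (thetaNorm τ) z / (thetaNorm τ z + δ ^ 2) ^ 2 * φ z := by
      intro l hl z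
      simp only [hNp l hl, hLp l hl, hper l hl]
    rw [← hp.setIntegral_preimage ((1 + (τ : ℂ)) / 2)]
    change ∫ z in centeredParallelogram τ, _ = _
    rw [← integral_indicator hS]
    set h : ℂ → ℝ := (centeredParallelogram τ).indicator fun z =>
      δ ^ 2 * Laplacian.laplacian (thetaNorm τ) z / (thetaNorm τ z + δ ^ 2) ^ 2 * φ z with hh
    have hscale := Measure.integral_comp_smul (volume : Measure ℂ) h δ
    rw [Complex.finrank_real_complex, abs_of_pos (by positivity), smul_eq_mul] at hscale
    have : ∫ z, h z = ∫ w, δ ^ 2 * h (δ • w) := by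
      rw [integral_const_mul, hscale]
      field_simp
    rw [this]
    congr 1
    ext w
    by_cases hw : δ • w ∈ centeredParallelogram τ
    · simp only [hh, hQdef, Set.indicator_of_mem hw]
      rw [thetaNorm_eq_mul, norm_smul, Real.norm_of_nonneg hδ.le]
      have : 0 < ‖w‖ ^ 2 * thetaNormQuotient τ (δ • w) + 1 := by
        have := hc _ (centeredParallelogram_subset τ hw)
        have : 0 ≤ thetaNormQuotient τ (δ • w) := by linarith
        positivity
      have e : (δ * ‖w‖) ^ 2 * thetaNormQuotient τ (δ • w) + δ ^ 2 =
          δ ^ 2 * (‖w‖ ^ 2 * thetaNormQuotient τ (δ • w) + 1) := by ring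
      rw [e]
      field_simp
    · simp only [hh, hQdef, Set.indicator_of_notMem hw, mul_zero]
  have hlim : Filter.Tendsto (fun δ => ∫ w, Q δ w) (nhdsWithin 0 (Set.Ioi 0))
      (nhds (∫ w : ℂ, Laplacian.laplacian (thetaNorm τ) 0 * φ 0 /
        (‖w‖ ^ 2 * thetaNormQuotient τ 0 + 1) ^ 2)) := by
    -- The majorant decays like `|w|⁻⁴`, which is integrable in real dimension 2.
    have hbint : Integrable (fun w : ℂ => C / c ^ 2 * (1 + ‖w‖ ^ 2) ^ (-(4 : ℝ) / 2)) :=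
      (integrable_rpow_neg_one_add_norm_sq (by rw [Complex.finrank_real_complex]; norm_num)).const_mul _
    refine tendsto_integral_filter_of_dominated_convergence _ ?_ ?_ hbint ?_
    · refine .of_forall fun δ => ?_
      have : Q δ = ((fun w : ℂ => δ • w) ⁻¹' centeredParallelogram τ).indicator fun w =>
          Laplacian.laplacian (thetaNorm τ) (δ • w) * φ (δ • w) /
            (‖w‖ ^ 2 * thetaNormQuotient τ (δ • w) + 1) ^ 2 := rfl
      rw [this]
      have hs : Measurable fun w : ℂ => δ • w := by fun_prop
      refine (Measurable.indicator ?_ (hs hS)).aestronglyMeasurable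
      have := hL.measurable
      have := hφ.measurable
      have := hQ.measurable
      fun_prop
    · refine .of_forall fun δ => .of_forall fun w => ?_
      by_cases hw : δ • w ∈ centeredParallelogram τ
      · simp only [hQdef, Set.indicator_of_mem hw]
        have hcz := hc _ (centeredParallelogram_subset τ hw)
        have hden : c * (1 + ‖w‖ ^ 2) ≤ ‖w‖ ^ 2 * thetaNormQuotient τ (δ • w) + 1 := by
          nlinarith [mul_le_mul_of_nonneg_left hcz (sq_nonneg ‖w‖)]
        have hpos : 0 < c * (1 + ‖w‖ ^ 2) := by positivity
        have e : (1 + ‖w‖ ^ 2) ^ (-(4 : ℝ) / 2) = ((1 + ‖w‖ ^ 2) ^ 2)⁻¹ := by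
          rw [show (-(4 : ℝ) / 2) = -((2 : ℕ) : ℝ) by norm_num, Real.rpow_neg (by positivity),
            Real.rpow_natCast]
        rw [e, norm_div, Real.norm_of_nonneg (sq_nonneg (_ + 1)), ← div_eq_mul_inv, div_div,
          ← mul_pow]
        exact div_le_div₀ hC0 (hC _) (by positivity) (pow_le_pow_left₀ hpos.le hden 2)
      · simp only [hQdef, Set.indicator_of_notMem hw, norm_zero]
        positivity
    · refine .of_forall fun w => ?_
      have hcont : ContinuousAt (fun δ : ℝ =>
          Laplacian.laplacian (thetaNorm τ) (δ • w) * φ (δ • w) /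
            (‖w‖ ^ 2 * thetaNormQuotient τ (δ • w) + 1) ^ 2) 0 := by
        refine ContinuousAt.div (by fun_prop) (by fun_prop) ?_
        rw [zero_smul]
        have := thetaNormQuotient_pos (τ := τ) (z := 0) fun _ => rfl
        positivity
      have ht := hcont.tendsto.mono_left (nhdsWithin_le_nhds (s := Set.Ioi 0))
      rw [zero_smul] at ht
      refine ht.congr' ?_
      have hm : ContinuousAt (fun δ : ℝ => δ • w) 0 := by fun_prop
      have hev : ∀ᶠ δ : ℝ in nhds 0, δ • w ∈ centeredParallelogram τ :=
        hm.eventually_mem (by simpa using centeredParallelogram_mem_nhds τ)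
      filter_upwards [nhdsWithin_le_nhds hev] with δ hδ
      simp only [hQdef, Set.indicator_of_mem hδ]
  have hval : ∫ w : ℂ, Laplacian.laplacian (thetaNorm τ) 0 * φ 0 /
      (‖w‖ ^ 2 * thetaNormQuotient τ 0 + 1) ^ 2 = thetaMass τ * φ 0 := by
    rw [thetaMass, ← integral_mul_const]
    congr 1
    ext w
    ring
  rw [hval] at hlim
  refine hlim.congr' ?_
  filter_upwards [self_mem_nhdsWithin] with δ hδ using (hQeq δ hδ).symm

/-- Green's identity moves the Laplacian onto the smooth function `log (N + δ²)`; then `δ → 0` on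
both sides. -/
theorem setIntegral_log_thetaNorm_mul_laplacian_aux {τ : UpperHalfPlane} {φ : ℂ → ℝ}
    (hper : IsTorusPeriodic τ φ) (hφ : ContDiff ℝ ∞ φ) :
    ∫ z in periodParallelogram τ, Real.log (thetaNorm τ z) * Laplacian.laplacian φ z =
      -(4 * Real.pi / τ.im) * (∫ z in periodParallelogram τ, φ z) + thetaMass τ * φ 0 := by
  obtain ⟨C, hC⟩ := hper.exists_norm_le hφ.continuous
  have hLp := hper.laplacian hφ
  have hLc := continuous_laplacian hφ
  obtain ⟨C', hC'⟩ := hLp.exists_norm_le hLc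
  have hNp := isTorusPeriodic_thetaNorm τ
  have hNc := (contDiff_thetaNorm τ).continuous
  have hNLp := hNp.laplacian (contDiff_thetaNorm τ)
  have hNLc := continuous_laplacian (contDiff_thetaNorm τ)
  have h1 := tendsto_setIntegral_log_thetaNorm_add τ hLc hC'
  have h2 := ((tendsto_setIntegral_thetaNorm_ratio τ hφ.continuous hC).const_mul
    (-(4 * Real.pi / τ.im))).add (tendsto_setIntegral_laplacian_thetaNorm τ hper hφ.continuous)
  refine tendsto_nhds_unique h1 (h2.congr' ?_)
  filter_upwards [self_mem_nhdsWithin] with δ hδ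
  have hδ' : 0 < δ ^ 2 := pow_pos hδ 2
  have hne : ∀ z, (thetaNorm τ z + δ ^ 2) ^ 2 ≠ 0 := fun z =>
    (pow_pos (add_pos_of_nonneg_of_pos (thetaNorm_nonneg τ z) hδ') 2).ne'
  rw [(hNp.comp fun x => Real.log (x + δ ^ 2)).setIntegral_mul_laplacian hper
    (contDiff_log_thetaNorm_add τ hδ') hφ, ← integral_const_mul, ← integral_add]
  · congr 1
    ext z
    rw [laplacian_log_thetaNorm_add τ hδ']
    ring
  · refine Integrable.const_mul (μ := volume.restrict _) (IsTorusPeriodic.integrableOn_of_continuous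
      (τ := τ) (k := fun z => thetaNorm τ z ^ 2 / (thetaNorm τ z + δ ^ 2) ^ 2 * φ z)
      (fun l hl z => ?_) ?_) _
    · simp only [hNp l hl, hper l hl]
    · exact ((hNc.pow 2).div₀ ((hNc.add continuous_const).pow 2) hne).mul hφ.continuous
  · refine IsTorusPeriodic.integrableOn_of_continuous (τ := τ) (fun l hl z => ?_) ?_
    · simp only [hNp l hl, hper l hl, hNLp l hl]
    · exact ((continuous_const.mul hNLc).div₀ ((hNc.add continuous_const).pow 2) hne).mul
        hφ.continuous

/-- The mass need not be integrated: for the test function 1 the left side vanishes, so the mass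
equals `4π/Im τ` times the area `Im τ`. -/
theorem thetaMass_eq (τ : UpperHalfPlane) : thetaMass τ = 4 * Real.pi := by
  have h := setIntegral_log_thetaNorm_mul_laplacian_aux (τ := τ) (φ := fun _ => 1)
    (fun l hl z => rfl) contDiff_const
  have hI := τ.im_pos.ne'
  have hV : volume.real (periodParallelogram τ) = τ.im := flatTorusArea_eq τ
  simp [hV] at h
  field_simp at h
  linarith

/-- `Δ log (|θ|² e^{-ψ}) = 4π δ₀ - 4π / Im τ` on the torus, in the sense of distributions. -/
theorem setIntegral_log_thetaNorm_mul_laplacian {τ : UpperHalfPlane} {φ : ℂ → ℝ}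
    (hper : IsTorusPeriodic τ φ) (hφ : ContDiff ℝ ∞ φ) :
    ∫ z in periodParallelogram τ, Real.log (thetaNorm τ z) * Laplacian.laplacian φ z =
      4 * Real.pi * φ 0 - 4 * Real.pi / τ.im * ∫ z in periodParallelogram τ, φ z := by
  rw [setIntegral_log_thetaNorm_mul_laplacian_aux hper hφ, thetaMass_eq]
  ring

/-! ### Functions on the torus from periodic functions -/

/-- The function on the torus given by a periodic function on `ℂ`. -/
noncomputable def torusLift (τ : UpperHalfPlane) {E : Type*} (k : ℂ → E) (p : FlatTorus τ) : E :=
  k (Function.surjInv (torusProj_surjective τ) p)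

theorem IsTorusPeriodic.eq_of_torusProj_eq {τ : UpperHalfPlane} {E : Type*} {k : ℂ → E}
    (hk : IsTorusPeriodic τ k) {z w : ℂ} (h : torusProj τ z = torusProj τ w) : k z = k w := by
  have := hk _ (torusProj_eq_iff.1 h) w
  rwa [add_sub_cancel] at this

theorem IsTorusPeriodic.torusLift_torusProj {τ : UpperHalfPlane} {E : Type*} {k : ℂ → E}
    (hk : IsTorusPeriodic τ k) (z : ℂ) : torusLift τ k (torusProj τ z) = k z :=
  hk.eq_of_torusProj_eq (Function.surjInv_eq _ _)

theorem isOpenQuotientMap_torusProj (τ : UpperHalfPlane) : IsOpenQuotientMap (torusProj τ) :=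
  ⟨torusProj_surjective τ, continuous_torusProj τ, isOpenMap_torusProj τ⟩

theorem IsTorusPeriodic.continuous_torusLift {τ : UpperHalfPlane} {E : Type*} [TopologicalSpace E]
    {k : ℂ → E} (hk : IsTorusPeriodic τ k) (hc : Continuous k) : Continuous (torusLift τ k) := by
  rw [← (isOpenQuotientMap_torusProj τ).continuous_comp_iff]
  exact hc.congr fun z => (hk.torusLift_torusProj z).symm

theorem torusProj_sub (τ : UpperHalfPlane) (z w : ℂ) :
    torusProj τ (z - w) = torusProj τ z - torusProj τ w := rfl

/-! ### Existence of the Green function -/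

/-- The monopole Green function with pole at the origin, as a periodic function. -/
noncomputable def greenCore (τ : UpperHalfPlane) (z : ℂ) : ℝ :=
  -(1 / (4 * Real.pi)) * Real.log (thetaNorm τ z) +
    1 / (4 * Real.pi) / τ.im * ∫ w in periodParallelogram τ, Real.log (thetaNorm τ w)

theorem isTorusPeriodic_greenCore (τ : UpperHalfPlane) : IsTorusPeriodic τ (greenCore τ) :=
  fun l hl z => by simp only [greenCore, isTorusPeriodic_thetaNorm τ l hl]

theorem integrableOn_greenCore (τ : UpperHalfPlane) :
    IntegrableOn (greenCore τ) (periodParallelogram τ) :=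
  ((integrableOn_log_thetaNorm τ).const_mul _).add
    (integrableOn_const (volume_periodParallelogram_lt_top τ).ne)

theorem contDiffAt_greenCore {τ : UpperHalfPlane} {z : ℂ} (hz : z ∉ (torusPeriods τ).lattice) :
    ContDiffAt ℝ ∞ (greenCore τ) z :=
  (contDiffAt_const.mul ((contDiff_thetaNorm τ).contDiffAt.log (thetaNorm_pos hz).ne')).add
    contDiffAt_const

theorem setIntegral_greenCore (τ : UpperHalfPlane) :
    ∫ z in periodParallelogram τ, greenCore τ z = 0 := by
  have hV : volume.real (periodParallelogram τ) = τ.im := flatTorusArea_eq τ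
  have hI := τ.im_pos.ne'
  unfold greenCore
  rw [integral_add ((integrableOn_log_thetaNorm τ).const_mul _)
    (integrableOn_const (volume_periodParallelogram_lt_top τ).ne), integral_const_mul]
  simp only [integral_const, MeasurableSet.univ, measureReal_restrict_apply, Set.univ_inter, hV,
    smul_eq_mul]
  field_simp
  ring

theorem IsTorusPeriodic.setIntegral_laplacian {τ : UpperHalfPlane} {φ : ℂ → ℝ}
    (hper : IsTorusPeriodic τ φ) (hφ : ContDiff ℝ ∞ φ) :
    ∫ z in periodParallelogram τ, Laplacian.laplacian φ z = 0 := by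
  have h1 : IsTorusPeriodic τ fun _ : ℂ => (1 : ℝ) := fun l hl z => rfl
  have := h1.setIntegral_mul_laplacian hper contDiff_const hφ
  have h0 : Laplacian.laplacian (fun _ : ℂ => (1 : ℝ)) = 0 :=
    funext fun z => by rw [laplacian_eq_fderiv_fderiv contDiff_const]; simp
  simpa [h0] using this

theorem setIntegral_greenCore_mul_laplacian {τ : UpperHalfPlane} {φ : ℂ → ℝ}
    (hper : IsTorusPeriodic τ φ) (hφ : ContDiff ℝ ∞ φ) :
    ∫ z in periodParallelogram τ, greenCore τ z * Laplacian.laplacian φ z =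
      -φ 0 + 1 / τ.im * ∫ z in periodParallelogram τ, φ z := by
  have hLp := hper.laplacian hφ
  have hLc := continuous_laplacian hφ
  obtain ⟨C, hC⟩ := hLp.exists_norm_le hLc
  have h1 : IntegrableOn (fun z => Real.log (thetaNorm τ z) * Laplacian.laplacian φ z)
      (periodParallelogram τ) :=
    (integrableOn_log_thetaNorm τ).mul_bdd hLc.aestronglyMeasurable (.of_forall hC)
  have h2 : IntegrableOn (Laplacian.laplacian φ) (periodParallelogram τ) :=
    hLp.integrableOn_of_continuous hLc
  simp only [greenCore, add_mul, mul_assoc]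
  rw [integral_add (h1.const_mul _), integral_const_mul, integral_const_mul, integral_const_mul,
    setIntegral_log_thetaNorm_mul_laplacian hper hφ, hper.setIntegral_laplacian hφ]
  · have := Real.pi_ne_zero
    have := τ.im_pos.ne'
    field_simp
    ring
  · exact (h2.const_mul _).const_mul _

theorem laplacian_comp_add {f : ℂ → ℝ} (hf : ContDiff ℝ ∞ f) (a z : ℂ) :
    Laplacian.laplacian (fun w => f (w + a)) z = Laplacian.laplacian f (z + a) := by
  have hf' : ContDiff ℝ ∞ fun w => f (w + a) := hf.comp (by fun_prop)
  rw [laplacian_eq_fderiv_fderiv (hf'.of_le two_le_infty),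
    laplacian_eq_fderiv_fderiv (hf.of_le two_le_infty)]
  have h : ∀ v, fderiv ℝ (fun w => fderiv ℝ (fun w => f (w + a)) w v) z =
      fderiv ℝ (fun w => fderiv ℝ f w v) (z + a) := by
    intro v
    simp only [fderiv_comp_add_right]
    rw [← fderiv_comp_add_right]
  rw [h, h]

/-- The monopole Green function of the torus. -/
noncomputable def torusGreen (τ : UpperHalfPlane) (p a : FlatTorus τ) : ℝ :=
  torusLift τ (greenCore τ) (p - a)

theorem torusGreen_torusProj (τ : UpperHalfPlane) (z a : ℂ) :
    torusGreen τ (torusProj τ z) (torusProj τ a) = greenCore τ (z - a) := by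
  rw [torusGreen, ← torusProj_sub, (isTorusPeriodic_greenCore τ).torusLift_torusProj]

theorem isMonopoleGreen_torusGreen (τ : UpperHalfPlane) : IsMonopoleGreen τ (torusGreen τ) where
  integrable a := by
    obtain ⟨a, rfl⟩ := torusProj_surjective τ a
    simp only [FlatTorusIntegrable, torusGreen_torusProj, sub_eq_add_neg]
    exact ((isTorusPeriodic_greenCore τ).integrableOn_comp_add _).2 (integrableOn_greenCore τ)
  continuousOn a := by
    obtain ⟨a, rfl⟩ := torusProj_surjective τ a
    intro p hp
    obtain ⟨z, rfl⟩ := torusProj_surjective τ p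
    refine ContinuousAt.continuousWithinAt ?_
    rw [← (isOpenQuotientMap_torusProj τ).continuousAt_comp_iff]
    have hz : z - a ∉ (torusPeriods τ).lattice := fun h => hp (torusProj_eq_iff.2 h)
    have h : ContinuousAt (fun w => greenCore τ (w - a)) z :=
      (contDiffAt_greenCore hz).continuousAt.comp (f := fun w => w - a) (by fun_prop)
    exact h.congr (.of_forall fun w => (torusGreen_torusProj τ w a).symm)
  equation a φ hφ := by
    obtain ⟨a, rfl⟩ := torusProj_surjective τ a
    have hper := isTorusPeriodic_comp_torusProj φ
    have hpa := hper.comp_const_add a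
    have hφa : ContDiff ℝ ∞ fun z => φ (torusProj τ (z + a)) :=
      hφ.comp (g := fun z => φ (torusProj τ z)) (f := fun z => z + a) (by fun_prop)
    -- The test function is translated by `a`, which moves the pole to the origin.
    have key := setIntegral_greenCore_mul_laplacian hpa hφa
    have hk : IsTorusPeriodic τ fun z => greenCore τ (z - a) *
        Laplacian.laplacian (fun w : ℂ => φ (torusProj τ w)) z := by
      intro l hl z
      simp only [add_sub_right_comm, isTorusPeriodic_greenCore τ l hl, hper.laplacian hφ l hl]
    have h1 := hk.setIntegral_comp_add a
    simp only [add_sub_cancel_right] at h1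
    simp only [laplacian_comp_add hφ, zero_add] at key
    simp only [torusGreen_torusProj]
    rw [← h1, key, hper.setIntegral_comp_add a, flatTorusArea_eq, flatTorusIntegral]
    ring
  normalized a := by
    obtain ⟨a, rfl⟩ := torusProj_surjective τ a
    simp only [flatTorusIntegral, torusGreen_torusProj, sub_eq_add_neg]
    rw [(isTorusPeriodic_greenCore τ).setIntegral_comp_add, setIntegral_greenCore]

/-! ### Characters of the torus -/

instance compactSpace_flatTorus (τ : UpperHalfPlane) : CompactSpace (FlatTorus τ) := by
  refine ⟨?_⟩
  rw [← (torusProj_surjective τ).range_eq]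
  exact IsZLattice.isCompact_range_of_periodic (torusPeriods τ).lattice _ (continuous_torusProj τ)
    fun z w hw => torusProj_add hw z

/-- The real linear form `s + tτ ↦ m s + n t`. -/
noncomputable def torusForm (τ : UpperHalfPlane) (m n : ℤ) : ℂ →L[ℝ] ℝ :=
  (m : ℝ) • Complex.reCLM + ((n - m * τ.re) / τ.im) • Complex.imCLM

theorem torusForm_apply (τ : UpperHalfPlane) (m n : ℤ) (z : ℂ) :
    torusForm τ m n z = m * z.re + (n - m * τ.re) / τ.im * z.im := by
  simp [torusForm]

theorem torusForm_of_mem {τ : UpperHalfPlane} (m n : ℤ) {l : ℂ}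
    (hl : l ∈ (torusPeriods τ).lattice) : ∃ k : ℤ, torusForm τ m n l = k := by
  obtain ⟨a, b, rfl⟩ := mem_torusLattice.1 hl
  have := τ.im_pos.ne'
  refine ⟨m * a + n * b, ?_⟩
  rw [torusForm_apply]
  simp
  field_simp
  ring

/-- The function `cos (2π(λ - θ))` for a linear form `λ` integral on the lattice. -/
noncomputable def torusWave (τ : UpperHalfPlane) (m n : ℤ) (θ : ℝ) (z : ℂ) : ℝ :=
  Real.cos (2 * Real.pi * torusForm τ m n z - θ)

theorem contDiff_torusWave (τ : UpperHalfPlane) (m n : ℤ) (θ : ℝ) :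
    ContDiff ℝ ∞ (torusWave τ m n θ) := by
  unfold torusWave
  fun_prop

theorem isTorusPeriodic_torusWave (τ : UpperHalfPlane) (m n : ℤ) (θ : ℝ) :
    IsTorusPeriodic τ (torusWave τ m n θ) := by
  intro l hl z
  obtain ⟨k, hk⟩ := torusForm_of_mem m n hl
  rw [torusWave, map_add, hk, torusWave,
    ← Real.cos_add_int_mul_two_pi (2 * Real.pi * torusForm τ m n z - θ) k]
  congr 1
  ring

/-- The waves are eigenfunctions whose eigenvalue vanishes only for `m = n = 0`. The phases `0` and
`π/2` give the real and imaginary parts of a character, so real test functions suffice. -/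
theorem laplacian_torusWave (τ : UpperHalfPlane) (m n : ℤ) (θ : ℝ) (z : ℂ) :
    Laplacian.laplacian (torusWave τ m n θ) z =
      -((2 * Real.pi) ^ 2 * (m ^ 2 + ((n - m * τ.re) / τ.im) ^ 2)) * torusWave τ m n θ z := by
  have hl : ∀ w, HasFDerivAt (fun w => 2 * Real.pi * torusForm τ m n w - θ)
      ((2 * Real.pi) • torusForm τ m n) w := fun w =>
    ((torusForm τ m n).hasFDerivAt.const_mul (2 * Real.pi)).sub_const θ
  have h1 : ∀ v w, fderiv ℝ (torusWave τ m n θ) w v =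
      -Real.sin (2 * Real.pi * torusForm τ m n w - θ) * (2 * Real.pi * torusForm τ m n v) := by
    intro v w
    have : HasFDerivAt (torusWave τ m n θ) _ w := (hl w).cos
    rw [this.fderiv]
    simp
  have h2 : ∀ v, fderiv ℝ (fun w => -Real.sin (2 * Real.pi * torusForm τ m n w - θ) *
      (2 * Real.pi * torusForm τ m n v)) z v =
      -(2 * Real.pi * torusForm τ m n v) ^ 2 * torusWave τ m n θ z := by
    intro v
    have := (hl z).sin.fun_neg.mul_const (2 * Real.pi * torusForm τ m n v)
    rw [this.fderiv, torusWave]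
    simp
    ring
  rw [laplacian_eq_fderiv_fderiv ((contDiff_torusWave τ m n θ).of_le two_le_infty)]
  simp only [h1, h2]
  simp [torusForm_apply]
  ring

/-- The characters of the torus, as periodic functions. -/
noncomputable def torusChar (τ : UpperHalfPlane) (m n : ℤ) (z : ℂ) : ℂ :=
  expTwoPiI (torusForm τ m n z)

theorem isTorusPeriodic_torusChar (τ : UpperHalfPlane) (m n : ℤ) :
    IsTorusPeriodic τ (torusChar τ m n) := by
  intro l hl z
  obtain ⟨k, hk⟩ := torusForm_of_mem m n hl
  rw [torusChar, map_add, hk, Complex.ofReal_add, expTwoPiI_add,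
    (expTwoPiI_eq_one_iff ((k : ℝ) : ℂ)).2 ⟨k, by simp⟩, mul_one]
  rfl

theorem continuous_torusChar (τ : UpperHalfPlane) (m n : ℤ) : Continuous (torusChar τ m n) := by
  have := differentiable_expTwoPiI.continuous
  unfold torusChar
  fun_prop

theorem torusForm_add (τ : UpperHalfPlane) (m n m' n' : ℤ) (z : ℂ) :
    torusForm τ (m + m') (n + n') z = torusForm τ m n z + torusForm τ m' n' z := by
  simp only [torusForm_apply]
  push_cast
  ring

theorem torusForm_neg (τ : UpperHalfPlane) (m n : ℤ) (z : ℂ) :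
    torusForm τ (-m) (-n) z = -torusForm τ m n z := by
  simp only [torusForm_apply]
  push_cast
  ring

theorem torusChar_eq (τ : UpperHalfPlane) (m n : ℤ) (z : ℂ) :
    torusChar τ m n z = torusWave τ m n 0 z + torusWave τ m n (Real.pi / 2) z * Complex.I := by
  have h : (2 * Real.pi * Complex.I * (torusForm τ m n z : ℂ)) =
      ((2 * Real.pi * torusForm τ m n z : ℝ) : ℂ) * Complex.I := by push_cast; ring
  rw [torusChar, expTwoPiI, h, Complex.exp_mul_I, torusWave, torusWave, sub_zero,
    Real.cos_sub_pi_div_two]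
  simp

/-- The characters of the torus. -/
noncomputable def torusCharMap (τ : UpperHalfPlane) (mn : ℤ × ℤ) : C(FlatTorus τ, ℂ) :=
  ⟨torusLift τ (torusChar τ mn.1 mn.2),
    (isTorusPeriodic_torusChar τ _ _).continuous_torusLift (continuous_torusChar τ _ _)⟩

theorem torusCharMap_torusProj (τ : UpperHalfPlane) (mn : ℤ × ℤ) (z : ℂ) :
    torusCharMap τ mn (torusProj τ z) = torusChar τ mn.1 mn.2 z :=
  (isTorusPeriodic_torusChar τ _ _).torusLift_torusProj z

theorem continuousMap_flatTorus_ext {τ : UpperHalfPlane} {f g : C(FlatTorus τ, ℂ)}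
    (h : ∀ z, f (torusProj τ z) = g (torusProj τ z)) : f = g := by
  ext p
  obtain ⟨z, rfl⟩ := torusProj_surjective τ p
  exact h z

theorem star_torusCharMap (τ : UpperHalfPlane) (mn : ℤ × ℤ) :
    star (torusCharMap τ mn) = torusCharMap τ (-mn) := by
  refine continuousMap_flatTorus_ext fun z => ?_
  rw [ContinuousMap.star_apply, torusCharMap_torusProj, torusCharMap_torusProj, Prod.fst_neg,
    Prod.snd_neg, torusChar, torusChar, torusForm_neg, expTwoPiI, expTwoPiI, Complex.star_def,
    ← Complex.exp_conj]
  congr 1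
  simp [Complex.conj_ofNat]

/-- The star algebra generated by the characters. -/
noncomputable def torusCharAlgebra (τ : UpperHalfPlane) : StarSubalgebra ℂ C(FlatTorus τ, ℂ) where
  toSubalgebra := Algebra.adjoin ℂ (Set.range (torusCharMap τ))
  star_mem' := by
    change Algebra.adjoin ℂ (Set.range (torusCharMap τ)) ≤
      star (Algebra.adjoin ℂ (Set.range (torusCharMap τ)))
    refine Algebra.adjoin_le ?_
    rintro _ ⟨mn, rfl⟩
    exact Algebra.subset_adjoin ⟨-mn, (star_torusCharMap τ mn).symm⟩

/-- Products of characters are characters and the constant 1 is the trivial one, so their linear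
span is already an algebra. -/
theorem torusCharAlgebra_toSubmodule (τ : UpperHalfPlane) :
    (torusCharAlgebra τ).toSubalgebra.toSubmodule =
      Submodule.span ℂ (Set.range (torusCharMap τ)) := by
  apply Algebra.adjoin_eq_span_of_subset
  refine .trans (fun x ↦ Submonoid.closure_induction (fun _ ↦ id) ⟨0, ?_⟩ ?_) Submodule.subset_span
  · refine continuousMap_flatTorus_ext fun z => ?_
    simp [torusCharMap_torusProj, torusChar, torusForm_apply, expTwoPiI]
  · rintro _ _ _ _ ⟨m, rfl⟩ ⟨n, rfl⟩
    refine ⟨m + n, continuousMap_flatTorus_ext fun z => ?_⟩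
    simp [torusCharMap_torusProj, torusChar, torusForm_add, expTwoPiI_add]

/-- If no character separates `z` and `w`, the forms with `(m, n) = (1, 0)` and `(0, 1)` are
integral at `z - w`, and these are its lattice coordinates. -/
theorem torusCharAlgebra_separatesPoints (τ : UpperHalfPlane) :
    (torusCharAlgebra τ).SeparatesPoints := by
  intro p q hpq
  obtain ⟨z, rfl⟩ := torusProj_surjective τ p
  obtain ⟨w, rfl⟩ := torusProj_surjective τ q
  by_contra hcon
  have key : ∀ mn : ℤ × ℤ, ∃ k : ℤ, torusForm τ mn.1 mn.2 (z - w) = k := by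
    intro mn
    have h : torusCharMap τ mn (torusProj τ z) = torusCharMap τ mn (torusProj τ w) := by
      by_contra hne
      exact hcon ⟨_, ⟨torusCharMap τ mn, Algebra.subset_adjoin ⟨mn, rfl⟩, rfl⟩, hne⟩
    rw [torusCharMap_torusProj, torusCharMap_torusProj, torusChar, torusChar] at h
    have h1 : expTwoPiI ((torusForm τ mn.1 mn.2 (z - w) : ℝ) : ℂ) = 1 := by
      rw [map_sub, Complex.ofReal_sub, sub_eq_add_neg, expTwoPiI_add, expTwoPiI_neg, h,
        mul_inv_cancel₀ (expTwoPiI_ne_zero _)]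
    obtain ⟨k, hk⟩ := (expTwoPiI_eq_one_iff _).1 h1
    exact ⟨k, by exact_mod_cast hk⟩
  obtain ⟨s, hs⟩ := key (1, 0)
  obtain ⟨t, ht⟩ := key (0, 1)
  refine hpq (torusProj_eq_iff.2 (mem_torusLattice.2 ⟨s, t, ?_⟩))
  have hI := τ.im_pos.ne'
  have him : (τ : ℂ).im = τ.im := rfl
  have hre : (τ : ℂ).re = τ.re := rfl
  rw [torusForm_apply] at hs ht
  push_cast at hs ht
  field_simp at hs ht
  apply Complex.ext
  · simp only [Complex.add_re, Complex.mul_re, Complex.intCast_re, Complex.intCast_im, hre, zero_mul,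
      sub_zero]
    apply mul_left_cancel₀ hI
    linear_combination -hs + τ.re * (by linear_combination -ht : (t : ℝ) * τ.im = (z - w).im)
  · simp only [Complex.add_im, Complex.mul_im, Complex.intCast_re, Complex.intCast_im, him, zero_mul,
      add_zero, zero_add]
    linear_combination -ht

/-- The Stone–Weierstrass theorem on the compact torus. -/
theorem span_torusCharMap_topologicalClosure (τ : UpperHalfPlane) :
    (Submodule.span ℂ (Set.range (torusCharMap τ))).topologicalClosure = ⊤ := by
  rw [← torusCharAlgebra_toSubmodule]
  exact congr_arg (Subalgebra.toSubmodule <| StarSubalgebra.toSubalgebra ·)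
    (ContinuousMap.starSubalgebra_topologicalClosure_eq_top_of_separatesPoints _
      (torusCharAlgebra_separatesPoints τ))

/-! ### Uniqueness of the Green function -/

section Uniqueness

variable {τ : UpperHalfPlane} {U : FlatTorus τ → ℝ}

/-- For a nonzero eigenvalue, testing against the wave itself gives the claim; the constant wave is
handled by the normalization. -/
theorem setIntegral_mul_torusWave_eq_zero
    (h0 : flatTorusIntegral τ U = 0)
    (hΔ : ∀ φ : ℂ → ℝ, IsTorusPeriodic τ φ → ContDiff ℝ ∞ φ →
      ∫ z in periodParallelogram τ, U (torusProj τ z) * Laplacian.laplacian φ z = 0)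
    (m n : ℤ) (θ : ℝ) :
    ∫ z in periodParallelogram τ, U (torusProj τ z) * torusWave τ m n θ z = 0 := by
  by_cases hmn : m = 0 ∧ n = 0
  · obtain ⟨rfl, rfl⟩ := hmn
    have : ∀ z, torusWave τ 0 0 θ z = Real.cos θ := fun z => by
      simp [torusWave, torusForm_apply]
    simp only [this]
    rw [integral_mul_const]
    exact mul_eq_zero_of_left h0 _
  · have h := hΔ _ (isTorusPeriodic_torusWave τ m n θ) (contDiff_torusWave τ m n θ)
    simp only [laplacian_torusWave, mul_left_comm (U _)] at h
    rw [integral_const_mul] at h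
    refine (mul_eq_zero.1 h).resolve_left (neg_ne_zero.2 (mul_ne_zero ?_ ?_))
    · have := Real.pi_ne_zero
      positivity
    · intro hs
      have hm : (m : ℝ) = 0 := by
        have := (add_eq_zero_iff_of_nonneg (sq_nonneg _) (sq_nonneg _)).1 hs
        exact pow_eq_zero_iff two_ne_zero |>.1 this.1
      have hn : (n - m * τ.re) / τ.im = 0 := by
        have := (add_eq_zero_iff_of_nonneg (sq_nonneg _) (sq_nonneg _)).1 hs
        exact pow_eq_zero_iff two_ne_zero |>.1 this.2
      rw [hm, zero_mul, sub_zero, div_eq_zero_iff] at hn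
      have hn' : (n : ℝ) = 0 := hn.resolve_right τ.im_pos.ne'
      exact hmn ⟨by exact_mod_cast hm, by exact_mod_cast hn'⟩

theorem integrableOn_mul_continuousMap (hU : FlatTorusIntegrable τ U) (v : C(FlatTorus τ, ℂ)) :
    IntegrableOn (fun z => (U (torusProj τ z) : ℂ) * v (torusProj τ z))
      (periodParallelogram τ) :=
  Integrable.mul_bdd (c := ‖v‖) (μ := volume.restrict _) hU.ofReal
    (v.continuous.comp (continuous_torusProj τ)).aestronglyMeasurable
    (.of_forall fun _ => v.norm_coe_le_norm _)

/-- Integration against an integrable function, as a functional on `C(M, ℂ)`. -/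
noncomputable def integralFunctional (hU : FlatTorusIntegrable τ U) : C(FlatTorus τ, ℂ) →L[ℂ] ℂ :=
  LinearMap.mkContinuous
    { toFun := fun v => ∫ z in periodParallelogram τ, (U (torusProj τ z) : ℂ) * v (torusProj τ z)
      map_add' := fun v w => by
        rw [← integral_add (integrableOn_mul_continuousMap hU v)
          (integrableOn_mul_continuousMap hU w)]
        simp only [ContinuousMap.add_apply, mul_add]
      map_smul' := fun c v => by
        simp only [ContinuousMap.smul_apply, smul_eq_mul, RingHom.id_apply]
        rw [← integral_const_mul]
        simp only [mul_left_comm] }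
    (∫ z in periodParallelogram τ, ‖(U (torusProj τ z) : ℂ)‖) fun v => by
      refine (norm_integral_le_of_norm_le (hU.ofReal.norm.mul_const ‖v‖)
        (.of_forall fun z => ?_)).trans_eq (integral_mul_const _ _)
      rw [norm_mul]
      exact mul_le_mul_of_nonneg_left (v.norm_coe_le_norm _) (norm_nonneg _)

theorem integralFunctional_apply (hU : FlatTorusIntegrable τ U) (v : C(FlatTorus τ, ℂ)) :
    integralFunctional hU v =
      ∫ z in periodParallelogram τ, (U (torusProj τ z) : ℂ) * v (torusProj τ z) := rfl

/-- The kernel of this continuous functional is closed and contains the characters, whose span is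
dense. -/
theorem integralFunctional_eq_zero (hU : FlatTorusIntegrable τ U) (h0 : flatTorusIntegral τ U = 0)
    (hΔ : ∀ φ : ℂ → ℝ, IsTorusPeriodic τ φ → ContDiff ℝ ∞ φ →
      ∫ z in periodParallelogram τ, U (torusProj τ z) * Laplacian.laplacian φ z = 0)
    (v : C(FlatTorus τ, ℂ)) : integralFunctional hU v = 0 := by
  have hle : Submodule.span ℂ (Set.range (torusCharMap τ)) ≤
      LinearMap.ker (integralFunctional hU).toLinearMap := by
    rw [Submodule.span_le]
    rintro _ ⟨⟨m, n⟩, rfl⟩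
    change integralFunctional hU _ = 0
    rw [integralFunctional_apply]
    have hw : ∀ θ, IntegrableOn (fun z => U (torusProj τ z) * torusWave τ m n θ z)
        (periodParallelogram τ) := fun θ =>
      Integrable.mul_bdd (c := 1) (μ := volume.restrict _) hU
        (contDiff_torusWave τ m n θ).continuous.aestronglyMeasurable
        (.of_forall fun z => Real.abs_cos_le_one _)
    have h1 : ∀ z, (U (torusProj τ z) : ℂ) * torusCharMap τ (m, n) (torusProj τ z) =
        ((U (torusProj τ z) * torusWave τ m n 0 z : ℝ) : ℂ) +
        ((U (torusProj τ z) * torusWave τ m n (Real.pi / 2) z : ℝ) : ℂ) * Complex.I := by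
      intro z
      rw [torusCharMap_torusProj, torusChar_eq]
      push_cast
      ring
    simp only [h1]
    rw [integral_add (hw 0).ofReal ((hw (Real.pi / 2)).ofReal.mul_const _), integral_mul_const,
      integral_complex_ofReal, integral_complex_ofReal, setIntegral_mul_torusWave_eq_zero h0 hΔ,
      setIntegral_mul_torusWave_eq_zero h0 hΔ]
    simp
  have hcl := Submodule.topologicalClosure_minimal _ hle
    (ContinuousLinearMap.isClosed_ker (integralFunctional hU))
  rw [span_torusCharMap_topologicalClosure] at hcl
  exact hcl (Submodule.mem_top (x := v))

/-- A continuous function with the sign of `U`, when `U` is continuous off the point `a`. -/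
theorem exists_continuousMap_sign {a : FlatTorus τ} (hc : ContinuousOn U {a}ᶜ) :
    ∃ v : C(FlatTorus τ, ℝ), ∀ p, 0 ≤ U p * v p ∧ (p ≠ a → U p ≠ 0 → U p * v p ≠ 0) := by
  have hNp := isTorusPeriodic_thetaNorm τ
  set N : FlatTorus τ → ℝ := torusLift τ (thetaNorm τ) with hN
  have hNc : Continuous N := hNp.continuous_torusLift (contDiff_thetaNorm τ).continuous
  have hNnonneg : ∀ p, 0 ≤ N p := fun p => thetaNorm_nonneg τ _
  have hN0 : ∀ p, N p = 0 ↔ p = 0 := by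
    intro p
    obtain ⟨z, rfl⟩ := torusProj_surjective τ p
    have h0 : (0 : FlatTorus τ) = torusProj τ 0 := rfl
    rw [hN, hNp.torusLift_torusProj, thetaNorm_eq_zero_iff, h0, torusProj_eq_iff, sub_zero]
  -- `g(U)` is bounded and has the sign of `U`. Multiplication by `N(p - a)`, which vanishes only at
  -- `a`, makes it continuous at the pole.
  set g : ℝ → ℝ := fun x => max (-1) (min 1 x) with hg
  have hgc : Continuous g := by fun_prop
  have hgb : ∀ x, |g x| ≤ 1 := fun x => abs_le.2
    ⟨le_max_left _ _, max_le (by norm_num) (min_le_left _ _)⟩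
  have hgs : ∀ x, 0 ≤ x * g x := by
    intro x
    rcases le_total 0 x with hx | hx
    · exact mul_nonneg hx (le_max_of_le_right (le_min zero_le_one hx))
    · exact mul_nonneg_of_nonpos_of_nonpos hx
        (max_le (by norm_num) ((min_le_right _ _).trans hx))
  have hg0 : ∀ x, x ≠ 0 → g x ≠ 0 := by
    intro x hx h
    rcases lt_or_gt_of_ne hx with hx | hx
    · have : g x < 0 := max_lt (by norm_num) ((min_le_right _ _).trans_lt hx)
      exact this.ne h
    · have : 0 < g x := lt_max_of_lt_right (lt_min one_pos hx)
      exact this.ne' h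
  refine ⟨⟨fun p => g (U p) * N (p - a), ?_⟩, fun p => ⟨?_, fun hp hU => ?_⟩⟩
  · rw [continuous_iff_continuousAt]
    intro p
    by_cases hp : p = a
    · subst hp
      have hN' : Filter.Tendsto (fun q => N (q - p)) (nhds p) (nhds 0) := by
        have h : Continuous fun q => N (q - p) := hNc.comp (continuous_id.sub continuous_const)
        have := h.tendsto p
        rwa [sub_self, (hN0 0).2 rfl] at this
      have e : g (U p) * N (p - p) = 0 := by rw [sub_self, (hN0 0).2 rfl, mul_zero]
      rw [ContinuousAt, e]
      refine squeeze_zero_norm (fun q => ?_) hN'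
      rw [norm_mul, Real.norm_eq_abs, Real.norm_of_nonneg (hNnonneg _)]
      exact mul_le_of_le_one_left (hNnonneg _) (hgb _)
    · have hop : IsOpen ({a}ᶜ : Set (FlatTorus τ)) := by
        have : ({a}ᶜ : Set (FlatTorus τ)) = {q | N (q - a) ≠ 0} := by
          ext q
          simp [hN0, sub_eq_zero]
        rw [this]
        exact isOpen_ne_fun (hNc.comp (continuous_id.sub continuous_const)) continuous_const
      have hUp : ContinuousAt U p := hc.continuousAt (hop.mem_nhds hp)
      exact (hgc.continuousAt.comp hUp).mul
        (hNc.comp (continuous_id.sub continuous_const)).continuousAt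
  · simp only [ContinuousMap.coe_mk]
    rw [← mul_assoc]
    exact mul_nonneg (hgs _) (hNnonneg _)
  · simp only [ContinuousMap.coe_mk]
    exact mul_ne_zero hU (mul_ne_zero (hg0 _ hU) (mt (hN0 _).1 (sub_ne_zero.2 hp)))

theorem isOpen_compl_singleton_flatTorus (τ : UpperHalfPlane) (a : FlatTorus τ) :
    IsOpen ({a}ᶜ : Set (FlatTorus τ)) := by
  obtain ⟨a, rfl⟩ := torusProj_surjective τ a
  rw [← (isOpenQuotientMap_torusProj τ).isQuotientMap.isOpen_preimage]
  have : torusProj τ ⁻¹' {torusProj τ a}ᶜ =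
      (fun z => z - a) ⁻¹' {z | z ∉ (torusPeriods τ).lattice} := by
    ext z
    simp [torusProj_eq_iff]
  rw [this]
  exact (isOpen_compl_torusLattice τ).preimage (by fun_prop)

/-- For `v` continuous with the sign of `U`, the integral of `U v ≥ 0` vanishes, so `U v = 0` almost
everywhere. If `U p ≠ 0`, continuity would make `U v` nonzero on an open set. -/
theorem eq_zero_of_setIntegral_mul_laplacian_eq_zero {a : FlatTorus τ}
    (hU : FlatTorusIntegrable τ U) (hc : ContinuousOn U {a}ᶜ) (h0 : flatTorusIntegral τ U = 0)
    (hΔ : ∀ φ : ℂ → ℝ, IsTorusPeriodic τ φ → ContDiff ℝ ∞ φ →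
      ∫ z in periodParallelogram τ, U (torusProj τ z) * Laplacian.laplacian φ z = 0)
    {p : FlatTorus τ} (hp : p ≠ a) : U p = 0 := by
  by_contra hne
  obtain ⟨v, hv⟩ := exists_continuousMap_sign hc
  obtain ⟨z₀, rfl⟩ := torusProj_surjective τ p
  have hz := integralFunctional_eq_zero hU h0 hΔ ⟨fun p => (v p : ℂ), by fun_prop⟩
  rw [integralFunctional_apply] at hz
  simp only [ContinuousMap.coe_mk, ← Complex.ofReal_mul] at hz
  rw [integral_complex_ofReal, Complex.ofReal_eq_zero] at hz
  obtain ⟨C, hC⟩ := (isTorusPeriodic_comp_torusProj (τ := τ) v).exists_norm_le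
    (v.continuous.comp (continuous_torusProj τ))
  have hint : IntegrableOn (fun z => U (torusProj τ z) * v (torusProj τ z))
      (periodParallelogram τ) :=
    Integrable.mul_bdd (c := C) (μ := volume.restrict _) hU
      (v.continuous.comp (continuous_torusProj τ)).aestronglyMeasurable (.of_forall hC)
  have hper : IsTorusPeriodic τ fun z => U (torusProj τ z) * v (torusProj τ z) :=
    isTorusPeriodic_comp_torusProj fun p => U p * v p
  -- This shift centers the domain of integration at `z₀`, so that it contains a neighbourhood of
  -- `z₀`.
  set c : ℂ := -z₀ + (1 + (τ : ℂ)) / 2 with hcdef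
  rw [← hper.setIntegral_preimage c] at hz
  rw [← hper.integrableOn_preimage c] at hint
  rw [integral_eq_zero_iff_of_nonneg (fun z => (hv _).1) hint] at hz
  have hS : (fun z => z + c) ⁻¹' periodParallelogram τ ∈ nhds z₀ := by
    have h1 : Filter.Tendsto (fun z => z - z₀) (nhds z₀) (nhds 0) := by
      have : Continuous fun z => z - z₀ := by fun_prop
      simpa using this.tendsto z₀
    have h2 := h1 (centeredParallelogram_mem_nhds τ)
    filter_upwards [h2] with z hz
    have : z + c = z - z₀ + (1 + (τ : ℂ)) / 2 := by rw [hcdef]; ring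
    simp only [Set.mem_preimage, this]
    exact hz
  have hW : ∀ᶠ z in nhds z₀, torusProj τ z ≠ a ∧ U (torusProj τ z) ≠ 0 := by
    have h1 : ∀ᶠ p in nhds (torusProj τ z₀), p ≠ a ∧ U p ≠ 0 :=
      (Filter.Eventually.and ((isOpen_compl_singleton_flatTorus τ a).mem_nhds hp)
        ((hc.continuousAt ((isOpen_compl_singleton_flatTorus τ a).mem_nhds hp)).eventually_ne hne))
    exact (continuous_torusProj τ).continuousAt.eventually h1
  have hpos := Measure.measure_pos_of_mem_nhds (volume : Measure ℂ) (Filter.inter_mem hS hW)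
  have hms : MeasurableSet ((fun z => z + c) ⁻¹' periodParallelogram τ) :=
    measurableSet_preimage (by fun_prop) (measurableSet_periodParallelogram τ)
  rw [Filter.EventuallyEq, ae_restrict_iff' hms, ae_iff] at hz
  refine hpos.ne' (measure_mono_null ?_ hz)
  rintro z ⟨hz1, hz2, hz3⟩ hz4
  exact (hv _).2 hz2 hz3 (hz4 hz1)

end Uniqueness

/-- The monopole Green function is unique off the diagonal. -/
theorem IsMonopoleGreen.eq_greenCore {τ : UpperHalfPlane} {G : FlatTorus τ → FlatTorus τ → ℝ}
    (hG : IsMonopoleGreen τ G) {z a : ℂ} (hza : z - a ∉ (torusPeriods τ).lattice) :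
    G (torusProj τ z) (torusProj τ a) = greenCore τ (z - a) := by
  have hT := isMonopoleGreen_torusGreen τ
  rw [← torusGreen_torusProj, ← sub_eq_zero]
  have hi1 : IntegrableOn (fun z => G (torusProj τ z) (torusProj τ a)) (periodParallelogram τ) :=
    hG.integrable (torusProj τ a)
  have hi2 : IntegrableOn (fun z => torusGreen τ (torusProj τ z) (torusProj τ a))
      (periodParallelogram τ) := hT.integrable (torusProj τ a)
  refine eq_zero_of_setIntegral_mul_laplacian_eq_zero
    (U := fun p => G p (torusProj τ a) - torusGreen τ p (torusProj τ a)) (a := torusProj τ a)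
    ?_ ?_ ?_ ?_ (fun h => hza (torusProj_eq_iff.1 h))
  · exact hi1.sub hi2
  · exact (hG.continuousOn _).sub (hT.continuousOn _)
  · have h1 := hG.normalized (torusProj τ a)
    have h2 := hT.normalized (torusProj τ a)
    rw [flatTorusIntegral] at h1 h2 ⊢
    rw [integral_sub hi1 hi2, h1, h2, sub_zero]
  · intro φ hper hφ
    have hlift : (fun w => torusLift τ φ (torusProj τ w)) = φ :=
      funext hper.torusLift_torusProj
    have hs : ContDiff ℝ ∞ fun w => torusLift τ φ (torusProj τ w) := by rwa [hlift]
    have h1 := hG.equation (torusProj τ a) (torusLift τ φ) hs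
    have h2 := hT.equation (torusProj τ a) (torusLift τ φ) hs
    rw [← h2, neg_inj, hlift] at h1
    obtain ⟨C, hC⟩ := (hper.laplacian hφ).exists_norm_le (continuous_laplacian hφ)
    have hm := (continuous_laplacian hφ).aestronglyMeasurable
      (μ := volume.restrict (periodParallelogram τ))
    simp only [sub_mul]
    rw [integral_sub (Integrable.mul_bdd (c := C) hi1 hm (.of_forall hC))
      (Integrable.mul_bdd (c := C) hi2 hm (.of_forall hC)), h1, sub_self]

/-! ### Wirtinger derivatives -/

theorem HasFDerivAt.wirtinger {f : ℂ → ℂ} {L : ℂ →L[ℝ] ℂ} {z : ℂ} (h : HasFDerivAt f L z) :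
    wirtinger f z = (L 1 - Complex.I * L Complex.I) / 2 := by
  rw [_root_.wirtinger, h.fderiv]

theorem HasFDerivAt.wirtingerBar {f : ℂ → ℂ} {L : ℂ →L[ℝ] ℂ} {z : ℂ} (h : HasFDerivAt f L z) :
    wirtingerBar f z = (L 1 + Complex.I * L Complex.I) / 2 := by
  rw [_root_.wirtingerBar, h.fderiv]

theorem Filter.EventuallyEq.wirtinger_eq {f g : ℂ → ℂ} {z : ℂ} (h : f =ᶠ[nhds z] g) :
    wirtinger f z = wirtinger g z := by
  rw [wirtinger, wirtinger, h.fderiv_eq]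

theorem Filter.EventuallyEq.wirtingerBar_eq {f g : ℂ → ℂ} {z : ℂ} (h : f =ᶠ[nhds z] g) :
    wirtingerBar f z = wirtingerBar g z := by
  rw [wirtingerBar, wirtingerBar, h.fderiv_eq]

theorem mixedDeriv_congr {F₁ F₂ : ℂ → ℂ → ℝ} {z a : ℂ}
    (h : ∀ᶠ p : ℂ × ℂ in nhds (z, a), F₁ p.1 p.2 = F₂ p.1 p.2) :
    mixedDeriv F₁ z a = mixedDeriv F₂ z a := by
  refine Filter.EventuallyEq.wirtinger_eq ?_
  filter_upwards [h.curry_nhds] with w hw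
  refine Filter.EventuallyEq.wirtinger_eq ?_
  filter_upwards [hw] with b hb
  rw [hb]

theorem mixedDerivBar_congr {F₁ F₂ : ℂ → ℂ → ℝ} {z a : ℂ}
    (h : ∀ᶠ p : ℂ × ℂ in nhds (z, a), F₁ p.1 p.2 = F₂ p.1 p.2) :
    mixedDerivBar F₁ z a = mixedDerivBar F₂ z a := by
  refine Filter.EventuallyEq.wirtinger_eq ?_
  filter_upwards [h.curry_nhds] with w hw
  refine Filter.EventuallyEq.wirtingerBar_eq ?_
  filter_upwards [hw] with b hb
  rw [hb]

/-! ### Logarithmic potentials with a quadratic term -/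

/-- The function `s (-log |F| + ψ / 2) + κ`. -/
noncomputable def logPotential (τ : UpperHalfPlane) (F : ℂ → ℂ) (s κ : ℝ) (z : ℂ) : ℝ :=
  s * (-Real.log ‖F z‖ + thetaWeight τ z / 2) + κ

theorem log_norm_eq (w : ℂ) : Real.log ‖w‖ = Real.log (Complex.normSq w) / 2 := by
  rw [Complex.normSq_eq_norm_sq, Real.log_pow]
  push_cast
  ring

section LogPotential

variable {τ : UpperHalfPlane} {F : ℂ → ℂ} {z a : ℂ}

/-- The general `F` and `s` serve two cases: `G` with `F = θ`, `s = 1/2π`, and its regular part `H`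
with `F = θ/z`, `s = 1`. -/
theorem contDiffAt_logPotential (hF : Differentiable ℂ F) (s κ : ℝ)
    (hz : F z ≠ 0) : ContDiffAt ℝ ∞ (logPotential τ F s κ) z := by
  have h1 : ContDiffAt ℝ ∞ (fun z => Real.log (Complex.normSq (F z))) z :=
    ((contDiff_complex_normSq.comp (contDiff_of_differentiable_complex hF)).contDiffAt).log
      (Complex.normSq_pos.2 hz).ne'
  unfold logPotential
  simp only [log_norm_eq]
  exact (contDiffAt_const.mul ((h1.div_const 2).neg.add
    ((contDiff_thetaWeight τ).contDiffAt.div_const 2))).add contDiffAt_const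

theorem fderiv_logPotential (hF : Differentiable ℂ F) (s κ : ℝ)
    (hz : F z ≠ 0) (v : ℂ) :
    fderiv ℝ (logPotential τ F s κ) z v =
      s * (-(deriv F z / F z * v).re + (2 * Real.pi * z.im / τ.im - Real.pi) * v.im) := by
  refine fderiv_eq_of_hasDerivAt_line
    ((contDiffAt_logPotential hF s κ hz).differentiableAt (by simp)) ?_
  obtain ⟨hr, hi⟩ := hasDerivAt_line_re_im hF z v 0
  have hw := hasDerivAt_line_thetaWeight τ z v 0
  have hn := (hr.mul hr).add (hi.mul hi)
  have hpos : 0 < (F z).re * (F z).re + (F z).im * (F z).im := by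
    rw [← Complex.normSq_apply]
    exact Complex.normSq_pos.2 hz
  have hl := hn.log (by simpa using hpos.ne')
  have := (((hl.div_const 2).neg.add (hw.div_const 2)).const_mul s).add_const κ
  simp only [logPotential, log_norm_eq, Complex.normSq_apply]
  refine this.congr_deriv ?_
  have e : (deriv F z / F z * v).re = ((deriv F z * v).re * (F z).re +
      (deriv F z * v).im * (F z).im) / ((F z).re * (F z).re + (F z).im * (F z).im) := by
    rw [div_mul_eq_mul_div, Complex.div_re, Complex.normSq_apply]
    ring
  rw [e]
  simp only [Complex.ofReal_zero, zero_mul, add_zero, Pi.mul_apply, Pi.add_apply]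
  field_simp
  ring

theorem hasFDerivAt_logPotential_sub (hF : Differentiable ℂ F) (s κ : ℝ)
    (hz : F (z - a) ≠ 0) :
    HasFDerivAt (fun b => (logPotential τ F s κ (z - b) : ℂ))
      (Complex.ofRealCLM.comp (-(fderiv ℝ (logPotential τ F s κ) (z - a)))) a := by
  have h1 := ((contDiffAt_logPotential hF s κ hz (τ := τ)).differentiableAt (by simp)).hasFDerivAt
  have h2 : HasFDerivAt (fun b : ℂ => z - b) (-(ContinuousLinearMap.id ℝ ℂ)) a := by
    simpa using (hasFDerivAt_id (𝕜 := ℝ) a).const_sub z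
  have h3 := Complex.ofRealCLM.hasFDerivAt.comp a (h1.comp a h2)
  refine h3.congr_fderiv ?_
  ext v
  simp

theorem wirtinger_logPotential_sub (hF : Differentiable ℂ F) (s κ : ℝ)
    (hz : F (z - a) ≠ 0) :
    wirtinger (fun b => (logPotential τ F s κ (z - b) : ℂ)) a =
      s * (deriv F (z - a) / F (z - a) / 2 +
        Complex.I * (Real.pi * (z - a).im / τ.im - Real.pi / 2)) := by
  rw [(hasFDerivAt_logPotential_sub hF s κ hz).wirtinger]
  simp only [ContinuousLinearMap.comp_apply, neg_apply,
    fderiv_logPotential hF s κ hz]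
  set q := deriv F (z - a) / F (z - a)
  apply Complex.ext <;> simp <;> ring

theorem wirtingerBar_logPotential_sub (hF : Differentiable ℂ F) (s κ : ℝ)
    (hz : F (z - a) ≠ 0) :
    wirtingerBar (fun b => (logPotential τ F s κ (z - b) : ℂ)) a =
      s * ((starRingEnd ℂ) (deriv F (z - a) / F (z - a)) / 2 -
        Complex.I * (Real.pi * (z - a).im / τ.im - Real.pi / 2)) := by
  rw [(hasFDerivAt_logPotential_sub hF s κ hz).wirtingerBar]
  simp only [ContinuousLinearMap.comp_apply, neg_apply,
    fderiv_logPotential hF s κ hz]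
  set q := deriv F (z - a) / F (z - a)
  apply Complex.ext <;> simp <;> ring

theorem eventually_ne_zero_sub (hF : Differentiable ℂ F) (hz : F (z - a) ≠ 0) : ∀ᶠ w in nhds z, F (w - a) ≠ 0 := by
  have hc : ContinuousAt (fun w => F (w - a)) z := by
    have := hF.continuous
    fun_prop
  exact hc.eventually_ne hz

theorem hasDerivAt_deriv_div_sub (hF : Differentiable ℂ F) (hz : F (z - a) ≠ 0) :
    HasDerivAt (fun w => deriv F (w - a) / F (w - a))
      (deriv (fun w => deriv F w / F w) (z - a)) z := by
  have h1 : DifferentiableAt ℂ (fun w => deriv F w / F w) (z - a) :=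
    ((hF.analyticAt _).deriv.differentiableAt).div (hF _) hz
  exact h1.hasDerivAt.comp_sub_const z a

theorem hasFDerivAt_im_term (c : ℂ) :
    HasFDerivAt (fun w : ℂ => c * (Real.pi * ((w - a).im : ℂ) / τ.im - Real.pi / 2))
      ((c * (Real.pi / τ.im)) • Complex.ofRealCLM.comp Complex.imCLM) z := by
  have h1 : HasFDerivAt (fun w : ℂ => ((w.im : ℝ) : ℂ)) (Complex.ofRealCLM.comp Complex.imCLM) z :=
    (Complex.ofRealCLM.comp Complex.imCLM).hasFDerivAt
  have h2 := (h1.const_mul (c * (Real.pi / τ.im))).const_add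
    (c * (-(Real.pi * (a.im : ℂ) / τ.im) - Real.pi / 2))
  refine h2.congr_of_eventuallyEq (.of_forall fun w => ?_)
  simp only [Complex.sub_im, Complex.ofReal_sub]
  ring

/-- `-log |F|` is locally `-Re log F`, which contributes `(log F)''/2`. The sign flip from
differentiating in `a` turns the quadratic term `π (Im (z - a))²/Im τ` into `+π/(2 Im τ)`. -/
theorem mixedDeriv_logPotential_sub (hF : Differentiable ℂ F) (s κ : ℝ)
    (hz : F (z - a) ≠ 0) :
    mixedDeriv (fun w b => logPotential τ F s κ (w - b)) z a =
      s * (deriv (fun w => deriv F w / F w) (z - a) / 2 + Real.pi / (2 * τ.im)) := by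
  have he : (fun w => wirtinger (fun b => (logPotential τ F s κ (w - b) : ℂ)) a) =ᶠ[nhds z]
      fun w => s * (deriv F (w - a) / F (w - a) / 2 +
        Complex.I * (Real.pi * (w - a).im / τ.im - Real.pi / 2)) := by
    filter_upwards [eventually_ne_zero_sub hF hz] with w hw
    exact wirtinger_logPotential_sub hF s κ hw
  have hq := ((hasDerivAt_deriv_div_sub hF hz).div_const 2).hasFDerivAt.restrictScalars ℝ
  have h := (hq.add (hasFDerivAt_im_term (τ := τ) (z := z) (a := a) Complex.I)).const_mul (s : ℂ)
  rw [mixedDeriv, he.wirtinger_eq]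
  refine h.wirtinger.trans ?_
  simp
  linear_combination (-(s : ℂ) * deriv (fun w => deriv F w / F w) (z - a) / 4 -
    s * Real.pi / τ.im / 2) * Complex.I_sq

/-- `∂/∂ā` of the logarithm is antiholomorphic in `z` and is killed by `∂/∂z`; only the quadratic
term survives. -/
theorem mixedDerivBar_logPotential_sub (hF : Differentiable ℂ F) (s κ : ℝ)
    (hz : F (z - a) ≠ 0) :
    mixedDerivBar (fun w b => logPotential τ F s κ (w - b)) z a =
      -(s * (Real.pi / (2 * τ.im))) := by
  have he : (fun w => wirtingerBar (fun b => (logPotential τ F s κ (w - b) : ℂ)) a) =ᶠ[nhds z]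
      fun w => s * (((starRingEnd ℂ) (deriv F (w - a) / F (w - a)) / 2) +
        (-Complex.I) * (Real.pi * (w - a).im / τ.im - Real.pi / 2)) := by
    filter_upwards [eventually_ne_zero_sub hF hz] with w hw
    rw [wirtingerBar_logPotential_sub hF s κ hw]
    ring
  have hq := ((hasDerivAt_deriv_div_sub hF hz).hasFDerivAt.restrictScalars ℝ)
  have hq' := ((Complex.conjCLE : ℂ →L[ℝ] ℂ).hasFDerivAt.comp z hq).mul_const (2⁻¹ : ℂ)
  have h := (hq'.add (hasFDerivAt_im_term (τ := τ) (z := z) (a := a) (-Complex.I))).const_mul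
    (s : ℂ)
  rw [mixedDerivBar, he.wirtinger_eq]
  simp only [div_eq_mul_inv _ (2 : ℂ)] at h ⊢
  refine h.wirtinger.trans ?_
  simp
  set q := (starRingEnd ℂ) (deriv (fun w => deriv F w / F w) (z - a))
  linear_combination ((s : ℂ) * q / 4 + s * Real.pi / τ.im / 2) * Complex.I_sq

end LogPotential

/-! ### The Green function as a logarithmic potential -/

/-- The additive constant of the Green function. -/
noncomputable def greenConst (τ : UpperHalfPlane) : ℝ :=
  1 / (4 * Real.pi) / τ.im * ∫ w in periodParallelogram τ, Real.log (thetaNorm τ w)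

theorem greenCore_eq_logPotential {τ : UpperHalfPlane} {z : ℂ}
    (hz : z ∉ (torusPeriods τ).lattice) :
    greenCore τ z =
      logPotential τ (thetaProduct τ) (1 / (2 * Real.pi)) (greenConst τ) z := by
  have h := (Complex.normSq_pos.2 (thetaProduct_ne_zero hz)).ne'
  have := Real.pi_ne_zero
  rw [greenCore, logPotential, thetaNorm, Real.log_mul h (Real.exp_ne_zero _), Real.log_exp,
    log_norm_eq, greenConst]
  field_simp
  ring

/-- The regular part of the Green function. -/
noncomputable def greenRegularPart (τ : UpperHalfPlane) (z : ℂ) : ℝ :=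
  logPotential τ (thetaQuotient τ) 1 (2 * Real.pi * greenConst τ) z

theorem greenCore_eq_regularPart {τ : UpperHalfPlane} {z : ℂ}
    (hz : z ∉ (torusPeriods τ).lattice) :
    greenCore τ z = 1 / (2 * Real.pi) * (-Real.log ‖z‖ + greenRegularPart τ z) := by
  have h0 : z ≠ 0 := fun h => hz (h ▸ zero_mem _)
  have h1 := thetaQuotient_ne_zero (τ := τ) (z := z) fun h => absurd h hz
  have := Real.pi_ne_zero
  rw [greenCore_eq_logPotential hz, logPotential, greenRegularPart, logPotential,
    thetaProduct_eq_mul_thetaQuotient, norm_mul,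
    Real.log_mul (norm_ne_zero_iff.2 h0) (norm_ne_zero_iff.2 h1)]
  field_simp
  ring

theorem contDiffAt_sub_comp {h : ℂ → ℝ} {z a : ℂ} (hh : ContDiffAt ℝ ∞ h (z - a)) :
    ContDiffAt ℝ ∞ (fun p : ℂ × ℂ => h (p.1 - p.2)) (z, a) :=
  ContDiffAt.comp (g := h) (f := fun p : ℂ × ℂ => p.1 - p.2) (z, a) hh
    (contDiff_fst.sub contDiff_snd).contDiffAt

/-- Near `(z, a)` the function `G` is the logarithmic potential of `θ`, and `(log θ)'' = -(℘ + η)`.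
Smoothness is then automatic, so only the formula for `L` remains as a condition. -/
theorem isSchifferKernel_iff {τ : UpperHalfPlane} {G : FlatTorus τ → FlatTorus τ → ℝ}
    (hG : IsMonopoleGreen τ G) (L : FlatTorus τ → FlatTorus τ → DoubleForm) :
    IsSchifferKernel τ G L ↔ ∀ z a : ℂ, torusProj τ z ≠ torusProj τ a →
      L (torusProj τ z) (torusProj τ a) =
        ((1 / Real.pi : ℂ) * ((torusPeriods τ).weierstrassP (z - a) + thetaEta τ)) • dzda
          - (1 / τ.im : ℂ) • dzda := by
  refine forall_congr' fun z => forall_congr' fun a => forall_congr' fun hza => ?_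
  have hl : z - a ∉ (torusPeriods τ).lattice := fun h => hza (torusProj_eq_iff.2 h)
  have hev : ∀ᶠ p : ℂ × ℂ in nhds (z, a), G (torusProj τ p.1) (torusProj τ p.2) =
      logPotential τ (thetaProduct τ) (1 / (2 * Real.pi)) (greenConst τ) (p.1 - p.2) := by
    have hc : ContinuousAt (fun p : ℂ × ℂ => p.1 - p.2) (z, a) := by fun_prop
    filter_upwards [hc.eventually (eventually_notMem_torusLattice hl)] with p hp
    rw [hG.eq_greenCore hp, greenCore_eq_logPotential hp]
  have hd := differentiable_thetaProduct τ
  have hne := thetaProduct_ne_zero hl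
  have hsm : ContDiffAt ℝ ∞ (fun p : ℂ × ℂ => G (torusProj τ p.1) (torusProj τ p.2)) (z, a) :=
    (contDiffAt_sub_comp (contDiffAt_logPotential hd _ _ hne)).congr_of_eventuallyEq hev
  have hval : mixedDeriv (fun w b => G (torusProj τ w) (torusProj τ b)) z a =
      1 / (2 * Real.pi) * (-((torusPeriods τ).weierstrassP (z - a) + thetaEta τ) / 2 +
        Real.pi / (2 * τ.im)) := by
    rw [mixedDeriv_congr (F₂ := fun w b => logPotential τ (thetaProduct τ) (1 / (2 * Real.pi))
      (greenConst τ) (w - b)) hev, mixedDeriv_logPotential_sub hd _ _ hne]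
    have : deriv (fun w => deriv (thetaProduct τ) w / thetaProduct τ w) (z - a) = _ :=
      (hasDerivAt_thetaLogDeriv hl).deriv
    rw [this]
    push_cast
    ring
  have hpi : (Real.pi : ℂ) ≠ 0 := by exact_mod_cast Real.pi_ne_zero
  have hI : (τ.im : ℂ) ≠ 0 := by exact_mod_cast τ.im_pos.ne'
  have hco : (-4 : ℂ) * mixedDeriv (fun w b => G (torusProj τ w) (torusProj τ b)) z a =
      (1 / Real.pi : ℂ) * ((torusPeriods τ).weierstrassP (z - a) + thetaEta τ) - 1 / τ.im := by
    rw [hval]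
    field_simp
    ring
  have hsub : ∀ x y : ℂ, (x - y) • dzda = x • dzda - y • dzda := fun x y => by
    ext v w
    simp [sub_mul]
  rw [hco, hsub]
  exact and_iff_right hsm

/-- Off the diagonal `H` is determined by `G`; on the diagonal its value is forced by continuity,
lattice points being isolated. -/
theorem eq_greenRegularPart {τ : UpperHalfPlane} {G : FlatTorus τ → FlatTorus τ → ℝ}
    (hG : IsMonopoleGreen τ G) {H : ℂ → ℂ → ℝ}
    (hH : ∀ z a : ℂ, torusProj τ z ≠ torusProj τ a → G (torusProj τ z) (torusProj τ a) =
        1 / (2 * Real.pi) * (-Real.log ‖z - a‖ + H z a))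
    (hs : ∀ z : ℂ, ContinuousAt (fun p : ℂ × ℂ => H p.1 p.2) (z, z)) {z a : ℂ}
    (hza : z - a ∈ (torusPeriods τ).lattice → z = a) : H z a = greenRegularPart τ (z - a) := by
  have hoff : ∀ z a : ℂ, z - a ∉ (torusPeriods τ).lattice → H z a = greenRegularPart τ (z - a) := by
    intro z a hl
    have h1 := hH z a fun h => hl (torusProj_eq_iff.1 h)
    rw [hG.eq_greenCore hl, greenCore_eq_regularPart hl] at h1
    have hpi : (1 / (2 * Real.pi)) ≠ 0 := by
      have := Real.pi_ne_zero
      positivity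
    linarith [mul_left_cancel₀ hpi h1]
  by_cases hl : z - a ∈ (torusPeriods τ).lattice
  · obtain rfl := hza hl
    have hreg : ContinuousAt (greenRegularPart τ) 0 :=
      (contDiffAt_logPotential (differentiable_thetaQuotient τ) _ _
        (thetaQuotient_ne_zero fun _ => rfl)).continuousAt
    have t1 : Filter.Tendsto (fun w => H (z + w) z) (nhdsWithin 0 {0}ᶜ) (nhds (H z z)) := by
      have hc : ContinuousAt (fun w : ℂ => (z + w, z)) 0 := by fun_prop
      have h2 : ContinuousAt (fun p : ℂ × ℂ => H p.1 p.2) ((fun w : ℂ => (z + w, z)) 0) := by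
        simpa using hs z
      have := (ContinuousAt.comp (f := fun w : ℂ => (z + w, z)) h2 hc).tendsto
      simp only [Function.comp_def, add_zero] at this
      exact this.mono_left nhdsWithin_le_nhds
    have t2 : Filter.Tendsto (greenRegularPart τ) (nhdsWithin 0 {0}ᶜ)
        (nhds (greenRegularPart τ 0)) := hreg.tendsto.mono_left nhdsWithin_le_nhds
    rw [sub_self]
    refine tendsto_nhds_unique t1 (t2.congr' ?_)
    filter_upwards [nhdsWithin_le_nhds ((torusPeriods τ).compl_lattice_sdiff_singleton_mem_nhds 0),
      self_mem_nhdsWithin] with w hw hw0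
    have hwl : w ∉ (torusPeriods τ).lattice := fun h => hw ⟨h, hw0⟩
    rw [hoff (z + w) z (by simpa using hwl), add_sub_cancel_left]
  · exact hoff z a hl

theorem mixedDerivBar_greenRegularPart {τ : UpperHalfPlane} {z a : ℂ}
    (hza : z - a ∈ (torusPeriods τ).lattice → z = a) :
    (-(2 / Real.pi : ℂ) * mixedDerivBar (fun w b => greenRegularPart τ (w - b)) z a) =
      1 / τ.im := by
  have h := mixedDerivBar_logPotential_sub (τ := τ) (differentiable_thetaQuotient τ) 1
    (2 * Real.pi * greenConst τ) (z := z) (a := a)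
    (thetaQuotient_ne_zero fun h => sub_eq_zero.2 (hza h))
  have h' : mixedDerivBar (fun w b => greenRegularPart τ (w - b)) z a = _ := h
  have hpi : (Real.pi : ℂ) ≠ 0 := by exact_mod_cast Real.pi_ne_zero
  have hI : (τ.im : ℂ) ≠ 0 := by exact_mod_cast τ.im_pos.ne'
  rw [h']
  push_cast
  field_simp

theorem isBergmanKernel_iff {τ : UpperHalfPlane} {G : FlatTorus τ → FlatTorus τ → ℝ}
    (hG : IsMonopoleGreen τ G) (K : FlatTorus τ → FlatTorus τ → DoubleForm) :
    IsBergmanKernel τ G K ↔ ∀ z a, K z a = (1 / τ.im : ℂ) • dzdaBar := by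
  constructor
  · rintro ⟨H, hH, hK⟩ p q
    have key : ∀ z a : ℂ, (torusProj τ z = torusProj τ a → z = a) →
        K (torusProj τ z) (torusProj τ a) = (1 / τ.im : ℂ) • dzdaBar := by
      intro z a hza
      have hza' : z - a ∈ (torusPeriods τ).lattice → z = a := fun h => hza (torusProj_eq_iff.2 h)
      rw [(hK z a hza).2, ← mixedDerivBar_greenRegularPart hza']
      congr 2
      refine mixedDerivBar_congr ?_
      have hc : ContinuousAt (fun p : ℂ × ℂ => p.1 - p.2) (z, a) := by fun_prop
      -- Avoiding the nonzero lattice vectors is an open condition, so `H` agrees with the regular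
      -- part on a whole neighbourhood and has the same derivatives.
      have hmem : (z - a) ∈ ((torusPeriods τ).lattice \ {0} : Set ℂ)ᶜ :=
        fun h => h.2 (sub_eq_zero.2 (hza' h.1))
      have ho := (torusPeriods τ).isOpen_compl_lattice_sdiff (s := {0})
      filter_upwards [hc.eventually (ho.mem_nhds hmem)] with p hp
      refine eq_greenRegularPart hG hH (fun z => (hK z z fun _ => rfl).1.continuousAt) fun h => ?_
      by_contra hne
      exact hp ⟨h, sub_ne_zero.2 hne⟩
    obtain ⟨z, rfl⟩ := torusProj_surjective τ p
    obtain ⟨a, rfl⟩ := torusProj_surjective τ q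
    -- Over the diagonal of `M × M` the same lift must be taken for both points.
    by_cases h : torusProj τ z = torusProj τ a
    · rw [h]
      exact key a a fun _ => rfl
    · exact key z a fun h' => absurd h' h
  · intro hK
    refine ⟨fun z a => greenRegularPart τ (z - a), fun z a hza => ?_, fun z a hza => ?_⟩
    · have hl : z - a ∉ (torusPeriods τ).lattice := fun h => hza (torusProj_eq_iff.2 h)
      rw [hG.eq_greenCore hl, greenCore_eq_regularPart hl]
    · have hza' : z - a ∈ (torusPeriods τ).lattice → z = a := fun h => hza (torusProj_eq_iff.2 h)
      refine ⟨contDiffAt_sub_comp (contDiffAt_logPotential (differentiable_thetaQuotient τ) _ _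
        (thetaQuotient_ne_zero fun h => sub_eq_zero.2 (hza' h))), ?_⟩
      rw [hK, mixedDerivBar_greenRegularPart hza']

/-! ### Periods of the Green function along the closed segments -/

/-- As `(*ψ)(v) = -ψ(iv)`, the star turns the real part of `(θ'/θ) v` into its imaginary part. -/
theorem starDGreen_apply {τ : UpperHalfPlane} {G : FlatTorus τ → FlatTorus τ → ℝ}
    (hG : IsMonopoleGreen τ G) {z a : ℂ} (hl : z - a ∉ (torusPeriods τ).lattice) (v : ℂ) :
    starDGreen τ G (torusProj τ a) z v =
      -(1 / (2 * Real.pi)) * (thetaLogDeriv τ (z - a) * v).im -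
        ((z - a).im / τ.im - 1 / 2) * v.re := by
  have he : (fun w => G (torusProj τ w) (torusProj τ a)) =ᶠ[nhds z]
      fun w => logPotential τ (thetaProduct τ) (1 / (2 * Real.pi)) (greenConst τ) (w - a) := by
    have hc : ContinuousAt (fun w => w - a) z := by fun_prop
    filter_upwards [hc.eventually (eventually_notMem_torusLattice hl)] with w hw
    rw [hG.eq_greenCore hw, greenCore_eq_logPotential hw]
  have h : fderiv ℝ (fun w => logPotential τ (thetaProduct τ) (1 / (2 * Real.pi))
      (greenConst τ) (w - a)) z = _ := fderiv_comp_sub (𝕜 := ℝ) a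
  have hpi := Real.pi_ne_zero
  have hI := τ.im_pos.ne'
  rw [starDGreen, he.fderiv_eq, h, hodgeStar]
  simp only [neg_apply, ContinuousLinearMap.comp_apply, ContinuousLinearMap.mul_apply']
  rw [fderiv_logPotential (differentiable_thetaProduct τ) _ _ (thetaProduct_ne_zero hl)]
  have e : (thetaLogDeriv τ (z - a) * (Complex.I * v)).re =
      -(thetaLogDeriv τ (z - a) * v).im := by
    rw [mul_left_comm, Complex.I_mul_re]
  change -(1 / (2 * Real.pi) * (-(thetaLogDeriv τ (z - a) * (Complex.I * v)).re + _)) = _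
  rw [e, Complex.I_mul_im]
  field_simp
  ring

section Period

variable {τ : UpperHalfPlane} {c a : ℂ}

theorem notMem_range_segment_iff :
    torusProj τ a ∉ Set.range (fun t => torusProj τ (Path.segment 0 c t)) ↔
      ∀ t ∈ Set.Icc (0 : ℝ) 1, (t : ℂ) * c - a ∉ (torusPeriods τ).lattice := by
  simp only [Set.mem_range, not_exists, torusProj_eq_iff, Path.segment_apply,
    AffineMap.lineMap_apply]
  refine ⟨fun h t ht => by simpa using h ⟨t, ht⟩, fun h t => by simpa using h t t.2⟩

theorem continuousAt_deriv_thetaLogDeriv {z : ℂ} (hz : z ∉ (torusPeriods τ).lattice) :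
    ContinuousAt (deriv (thetaLogDeriv τ)) z := by
  have hon : DifferentiableOn ℂ (thetaLogDeriv τ) {z | z ∉ (torusPeriods τ).lattice} :=
    fun w hw => (differentiableAt_thetaLogDeriv hw).differentiableWithinAt
  exact ((hon.deriv (isOpen_compl_torusLattice τ)).differentiableAt
    ((isOpen_compl_torusLattice τ).mem_nhds hz)).continuousAt

theorem continuousOn_segment_comp {h : ℂ → ℂ}
    (hh : ∀ z ∉ (torusPeriods τ).lattice, ContinuousAt h z)
    (ha : ∀ t ∈ Set.Icc (0 : ℝ) 1, (t : ℂ) * c - a ∉ (torusPeriods τ).lattice) :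
    ContinuousOn (fun t : ℝ => h (t * c - a)) (Set.uIcc 0 1) := by
  rw [Set.uIcc_of_le zero_le_one]
  intro t ht
  refine ContinuousAt.continuousWithinAt ?_
  exact ContinuousAt.comp (f := fun t : ℝ => (t : ℂ) * c - a) (hh _ (ha t ht)) (by fun_prop)

theorem eventually_segment_notMem
    (ha : ∀ t ∈ Set.Icc (0 : ℝ) 1, (t : ℂ) * c - a ∉ (torusPeriods τ).lattice) :
    ∀ᶠ b in nhds a, ∀ t ∈ Set.Icc (0 : ℝ) 1, (t : ℂ) * c - b ∉ (torusPeriods τ).lattice := by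
  refine isCompact_Icc.eventually_forall_of_forall_eventually fun t ht => ?_
  have hc : ContinuousAt (fun p : ℂ × ℝ => (p.2 : ℂ) * c - p.1) (a, t) := by fun_prop
  exact hc.eventually (eventually_notMem_torusLattice (ha t ht))

/-- Under the integral sign the `b`-derivative of `(θ'/θ)(tc - b) c` is minus its `t`-derivative
counterpart `d/dt (θ'/θ)(tc - b)`, so the integral is minus the increment of `θ'/θ` along the
segment. -/
theorem hasDerivAt_integral_thetaLogDeriv {δ : ℂ}
    (hδ : ∀ z ∉ (torusPeriods τ).lattice, thetaLogDeriv τ (z + c) = thetaLogDeriv τ z + δ)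
    (ha : ∀ t ∈ Set.Icc (0 : ℝ) 1, (t : ℂ) * c - a ∉ (torusPeriods τ).lattice) :
    HasDerivAt (fun b => ∫ t in (0 : ℝ)..1, thetaLogDeriv τ (t * c - b) * c) (-δ) a := by
  have hcu : ∀ z ∉ (torusPeriods τ).lattice, ContinuousAt (thetaLogDeriv τ) z :=
    fun z hz => (differentiableAt_thetaLogDeriv hz).continuousAt
  have hu' : ContinuousOn (fun t : ℝ => deriv (thetaLogDeriv τ) (t * c - a)) (Set.uIcc 0 1) :=
    continuousOn_segment_comp (fun z hz => continuousAt_deriv_thetaLogDeriv hz) ha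
  obtain ⟨C, hC⟩ := isCompact_uIcc.exists_bound_of_continuousOn hu'
  rw [Set.uIcc_of_le zero_le_one] at hC
  -- By compactness of the parameter interval, one neighbourhood of `a` works for all `t`; the bound
  -- is relaxed to `C + 1` to become an open condition.
  have hs : ∀ᶠ b in nhds a, ∀ t ∈ Set.Icc (0 : ℝ) 1, (t : ℂ) * c - b ∉ (torusPeriods τ).lattice ∧
      ‖deriv (thetaLogDeriv τ) (t * c - b)‖ < C + 1 := by
    refine isCompact_Icc.eventually_forall_of_forall_eventually fun t ht => ?_
    have hc : ContinuousAt (fun p : ℂ × ℝ => (p.2 : ℂ) * c - p.1) (a, t) := by fun_prop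
    refine (hc.eventually (eventually_notMem_torusLattice (ha t ht))).and ?_
    have h1 : ContinuousAt (fun p : ℂ × ℝ => ‖deriv (thetaLogDeriv τ) (p.2 * c - p.1)‖) (a, t) :=
      (ContinuousAt.comp (f := fun p : ℂ × ℝ => (p.2 : ℂ) * c - p.1)
        (continuousAt_deriv_thetaLogDeriv (ha t ht)) hc).norm
    exact h1.eventually_lt continuousAt_const ((hC t ht).trans_lt (lt_add_one C))
  have hsub : Set.uIoc (0 : ℝ) 1 ⊆ Set.Icc 0 1 := by
    rw [Set.uIoc_of_le zero_le_one]
    exact Set.Ioc_subset_Icc_self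
  have hint : ∀ b, (∀ t ∈ Set.Icc (0 : ℝ) 1, (t : ℂ) * c - b ∉ (torusPeriods τ).lattice) →
      IntervalIntegrable (fun t : ℝ => thetaLogDeriv τ (t * c - b) * c) volume 0 1 := fun b hb =>
    ((continuousOn_segment_comp hcu hb).mul continuousOn_const).intervalIntegrable
  have hint' : IntervalIntegrable (fun t : ℝ => -deriv (thetaLogDeriv τ) (t * c - a) * c)
      volume 0 1 := (hu'.neg.mul continuousOn_const).intervalIntegrable
  have hline : ∀ b : ℂ, ∀ t : ℝ, (t : ℂ) * c - b ∉ (torusPeriods τ).lattice →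
      HasDerivAt (fun b => thetaLogDeriv τ (t * c - b) * c)
        (-deriv (thetaLogDeriv τ) (t * c - b) * c) b := by
    intro b t hb
    have h1 := (differentiableAt_thetaLogDeriv hb).hasDerivAt
    have h2 : HasDerivAt (fun b : ℂ => (t : ℂ) * c - b) (-1) b := (hasDerivAt_id b).const_sub _
    have h3 := (h1.comp b h2).mul_const c
    refine h3.congr_deriv ?_
    ring
  have key := (intervalIntegral.hasDerivAt_integral_of_dominated_loc_of_deriv_le
    (F := fun b (t : ℝ) => thetaLogDeriv τ (t * c - b) * c)
    (F' := fun b (t : ℝ) => -deriv (thetaLogDeriv τ) (t * c - b) * c)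
    (bound := fun _ => (C + 1) * ‖c‖) (μ := volume) hs
    (by
      filter_upwards [hs] with b hb
      exact (hint b fun t ht => (hb t ht).1).aestronglyMeasurable_restrict_uIoc)
    (hint a ha) hint'.aestronglyMeasurable_restrict_uIoc
    (.of_forall fun t ht b hb => by
      rw [norm_mul, norm_neg]
      exact mul_le_mul_of_nonneg_right (hb t (hsub ht)).2.le (norm_nonneg c))
    intervalIntegrable_const
    (.of_forall fun t ht b hb => hline b t (hb t (hsub ht)).1)).2
  refine key.congr_deriv ?_
  have hftc : ∫ t in (0 : ℝ)..1, deriv (thetaLogDeriv τ) (t * c - a) * c =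
      thetaLogDeriv τ (c - a) - thetaLogDeriv τ (-a) := by
    have := intervalIntegral.integral_eq_sub_of_hasDerivAt (a := 0) (b := 1)
      (f := fun t : ℝ => thetaLogDeriv τ (t * c - a))
      (f' := fun t : ℝ => deriv (thetaLogDeriv τ) (t * c - a) * c) (fun t ht => ?_)
      (hu'.mul continuousOn_const).intervalIntegrable
    · simpa using this
    · rw [Set.uIcc_of_le zero_le_one] at ht
      have h1 := (differentiableAt_thetaLogDeriv (ha t ht)).hasDerivAt
      have h2 : HasDerivAt (fun t : ℝ => (t : ℂ) * c - a) c t := by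
        simpa using ((Complex.ofRealCLM.hasDerivAt (x := t)).mul_const c).sub_const a
      exact h1.comp_of_eq t h2 rfl
  have hna : -a ∉ (torusPeriods τ).lattice := by
    simpa using ha 0 (by simp)
  have := hδ _ hna
  rw [neg_add_eq_sub] at this
  simp only [neg_mul]
  rw [intervalIntegral.integral_neg, hftc, this]
  ring

/-- The differential of `U_γ` for the closed curve `γ` given by the segment from `0` to `c`. -/
noncomputable def periodDifferential (τ : UpperHalfPlane) (c : ℂ) : ℂ →L[ℝ] ℝ :=
  (c.re / τ.im) • Complex.imCLM - (c.im / τ.im) • Complex.reCLM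

theorem cyclePotential_segment {G : FlatTorus τ → FlatTorus τ → ℝ} (hG : IsMonopoleGreen τ G)
    (ha : ∀ t ∈ Set.Icc (0 : ℝ) 1, (t : ℂ) * c - a ∉ (torusPeriods τ).lattice) :
    CurveIntegrable (starDGreen τ G (torusProj τ a)) (Path.segment 0 c) ∧
    cyclePotential τ G (Path.segment 0 c) (torusProj τ a) =
      -(1 / (2 * Real.pi)) * (∫ t in (0 : ℝ)..1, thetaLogDeriv τ (t * c - a) * c).im -
        ((c.im / 2 - a.im) / τ.im - 1 / 2) * c.re := by
  have hcu : ∀ z ∉ (torusPeriods τ).lattice, ContinuousAt (thetaLogDeriv τ) z :=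
    fun z hz => (differentiableAt_thetaLogDeriv hz).continuousAt
  have hcont : ContinuousOn (fun t : ℝ => thetaLogDeriv τ (t * c - a) * c) (Set.uIcc 0 1) :=
    (continuousOn_segment_comp hcu ha).mul continuousOn_const
  have hint := hcont.intervalIntegrable (μ := volume)
  have heq : ∀ t ∈ Set.uIcc (0 : ℝ) 1,
      starDGreen τ G (torusProj τ a) (AffineMap.lineMap 0 c t) (c - 0) =
      -(1 / (2 * Real.pi)) * (thetaLogDeriv τ (t * c - a) * c).im -
        ((t * c.im - a.im) / τ.im - 1 / 2) * c.re := by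
    intro t ht
    rw [Set.uIcc_of_le zero_le_one] at ht
    have e : (AffineMap.lineMap 0 c t : ℂ) = t * c := by simp [AffineMap.lineMap_apply]
    rw [e, starDGreen_apply hG (ha t ht), sub_zero]
    simp
  have him : IntervalIntegrable (fun t : ℝ => (thetaLogDeriv τ (t * c - a) * c).im) volume 0 1 :=
    (Complex.continuous_im.comp_continuousOn hcont).intervalIntegrable
  have hlin : IntervalIntegrable (fun t : ℝ => ((t * c.im - a.im) / τ.im - 1 / 2) * c.re)
      volume 0 1 := Continuous.intervalIntegrable (by fun_prop) _ _
  constructor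
  · rw [curveIntegrable_segment]
    refine ((him.const_mul (-(1 / (2 * Real.pi)))).sub hlin).congr ?_
    intro t ht
    exact (heq t (Set.uIoc_subset_uIcc ht)).symm
  · rw [cyclePotential, curveIntegral_segment, intervalIntegral.integral_congr heq,
      intervalIntegral.integral_sub (him.const_mul _) hlin, intervalIntegral.integral_const_mul]
    congr 1
    · congr 1
      have := Complex.imCLM.intervalIntegral_comp_comm hint
      exact this
    · have h1 : ∫ t in (0 : ℝ)..1, ((t * c.im - a.im) / τ.im - 1 / 2) * c.re =
          ∫ t in (0 : ℝ)..1, (t * (c.im / τ.im * c.re) + (-(a.im / τ.im) - 1 / 2) * c.re) := by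
        congr 1
        ext t
        ring
      rw [h1, intervalIntegral.integral_add (Continuous.intervalIntegrable (by fun_prop) _ _)
        (Continuous.intervalIntegrable (by fun_prop) _ _), intervalIntegral.integral_mul_const,
        integral_id, intervalIntegral.integral_const]
      simp
      ring

/-- The hypothesis `hc` treats `c = 1` and `c = τ` together. The increment of `θ'/θ` produces the
`dx` part of `dU_γ`, and the linear term in `Im a` produces the `dy` part. -/
theorem hasFDerivAt_cyclePotential_segment {G : FlatTorus τ → FlatTorus τ → ℝ}
    (hG : IsMonopoleGreen τ G)
    (hc : ∀ z ∉ (torusPeriods τ).lattice,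
      thetaLogDeriv τ (z + c) = thetaLogDeriv τ z - 2 * Real.pi * Complex.I * (c.im / τ.im : ℝ))
    (ha : ∀ t ∈ Set.Icc (0 : ℝ) 1, (t : ℂ) * c - a ∉ (torusPeriods τ).lattice) :
    HasFDerivAt (fun b : ℂ => cyclePotential τ G (Path.segment 0 c) (torusProj τ b))
      (periodDifferential τ c) a := by
  have h1 := (hasDerivAt_integral_thetaLogDeriv (τ := τ)
    (δ := -(2 * Real.pi * Complex.I * (c.im / τ.im : ℝ)))
    (fun z hz => by rw [hc z hz, sub_eq_add_neg]) ha).hasFDerivAt.restrictScalars ℝ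
  have h2 := (Complex.imCLM.hasFDerivAt.comp a h1).const_mul (-(1 / (2 * Real.pi)))
  have h3 : HasFDerivAt (fun b : ℂ => ((c.im / 2 - b.im) / τ.im - 1 / 2) * c.re)
      ((-(c.re / τ.im)) • Complex.imCLM) a := by
    have h := ((Complex.imCLM.hasFDerivAt (x := a)).const_mul (-(c.re / τ.im))).const_add
      ((c.im / 2 / τ.im - 1 / 2) * c.re)
    refine h.congr_of_eventuallyEq (.of_forall fun b => ?_)
    simp
    ring
  refine ((h2.sub h3).congr_of_eventuallyEq ?_).congr_fderiv ?_
  · filter_upwards [eventually_segment_notMem ha] with b hb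
    exact (cyclePotential_segment hG hb).2
  · have hpi := Real.pi_ne_zero
    have hI := τ.im_pos.ne'
    ext v
    simp [periodDifferential]
    field_simp
    ring

/-- On the segment an integral linear form vanishes, so on all lifts of the curve it takes integer
values. Its preimage of `ℝ ∖ ℤ` misses them and is dense, because a nonzero form is an open map. -/
theorem dense_notMem_range_segment {m n : ℤ} (hmn : m ≠ 0 ∨ n ≠ 0) (hc : torusForm τ m n c = 0) :
    Dense {a : ℂ | torusProj τ a ∉ Set.range (fun t => torusProj τ (Path.segment 0 c t))} := by
  have hne : torusForm τ m n ≠ 0 := by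
    intro h
    have h1 : torusForm τ m n 1 = 0 := by rw [h]; rfl
    have h2 : torusForm τ m n τ = 0 := by rw [h]; rfl
    have him : (τ : ℂ).im = τ.im := rfl
    have hre : (τ : ℂ).re = τ.re := rfl
    have hI := τ.im_pos.ne'
    rw [torusForm_apply] at h1 h2
    have hm : (m : ℝ) = 0 := by simpa using h1
    rw [hm, him] at h2
    have hn : (n : ℝ) = 0 := by
      simp at h2
      rcases h2 with h | h
      · exact_mod_cast h
      · exact absurd h hI
    rcases hmn with h | h
    · exact h (by exact_mod_cast hm)
    · exact h (by exact_mod_cast hn)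
  have hsurj : Function.Surjective (torusForm τ m n) :=
    LinearMap.surjective (f := (torusForm τ m n).toLinearMap)
      fun h => hne (ContinuousLinearMap.coe_injective h)
  have hd : Dense (Set.range ((↑) : ℤ → ℝ))ᶜ := (Set.countable_range _).dense_compl ℝ
  refine (hd.preimage ((torusForm τ m n).isOpenMap hsurj)).mono fun a ha => ?_
  rw [Set.mem_ofPred_eq, notMem_range_segment_iff]
  intro t _ hl
  obtain ⟨k, hk⟩ := torusForm_of_mem m n hl
  have e : torusForm τ m n ((t : ℂ) * c) = 0 := by
    rw [← Complex.real_smul, map_smul, hc, smul_zero]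
  rw [map_sub, e, zero_sub] at hk
  exact ha ⟨-k, by push_cast; linarith⟩

/-- Off `γ` the form `dU_γ + i *dU_γ` is the constant multiple `-i c̄/Im τ` of `da`. The coefficient
of a holomorphic form is continuous, so agreement on the dense complement of `γ` forces equality
everywhere. -/
theorem isBasicHolomorphicForm_segment_iff {G : FlatTorus τ → FlatTorus τ → ℝ}
    (hG : IsMonopoleGreen τ G)
    (hc : ∀ z ∉ (torusPeriods τ).lattice,
      thetaLogDeriv τ (z + c) = thetaLogDeriv τ z - 2 * Real.pi * Complex.I * (c.im / τ.im : ℝ))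
    {m n : ℤ} (hmn : m ≠ 0 ∨ n ≠ 0) (hcm : torusForm τ m n c = 0)
    (θ : FlatTorus τ → (ℂ →L[ℝ] ℂ)) :
    IsBasicHolomorphicForm τ G (Path.segment 0 c) θ ↔
      ∀ a, θ a = (-Complex.I * (starRingEnd ℂ) c / τ.im : ℂ) • oneFormDa := by
  have hval : Complex.ofRealCLM.comp (periodDifferential τ c) +
      Complex.I • Complex.ofRealCLM.comp (hodgeStar (periodDifferential τ c)) =
      (-Complex.I * (starRingEnd ℂ) c / τ.im : ℂ) • oneFormDa := by
    have hI := τ.im_pos.ne'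
    ext v
    apply Complex.ext <;>
    · simp [periodDifferential, hodgeStar, oneFormDa, Complex.div_re, Complex.div_im,
        Complex.normSq_apply]
      field_simp
      ring
  constructor
  · rintro ⟨⟨f, hf, hθ⟩, h⟩ p
    have hfc : ∀ a : ℂ, f (torusProj τ a) = -Complex.I * (starRingEnd ℂ) c / τ.im := by
      refine congrFun (Continuous.ext_on (dense_notMem_range_segment hmn hcm) hf.continuous
        continuous_const fun a ha => ?_)
      have h1 := (h a ha).2.2
      rw [(hasFDerivAt_cyclePotential_segment hG hc (notMem_range_segment_iff.1 ha)).fderiv,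
        hval, hθ] at h1
      simpa [oneFormDa] using congrArg (fun L : ℂ →L[ℝ] ℂ => L 1) h1
    obtain ⟨a, rfl⟩ := torusProj_surjective τ p
    rw [hθ, hfc]
  · intro hθ
    refine ⟨⟨fun _ => -Complex.I * (starRingEnd ℂ) c / τ.im, differentiable_const _, hθ⟩,
      fun a ha => ?_⟩
    have ha' := notMem_range_segment_iff.1 ha
    have hd := hasFDerivAt_cyclePotential_segment hG hc ha'
    refine ⟨(cyclePotential_segment hG ha').1, hd.differentiableAt, ?_⟩
    rw [hd.fderiv, hval, hθ]

end Period

/-! ### The main theorem. -/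

theorem mainTheorem9 (τ : UpperHalfPlane) :
    (∃ G, IsMonopoleGreen τ G) ∧ (∃ η₁, IsEtaOne τ η₁) ∧
    ∀ (G : FlatTorus τ → FlatTorus τ → ℝ) (η₁ : ℂ),
      IsMonopoleGreen τ G → IsEtaOne τ η₁ →
      (∀ K : FlatTorus τ → FlatTorus τ → DoubleForm,
        IsBergmanKernel τ G K ↔ ∀ z a, K z a = (1 / τ.im : ℂ) • dzdaBar) ∧
      (∀ L : FlatTorus τ → FlatTorus τ → DoubleForm,
        IsSchifferKernel τ G L ↔
          ∀ z a : ℂ, torusProj τ z ≠ torusProj τ a →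
            L (torusProj τ z) (torusProj τ a) =
              ((1 / Real.pi : ℂ) * ((torusPeriods τ).weierstrassP (z - a) + η₁)) • dzda
                - (1 / τ.im : ℂ) • dzda) ∧
      (∀ θ : FlatTorus τ → (ℂ →L[ℝ] ℂ),
        IsBasicHolomorphicForm τ G (Path.segment 0 1) θ ↔
          ∀ a, θ a = (-Complex.I / τ.im : ℂ) • oneFormDa) ∧
      (∀ θ : FlatTorus τ → (ℂ →L[ℝ] ℂ),
        IsBasicHolomorphicForm τ G (Path.segment 0 (τ : ℂ)) θ ↔
          ∀ a, θ a = (-Complex.I * (starRingEnd ℂ) (τ : ℂ) / τ.im : ℂ) • oneFormDa) := by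
  refine ⟨⟨_, isMonopoleGreen_torusGreen τ⟩, ⟨_, isEtaOne_thetaEta τ⟩, fun G η₁ hG hη => ?_⟩
  obtain rfl := hη.eq_thetaEta
  have him : (τ : ℂ).im = τ.im := rfl
  have hre : (τ : ℂ).re = τ.re := rfl
  have hI := τ.im_pos.ne'
  refine ⟨isBergmanKernel_iff hG, isSchifferKernel_iff hG, fun θ => ?_, fun θ => ?_⟩
  -- The integral form `s + tτ ↦ t` vanishes along `α`, and `s + tτ ↦ s` along `β`.
  · rw [isBasicHolomorphicForm_segment_iff hG (c := 1) (m := 0) (n := 1) (fun z _ => ?_)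
      (.inr one_ne_zero) (by simp [torusForm_apply]) θ]
    · simp
    · simp [thetaLogDeriv_add_one]
  · refine isBasicHolomorphicForm_segment_iff hG (c := (τ : ℂ)) (m := 1) (n := 0) (fun z hz => ?_)
      (.inl one_ne_zero) ?_ θ
    · rw [thetaLogDeriv_add_tau hz, him, div_self hI]
      simp
    · rw [torusForm_apply, him, hre]
      push_cast
      field_simp
      ring
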